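/- **Setting.** Let $T\ge 2$, $\delta\in(0,1)$, and let $q_1,\dots,q_T\in[0,1]$ be fixed in advance. In round $t$ a forecaster draws a prediction $p_t\in[0,1]$ from a distribution that depends on the past, an outcome $y_t\sim\mathrm{Ber}(q_t)$ is drawn independently of it, and $y_t$ is revealed. Put $$\mathrm{Cal}_2=\sum_{p:\,n(p)>0} n(p)\Big|\tfrac1{n(p)}\sum_{t:\,p_t=p}y_t-p\Big|^2,\quad n(p)=|\{t\le T:p_t=p\}|,\qquad C=\min_{x\in[0,1]}\sum_{t=1}^T|q_t-x| .$$ The forecaster knows $T$, $C$ and a number $\iota$ of order $\Theta(\log(T/\delta))$. **Framework.** Epoch $m=1,2,\dots$ has $s_m=2^m$ rounds (the last one is cut off at round $T$). In epoch $1$ the predictions are arbitrary fixed numbers in $[0,1]$. For $m\ge2$ let $\hat y_m$ be the average outcome of epoch $m-1$, $r_m=\sqrt{\iota/s_{m-1}}+C/s_{m-1}$, and $I_m=[a_m,b_m]=[\hat y_m-2r_m,\hat y_m+2r_m]\cap[0,1]$. Partition $I_m$ uniformly into $N_m=\lceil s_m^{1/3}|I_m|^{2/3}\iota^{-1/3}\rceil$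 intervals, and, for $q=0,\dots,\lceil\log_2T\rceil$, each nonempty band $$[a_m-(2^{q+1}-1)r_m,\;a_m-(2^q-1)r_m)\cap[0,1],\qquad (b_m+(2^q-1)r_m,\;b_m+(2^{q+1}-1)r_m]\cap[0,1]$$ uniformly into $K=\lceil((1+C)/\iota)^{1/3}\rceil$ intervals. Let $\Pi_m$ be the resulting partition of $[0,1]$, and let the following base algorithm run on $\Pi_m$ from scratch during epoch $m$. **Base algorithm** on a partition $\Pi$, for $n=s_m$ rounds. There are $d=2|\Pi|$ experts $(J,\sigma)\in\Pi\times\{\pm1\}$ with weights $\omega_{J,\sigma}$, initially $1/d$. In each round let $\Phi(u)=\sum_{J,\sigma}\omega_{J,\sigma}\,\sigma\,\mathbf 1\{u\in J\}$. If $\Phi(0)>0$, let $P$ be the point mass at $0$; else if $\Phi(1)\le0$, the point mass at $1$; else choose any $i\in\{0,\dots,n-1\}$ with $\Phi(\frac in)\Phi(\frac{i+1}n)\le0$ and let $P$ have masses proportional to $|\Phi(\frac{i+1}n)|$ at $\frac in$ and to $|\Phi(\frac in)|$ at $\frac{i+1}n$ (all mass at $\frac in$ if both are $0$). Draw $\tilde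 p\sim P$ and predict $\sup J$ for the $J\in\Pi$ with $\tilde p\in J$. After observing $y$, let $\ell_{J,\sigma}=\mathbb E_{u\sim P}[\sigma\mathbf 1\{u\in J\}(u-y)]$ be the gain of expert $(J,\sigma)$ and feed the loss $g=-\ell$ to MsMwC: with $L=\log(dn)$, $V_{J,\sigma}$ the sum of the squared losses of the expert in the earlier rounds of the epoch, $\eta=\min\{\frac1{64},\sqrt{L/V}\}$ and $c=g+32\eta g^2$ for each expert, the next weight vector is $$\operatorname*{argmin}\Big\{\langle v,c\rangle+\sum_{e}\tfrac1{\eta_e}\big(v_e\log\tfrac{v_e}{\omega_e}-v_e+\omega_e\big):\ \sum_e v_e=1,\ v_e\ge\tfrac1{dn}\ \forall e\Big\}.$$ **Implementation.** On a real-number machine in which elementary real operations (arithmetic, comparison, $\exp$, $\log$, roots) and random coins cost one step and every loop and list traversal is paid for, the argmin is computed as $v_e=\max\{\frac1{dn},\omega_e e^{-\eta_e(c_e+\lambda)}\}$, with $\lambda\in[-2,2]$ found by $3m$ bisection steps for $\sum_ev_e=1$ (keeping the left end point, where the sum is at least $1$), and the index $i$ is found by binary search. **Theorem.** There is an absolute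 constant $c_0>0$ such that for every $c_1\ge c_0$ there are constants $A>0$ and $k\in\mathbb N$ with the following property. For all $T\ge2$, $\delta\in(0,1)$, $\iota\in[c_0\log(T/\delta),c_1\log(T/\delta)]$, all $q_1,\dots,q_T\in[0,1]$ and all first-epoch predictions: 1. the framework with the exact base algorithm (whatever the choice of the indices $i$) satisfies, with probability at least $1-\delta$, $$\mathrm{Cal}_2\le A\big(C^{1/3}\iota^{2/3}\log^2T+\iota\log^2T\big);$$ 2. the implementation satisfies the same bound with probability at least $1-\delta$, and in every round, whatever the outcomes are, it uses at most $A\,(1+C)^{1/3}(\log T)^k$ steps, i.e. $\tilde O((1+C)^{1/3})$. -/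

import Mathlib

open scoped NNReal ENNReal

noncomputable section

namespace Calib

/-! ### Calibration error and non-stationarity -/

/-- `n(p)`: the number of rounds of the transcript `h` (pairs of a prediction and an outcome) in
which the prediction was `p`. -/
def visits (h : List (ℝ × Bool)) (p : ℝ) : ℕ := by
  classical
  exact (h.filter fun x => x.1 = p).length

/-- The number of rounds in which the prediction was `p` and the outcome was `1`. -/
def hits (h : List (ℝ × Bool)) (p : ℝ) : ℕ := by
  classical
  exact (h.filter fun x => x.1 = p ∧ x.2 = true).length

/-- The `ℓ_r`-calibration error
`∑_{p : n(p) > 0} n(p) * |(1 / n(p)) ∑_{t : p_t = p} y_t - p| ^ r` of a transcript. -/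
def calError (r : ℕ) (h : List (ℝ × Bool)) : ℝ := by
  classical
  exact ∑ p ∈ (h.map Prod.fst).toFinset,
    (visits h p : ℝ) * |(hits h p : ℝ) / (visits h p : ℝ) - p| ^ r

/-- `C = min_{x ∈ [0,1]} ∑_{t < T} |q_t - x|`. -/
def deviation (T : ℕ) (q : ℕ → ℝ) : ℝ :=
  ⨅ x : Set.Icc (0 : ℝ) 1, ∑ t ∈ Finset.range T, |q t - (x : ℝ)|

/-! ### Step-counted real-number programs

A program of type `Timed α` returns a value together with the number of steps it used.  One step
(`op`) pays for an expression of constant size built from the elementary real operations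
(`+ - * /`, absolute value, minimum, maximum, comparison, `exp`, `log`, square and cube roots), for
an operation on counters, for one random coin, or for reading or writing one record.  Everything
whose size is not constant is written as a recursion that pays for each of its steps. -/

structure Timed (α : Type) where
  val : α
  cost : ℕ

namespace Timed

instance : Monad Timed where
  pure a := ⟨a, 0⟩
  bind x f := ⟨(f x.val).val, x.cost + (f x.val).cost⟩

end Timed

/-- One step. -/
def op {α : Type} (a : α) : Timed α := ⟨a, 1⟩

/-- `2 ^ k`, by repeated doubling. -/
def pow2 (k : ℕ) : Timed ℕ := ⟨2 ^ k, k + 1⟩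

/-- `⌈x⌉`, by counting upwards from `0`. -/
def ceilT (x : ℝ) : Timed ℕ := ⟨⌈x⌉₊, ⌈x⌉₊ + 1⟩

/-- The list `[0, ..., n - 1]`. -/
def rangeT (n : ℕ) : Timed (List ℕ) := ⟨List.range n, n + 1⟩

def lengthT {α : Type} (l : List α) : Timed ℕ := ⟨l.length, l.length + 1⟩

def appendT {α : Type} (l l' : List α) : Timed (List α) := ⟨l ++ l', l.length + 1⟩

def mapT {α β : Type} (f : α → Timed β) : List α → Timed (List β)
  | [] => op []
  | a :: l => do
      let b ← f a
      let bs ← mapT f l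
      op (b :: bs)

def flatMapT {α β : Type} (f : α → Timed (List β)) : List α → Timed (List β)
  | [] => op []
  | a :: l => do
      let b ← f a
      let bs ← flatMapT f l
      appendT b bs

def zipWithT {α β γ : Type} (f : α → β → Timed γ) : List α → List β → Timed (List γ)
  | a :: l, b :: l' => do
      let c ← f a b
      let cs ← zipWithT f l l'
      op (c :: cs)
  | _, _ => op []

def sumT {α : Type} (f : α → Timed ℝ) : List α → Timed ℝ
  | [] => op 0
  | a :: l => do
      let x ← f a
      let s ← sumT f l
      op (x + s)

/-! ### Intervals and the non-uniform partition -/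

/-- An interval with end points `lo` and `hi`; the flags say which end points belong to it. -/
structure Cell where
  lo : ℝ
  hi : ℝ
  loClosed : Bool
  hiClosed : Bool

def Cell.toSet (J : Cell) : Set ℝ :=
  {x | (J.lo < x ∨ (J.loClosed = true ∧ x = J.lo)) ∧ (x < J.hi ∨ (J.hiClosed = true ∧ x = J.hi))}

/-- For an interval of positive length the right end point is the supremum, so `J.hi` is the grid
prediction `z_J`. -/
theorem Cell.isLUB_toSet (J : Cell) (h : J.lo < J.hi) : IsLUB J.toSet J.hi := by
  constructor
  · rintro x ⟨-, hx | ⟨-, hx⟩⟩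
    · exact hx.le
    · exact hx.le
  · intro b hb
    by_contra hlt
    push Not at hlt
    obtain ⟨x, hx1, hx2⟩ := exists_between (max_lt h hlt)
    have hmem : x ∈ J.toSet := ⟨Or.inl (lt_of_le_of_lt (le_max_left _ _) hx1), Or.inl hx2⟩
    exact absurd (hb hmem) (not_le.mpr (lt_of_le_of_lt (le_max_right _ _) hx1))

/-- The intersection with `[0,1]`. -/
def Cell.clip (J : Cell) : Cell where
  lo := max J.lo 0
  hi := min J.hi 1
  loClosed := by
    classical
    exact if J.lo < 0 then true else J.loClosed
  hiClosed := by
    classical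
    exact if 1 < J.hi then true else J.hiClosed

theorem Cell.toSet_clip (J : Cell) : J.clip.toSet = J.toSet ∩ Set.Icc 0 1 := by
  ext x
  simp only [Cell.toSet, Cell.clip, Set.mem_ofPred_eq, Set.mem_inter_iff, Set.mem_Icc]
  rcases lt_or_ge J.lo 0 with h0 | h0 <;> rcases lt_or_ge 1 J.hi with h1 | h1
  · simp only [h0, h1, if_true, max_eq_right h0.le, min_eq_right h1.le]
    grind
  · simp only [h0, not_lt.mpr h1, if_true, if_false, max_eq_right h0.le, min_eq_left h1]
    grind
  · simp only [not_lt.mpr h0, h1, if_true, if_false, max_eq_left h0, min_eq_right h1.le]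
    grind
  · simp only [not_lt.mpr h0, not_lt.mpr h1, if_false, max_eq_left h0, min_eq_left h1]
    grind

/-- The uniform partition of the interval `I` into `N` pieces: the pieces are
`[l + k Δ / N, l + (k + 1) Δ / N)` for `k = 0, ..., N - 1`, except that the outer end points of the
first and of the last piece are those of `I` (and belong to the piece iff they belong to `I`). -/
def unifPart (I : Cell) (N : ℕ) : Timed (List Cell) := do
  let ks ← rangeT N
  mapT (fun k => op
    { lo := I.lo + (k : ℝ) / N * (I.hi - I.lo)
      hi := if k + 1 = N then I.hi else I.lo + ((k : ℝ) + 1) / N * (I.hi - I.lo)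
      loClosed := if k = 0 then I.loClosed else true
      hiClosed := if k + 1 = N then I.hiClosed else false }) ks

/-- What the forecaster knows in advance. -/
structure Params where
  /-- the number of rounds -/
  T : ℕ
  /-- the confidence term `ι = Θ(log (T / δ))` -/
  ι : ℝ
  /-- the non-stationarity -/
  C : ℝ

/-- The radius `r = √(ι / s) + C / s`, where `s` is the length of the previous epoch. -/
def radius (P : Params) (s : ℝ) : ℝ := √(P.ι / s) + P.C / s

/-- The real number whose ceiling is `N_m`; `s` is the length of the epoch and `len = |I_m|`. -/
def innerGrid (P : Params) (s len : ℝ) : ℝ :=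
  s ^ ((1 : ℝ) / 3) * len ^ ((2 : ℝ) / 3) * P.ι ^ (-(1 : ℝ) / 3)

/-- The real number whose ceiling is the number `K` of pieces of each outer band. -/
def outerGrid (P : Params) : ℝ := ((1 + P.C) / P.ι) ^ ((1 : ℝ) / 3)

/-- The uniform partition of an outer band; an empty band contributes nothing. -/
def bandPart (B : Cell) (K : ℕ) : Timed (List Cell) := by
  classical
  exact do
    let nonempty ← op (decide (B.lo < B.hi))
    if nonempty then unifPart B K else op []

/-- The partition for epoch `m`, where `ybar` is the average outcome of epoch `m - 1`. -/
def buildPartition (P : Params) (m : ℕ) (ybar : ℝ) : Timed (List Cell) := do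
  let s' ← pow2 (m - 1)
  let s ← pow2 m
  let r ← op (radius P s')
  let I ← op (Cell.clip ⟨ybar - 2 * r, ybar + 2 * r, true, true⟩)
  let N ← ceilT (innerGrid P s (I.hi - I.lo))
  let K ← ceilT (outerGrid P)
  let inner ← unifPart I N
  let Q ← ceilT (Real.logb 2 P.T)
  let qs ← rangeT (Q + 1)
  let outer ← flatMapT (fun q => do
    let w ← pow2 q
    let L ← op (Cell.clip
      ⟨I.lo - (2 * (w : ℝ) - 1) * r, I.lo - ((w : ℝ) - 1) * r, true, false⟩)
    let R ← op (Cell.clip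
      ⟨I.hi + ((w : ℝ) - 1) * r, I.hi + (2 * (w : ℝ) - 1) * r, false, true⟩)
    let Ls ← bandPart L K
    let Rs ← bandPart R K
    appendT Ls Rs) qs
  appendT inner outer

/-! ### The base algorithm -/

/-- An expert `(J, σ)` with its current weight and its sum of squared losses so far. -/
structure Expert where
  cell : Cell
  sign : ℝ
  weight : ℝ
  sqSum : ℝ

/-- The input of a mirror-descent step for one expert: its current weight `w`, its learning rate
`η` and its corrected loss `c`. -/
structure Slot where
  w : ℝ
  η : ℝ
  c : ℝ

/-- The truncated simplex `{v : ∑ v_i = 1, v_i ≥ floor}`. -/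
def Feasible (floor : ℝ) (slots : List Slot) (v : List ℝ) : Prop :=
  v.length = slots.length ∧ (∀ x ∈ v, floor ≤ x) ∧ v.sum = 1

/-- The objective `⟨v, c⟩ + D_ψ(v, w)`, where `D_ψ` is the Bregman divergence of
`ψ(v) = ∑ (1 / η_i) v_i log v_i`. -/
def objective (slots : List Slot) (v : List ℝ) : ℝ :=
  (List.zipWith (fun (s : Slot) (x : ℝ) =>
    x * s.c + (x * Real.log (x / s.w) - x + s.w) / s.η) slots v).sum

def IsMinimizer (floor : ℝ) (slots : List Slot) (v : List ℝ) : Prop :=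
  Feasible floor slots v ∧ ∀ v', Feasible floor slots v' → objective slots v ≤ objective slots v'

/-- `1` if `u` lies in `J`, and `0` otherwise. -/
def Cell.ind (J : Cell) (u : ℝ) : ℝ := J.toSet.indicator 1 u

/-- `Φ(u) = ∑_{(J,σ)} ω_{J,σ} σ 1{u ∈ J}`. -/
def potential (es : List Expert) (u : ℝ) : Timed ℝ :=
  sumT (fun e => op (e.weight * e.sign * e.cell.ind u)) es

/-- The two subroutines of the base algorithm, for a run of `2 ^ m` rounds: `solve` carries out the
mirror-descent step of MsMwC, and `pick` finds two neighbouring grid points between which `Φ`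
changes its sign. -/
structure Subroutines where
  solve : (m : ℕ) → (floor : ℝ) → List Slot → Timed (List ℝ)
  pick : (m : ℕ) → List Expert → Timed ℕ

/-- `i` is a legal choice of a grid index. -/
def IsSignChange (m : ℕ) (es : List Expert) (i : ℕ) : Prop :=
  i < 2 ^ m ∧
    (potential es ((i : ℝ) / 2 ^ m)).val * (potential es (((i : ℝ) + 1) / 2 ^ m)).val ≤ 0

/-- The subroutines do exactly what the algorithm asks for whenever that is possible: `solve`
returns a minimizer, and `pick` returns some legal index. -/
def Subroutines.Exact (S : Subroutines) : Prop :=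
  (∀ m floor slots, (∃ v, IsMinimizer floor slots v) →
    IsMinimizer floor slots (S.solve m floor slots).val) ∧
  (∀ m es, (∃ i, IsSignChange m es i) → IsSignChange m es (S.pick m es).val)

/-- The minimizer has the form `v_i = max (floor, w_i exp (-η_i (c_i + l)))`, where the multiplier
`l` is fixed by `∑ v_i = 1`. -/
def trialWeight (floor l : ℝ) (s : Slot) : ℝ := max floor (s.w * Real.exp (-s.η * (s.c + l)))

/-- `k` bisection steps for the multiplier on `[l, r]`. -/
def bisect (floor : ℝ) (slots : List Slot) : ℕ → ℝ → ℝ → Timed ℝ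
  | 0, l, _ => op l
  | k + 1, l, r => by
      classical
      exact do
        let mid ← op ((l + r) / 2)
        let tot ← sumT (fun s => op (trialWeight floor mid s)) slots
        if 1 ≤ tot then bisect floor slots k mid r else bisect floor slots k l mid

/-- Binary search for a sign change of `Φ` among the grid points `i, ..., i + 2 ^ j` (over
`2 ^ m`). -/
def search (m : ℕ) (es : List Expert) : ℕ → ℕ → Timed ℕ
  | 0, i => op i
  | j + 1, i => by
      classical
      exact do
        let half ← pow2 j
        let n ← pow2 m
        let v ← potential es (((i + half : ℕ) : ℝ) / n)
        if v ≤ 0 then search m es j (i + half) else search m es j i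

/-- The implementation: the multiplier of the mirror-descent step is computed by `3 m` bisection
steps on `[-2, 2]`, and the sign change is found by binary search. -/
def fast : Subroutines where
  solve m floor slots := do
    let l ← bisect floor slots (3 * m) (-2) 2
    mapT (fun s => op (trialWeight floor l s)) slots
  pick m es := search m es m 0

/-- The grid prediction `z_J = sup J` for the interval `J` that contains `u`. -/
def locate : List Expert → ℝ → Timed ℝ
  | [], u => op u
  | e :: es, u => by
      classical
      exact do
        let here ← op (decide (u ∈ e.cell.toSet))
        if here then op e.cell.hi else locate es u

/-- The randomization of one round: `u₀` with probability `pr` and `u₁` with probability `1 - pr`,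
which leads to the predictions `z₀` and `z₁`. -/
structure Plan where
  u₀ : ℝ
  u₁ : ℝ
  pr : ℝ
  z₀ : ℝ
  z₁ : ℝ

/-- The distribution `P_t` of the base algorithm in a run of `2 ^ m` rounds. -/
def basePlan (S : Subroutines) (m : ℕ) (es : List Expert) : Timed Plan := by
  classical
  exact do
    let v0 ← potential es 0
    if 0 < v0 then
      let z ← locate es 0
      op ⟨0, 0, 1, z, z⟩
    else
      let v1 ← potential es 1
      if v1 ≤ 0 then
        let z ← locate es 1
        op ⟨1, 1, 1, z, z⟩
      else
        let i ← S.pick m es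
        let n ← pow2 m
        let a ← op ((i : ℝ) / n)
        let b ← op (((i : ℝ) + 1) / n)
        let fa ← potential es a
        let fb ← potential es b
        let pr ← op (if |fa| + |fb| = 0 then 1 else |fb| / (|fa| + |fb|))
        let za ← locate es a
        let zb ← locate es b
        op ⟨a, b, pr, za, zb⟩

/-- `0` or `1`. -/
def outcome (y : Bool) : ℝ := if y then 1 else 0

/-- `ℓ_{J,σ} = E_{u ∼ P_t} [σ 1{u ∈ J} (u - y)]`. -/
def expertGain (p : Plan) (y : Bool) (e : Expert) : ℝ :=
  e.sign * (p.pr * (e.cell.ind p.u₀ * (p.u₀ - outcome y)) +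
    (1 - p.pr) * (e.cell.ind p.u₁ * (p.u₁ - outcome y)))

/-- The learning rate `min {1 / 64, √(L / V)}` of MsMwC, where `L = log (d n)` for `d` experts and
`n` rounds, and `V` is the sum of the squared losses of the previous rounds. -/
def learningRate (L V : ℝ) : ℝ := (max 64 √(V / L))⁻¹

/-- The slot of an expert: MsMwC (without optimistic predictions) minimizes losses, and the loss of
an expert is `g = -ℓ`, so that the experts with large `ℓ` gain weight.  The corrected loss is
`g + 32 η g ^ 2`. -/
def expertSlot (L : ℝ) (p : Plan) (y : Bool) (e : Expert) : Slot where
  w := e.weight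
  η := learningRate L e.sqSum
  c := -expertGain p y e + 32 * learningRate L e.sqSum * (-expertGain p y e) ^ 2

/-- The step of MsMwC with `d` experts in a run of `2 ^ m` rounds, over the simplex truncated at
`1 / (d 2 ^ m)`. -/
def baseUpdate (S : Subroutines) (m : ℕ) (es : List Expert) (p : Plan) (y : Bool) :
    Timed (List Expert) := do
  let d ← lengthT es
  let n ← pow2 m
  let L ← op (Real.log ((d : ℝ) * n))
  let floor ← op (1 / ((d : ℝ) * n))
  let slots ← mapT (fun e => op (expertSlot L p y e)) es
  let ws ← S.solve m floor slots
  zipWithT (fun (e : Expert) (w : ℝ) => op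
    { e with weight := w, sqSum := e.sqSum + (-expertGain p y e) ^ 2 }) es ws

/-- The experts at the start of a run of the base algorithm: two for each interval, with uniform
weights. -/
def initExperts (cells : List Cell) : Timed (List Expert) := do
  let N ← lengthT cells
  flatMapT (fun J => op
    [⟨J, 1, 1 / (2 * (N : ℝ)), 0⟩, ⟨J, -1, 1 / (2 * (N : ℝ)), 0⟩]) cells

/-! ### The epoch-based framework -/

/-- The memory of the forecaster between two rounds: the epoch `m` (of length `2 ^ m`), the number
of rounds of this epoch that are over, the sum of their outcomes, and the experts. -/
structure State where
  m : ℕ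
  seen : ℕ
  ySum : ℝ
  experts : List Expert

def initState : State := ⟨1, 0, 0, []⟩

/-- The randomization of the next round; `first` are the predictions in the first epoch. -/
def plan (S : Subroutines) (first : ℕ → ℝ) (st : State) : Timed Plan :=
  if st.m = 1 then op ⟨first st.seen, first st.seen, 1, first st.seen, first st.seen⟩
  else basePlan S st.m st.experts

/-- The memory after the outcome `y`.  When an epoch ends, the next one is prepared. -/
def update (S : Subroutines) (P : Params) (st : State) (p : Plan) (y : Bool) : Timed State := do
  let es ← if st.m = 1 then op [] else baseUpdate S st.m st.experts p y
  let ySum ← op (st.ySum + outcome y)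
  let s ← pow2 st.m
  if st.seen + 1 = s then
    let cells ← buildPartition P (st.m + 1) (ySum / s)
    let es' ← initExperts cells
    op ⟨st.m + 1, 0, 0, es'⟩
  else
    op ⟨st.m, st.seen + 1, ySum, es⟩

/-- The memory after the given outcomes. -/
def stateAfter (S : Subroutines) (P : Params) (first : ℕ → ℝ) (ys : List Bool) : State :=
  ys.foldl (fun st y => (update S P st (plan S first st).val y).val) initState

/-- The number of steps of the round that follows the outcomes `ys` and has the outcome `y`: the
computation of the randomization, one coin, and the update. -/
def roundCost (S : Subroutines) (P : Params) (first : ℕ → ℝ) (ys : List Bool) (y : Bool) : ℕ :=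
  (plan S first (stateAfter S P first ys)).cost + 1 +
    (update S P (stateAfter S P first ys) (plan S first (stateAfter S P first ys)).val y).cost

/-- A coin that shows `true` with probability `x ∈ [0,1]`. -/
def coin (x : ℝ) : PMF Bool := PMF.bernoulli (min x.toNNReal 1) (min_le_right _ _)

/-- The law of the transcript of the first `t` rounds: the forecaster draws its prediction, and
independently nature draws the outcome with mean `q t`. -/
def law (S : Subroutines) (P : Params) (first : ℕ → ℝ) (q : ℕ → ℝ) : ℕ → PMF (List (ℝ × Bool))
  | 0 => PMF.pure []
  | t + 1 => (law S P first q t).bind fun h =>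
      let p := (plan S first (stateAfter S P first (h.map Prod.snd))).val
      (coin p.pr).bind fun b => (coin (q t)).bind fun y =>
        PMF.pure (h ++ [(if b then p.z₀ else p.z₁, y)])

end Calib

end

noncomputable section
namespace Calib

/-! ### The divergence `a log (a / b) - a + b` -/

/-! Call `E_J` the sum over an epoch of the conditional expectations of `1{u ∈ J} (u - y)`, `N_J`
the expected number of visits to the cell `J`, `n_J` the actual number, and `w_J` the width of `J`.
Everything rests on one property of the base algorithm: `|E_J| ≲ ι + √(ι N_J)` for every cell at
once (`calibration_of_epoch`). Two facts give it. The randomization makes the weighted average of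
the experts' gains `O(1/n)` whichever outcome occurs (`basePlan_spec`): at a sign change of `Φ` the
two masses balance, so that the outcome cancels. Hence `±E_J` is at most the regret of MsMwC against
the expert `(J, ±1)`, and this regret scales with the squared losses of that single expert, which
sum up to at most `N_J` (`msmwc_step`, `epoch_run`).

Calibration error follows cell by cell. Deviation inequalities of Freedman type replace expected
visits and outcomes by actual ones, and the contribution of `J` becomes at most a constant times `ι
+ n_J w_J²` (`cell_error_le`). The interval `I_m` has twice the confidence radius, and the previous
average is within one radius of the best centre `x`. So a cell of an outer band at scale `ρ` lies at
distance at least `ρ` from `x`, all on one side. Calibration then says that many visits there need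
outcomes with means far from `x`: `N_J ρ ≲ C_J + ι + √(ι N_J)`, where `C_J` is the share of `∑ |q_t
- x|` charged to `J`. As `w_J ≤ ρ / K`, this gives `n_J w_J² ≲ C_J / K² + ι` (`far_cell_le`). The
shares sum up to at most `C`, so an epoch costs about `|Π| ι + C / K² + s_m (|I_m| / N_m)²`
(`epoch_calError_le`). The grid sizes balance these terms at `ι + C^{1/3} ι^{2/3}`, up to the
logarithmic number of bands. The error is subadditive under concatenation (`calError_append_le`),
and logarithmically many epochs give the second logarithm.

The deviations are controlled by exponential supermartingales (`expect_exp_sum_le`). Since the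
variances are random, a union bound also runs over a grid of scales (`prob_not_controlled_le`,
`abs_le_of_scales`).

Exact and implemented algorithm share one analysis through `Sound`. Bisection returns weights of the
right exponential form whose sum exceeds `1` slightly; the excess grows by a factor of at most `exp
(2^{-3m})` per round and stays below `2^{-m}` over `2^m` rounds, which costs `O(1)` regret. The
running time is the number of experts, `O((1+C)^{1/3} log T)`, times the `O(log T)` steps of
bisection and binary search, plus the construction of a partition at the end of an epoch. -/

/-- The Bregman divergence of `x log x`. -/
def kl (a b : ℝ) : ℝ := a * Real.log (a / b) - a + b

theorem kl_nonneg {a b : ℝ} (ha : 0 < a) (hb : 0 < b) : 0 ≤ kl a b := by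
  have h := Real.log_le_sub_one_of_pos (div_pos hb ha)
  have h2 : Real.log (a / b) = -Real.log (b / a) := by rw [← Real.log_inv, inv_div]
  have h3 : a * (b / a) = b := by field_simp
  unfold kl
  rw [h2]
  nlinarith [mul_le_mul_of_nonneg_left h ha.le]

theorem eq_of_kl_le_zero {a b : ℝ} (ha : 0 < a) (hb : 0 < b) (h : kl a b ≤ 0) : a = b := by
  by_contra hne
  have hx : b / a ≠ 1 := fun hx => hne ((div_eq_one_iff_eq ha.ne').mp hx).symm
  have h1 := Real.log_lt_sub_one_of_pos (div_pos hb ha) hx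
  have h2 : Real.log (a / b) = -Real.log (b / a) := by rw [← Real.log_inv, inv_div]
  have h3 : a * (b / a) = b := by field_simp
  unfold kl at h
  rw [h2] at h
  nlinarith [mul_lt_mul_of_pos_left h1 ha]

/-- The three-point identity of Bregman divergences: it turns the first order condition at `v` into
a difference of divergences that telescopes over the rounds. -/
theorem kl_three_point {u v w : ℝ} (hu : 0 < u) (hv : 0 < v) (hw : 0 < w) :
    kl u w - kl u v - kl v w = (u - v) * Real.log (v / w) := by
  unfold kl
  rw [Real.log_div hu.ne' hw.ne', Real.log_div hu.ne' hv.ne', Real.log_div hv.ne' hw.ne']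
  ring

/-- Fenchel's inequality for `kl`. -/
theorem sub_le_kl_add {v w x : ℝ} (hv : 0 < v) (hw : 0 < w) :
    w - w * Real.exp (-x) ≤ kl v w + v * x := by
  have h := kl_nonneg hv (mul_pos hw (Real.exp_pos (-x)))
  unfold kl at h ⊢
  rw [Real.log_div hv.ne' (mul_pos hw (Real.exp_pos _)).ne', Real.log_mul hw.ne'
    (Real.exp_pos _).ne', Real.log_exp] at h
  rw [Real.log_div hv.ne' hw.ne']
  linarith

theorem exp_neg_le_quadratic {x : ℝ} (hx : |x| ≤ 1) : Real.exp (-x) ≤ 1 - x + x ^ 2 := by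
  have h := Real.abs_exp_sub_one_sub_id_le (x := -x) (by simpa using hx)
  have := (abs_le.mp h).2
  nlinarith

theorem exp_le_quadratic {x : ℝ} (hx : |x| ≤ 1) : Real.exp x ≤ 1 + x + x ^ 2 := by
  have := (abs_le.mp (Real.abs_exp_sub_one_sub_id_le hx)).2
  linarith

/-! ### One step of mirror descent on the truncated simplex -/

/-- The truncated exponential weight satisfies the first order optimality condition. -/
theorem trialWeight_optimality {floor l u : ℝ} {s : Slot} (hw : 0 < s.w) (hη : 0 < s.η)
    (hu : floor ≤ u) :
    0 ≤ (u - trialWeight floor l s) *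
      (s.c + l + Real.log (trialWeight floor l s / s.w) / s.η) := by
  have hx : 0 < s.w * Real.exp (-s.η * (s.c + l)) := mul_pos hw (Real.exp_pos _)
  have hlog : Real.log (s.w * Real.exp (-s.η * (s.c + l)) / s.w) = -s.η * (s.c + l) := by
    rw [mul_div_cancel_left₀ _ hw.ne', Real.log_exp]
  unfold trialWeight
  rcases le_total floor (s.w * Real.exp (-s.η * (s.c + l))) with h | h
  · rw [max_eq_right h, hlog]
    have : s.c + l + -s.η * (s.c + l) / s.η = 0 := by field_simp; ring
    rw [this, mul_zero]
  · rw [max_eq_left h]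
    refine mul_nonneg (by linarith) ?_
    have h1 : -s.η * (s.c + l) ≤ Real.log (floor / s.w) := by
      rw [← hlog]
      exact Real.log_le_log (by positivity) (by gcongr)
    have h2 : -(s.c + l) ≤ Real.log (floor / s.w) / s.η := by
      rw [le_div_iff₀ hη]; linarith
    linarith

theorem trialWeight_pos {floor l : ℝ} {s : Slot} (hf : 0 < floor) : 0 < trialWeight floor l s :=
  lt_of_lt_of_le hf (le_max_left _ _)

theorem floor_le_trialWeight (floor l : ℝ) (s : Slot) : floor ≤ trialWeight floor l s :=
  le_max_left _ _

/-- The exponent is at most `(3/2 + 2) / 64`, which is below `1/16`. The factor `2` suffices to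
charge terms in the new weight to the negative correction term, which carries the old weight. -/
theorem trialWeight_le_two_mul {floor l : ℝ} {s : Slot} (hf : 0 < floor) (hw : floor ≤ s.w)
    (hη : 0 < s.η) (hη' : s.η ≤ 1 / 64) (hc : |s.c| ≤ 3 / 2) (hl : |l| ≤ 2) :
    trialWeight floor l s ≤ 2 * s.w := by
  have hw0 : 0 < s.w := hf.trans_le hw
  have hx : |-s.η * (s.c + l)| ≤ 1 := by
    have h1 := abs_add_le s.c l
    rw [abs_mul, abs_neg, abs_of_pos hη]
    nlinarith [abs_nonneg (s.c + l)]
  have hx2 : -s.η * (s.c + l) ≤ 1 / 16 := by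
    have h1 := abs_le.mp hc
    have h2 := abs_le.mp hl
    nlinarith
  have h := Real.exp_le_exp.mpr hx2
  have h4 := exp_le_quadratic (x := 1 / 16) (by norm_num [abs_le])
  refine max_le (by linarith) ?_
  nlinarith [mul_le_mul_of_nonneg_left (h.trans h4) hw0.le]

theorem abs_corrected_le {η g : ℝ} (hη : 0 ≤ η) (hη' : η ≤ 1 / 64) (hg : |g| ≤ 1) :
    |g + 32 * η * g ^ 2| ≤ 3 / 2 * |g| := by
  have h1 := abs_add_le g (32 * η * g ^ 2)
  have h2 : |32 * η * g ^ 2| = 32 * η * |g| ^ 2 := by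
    rw [abs_of_nonneg (by positivity), sq_abs]
  rw [h2] at h1
  have h3 : 32 * η * |g| ^ 2 ≤ 1 / 2 * |g| := by
    have : 32 * η * |g| ≤ 1 / 2 := by nlinarith [abs_nonneg g]
    calc 32 * η * |g| ^ 2 = 32 * η * |g| * |g| := by ring
      _ ≤ _ := by gcongr
  linarith

section OneStep

variable {κ : Type*} [Fintype κ]

/-- Optimality of the new weights plus the three-point identity bound `⟨v - u, c⟩` by divergences,
and Fenchel's inequality pays for replacing `v` by `w` with `w η c²`. The correction `32 η g²` is
charged to the comparator `u` but credited to the played weight `w`, which leaves a negative term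
after the stability cost `9/4 · w η g²`; that term later absorbs the drift of the learning rates. -/
theorem mirror_step (s : κ → Slot) (g u : κ → ℝ) {floor l θ : ℝ} (hf : 0 < floor)
    (hw : ∀ i, floor ≤ (s i).w) (hη : ∀ i, 0 < (s i).η) (hη' : ∀ i, (s i).η ≤ 1 / 64)
    (hg : ∀ i, |g i| ≤ 1) (hc : ∀ i, (s i).c = g i + 32 * (s i).η * g i ^ 2)
    (hl : |l| ≤ 2) (hu : ∀ i, floor ≤ u i) (hu1 : ∑ i, u i = 1)
    (hv1 : 1 ≤ ∑ i, trialWeight floor l (s i)) (hvθ : ∑ i, trialWeight floor l (s i) ≤ 1 + θ) :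
    ∑ i, (s i).w * g i ≤ ∑ i, u i * g i + ∑ i, 32 * u i * (s i).η * g i ^ 2
      + ∑ i, (kl (u i) (s i).w - kl (u i) (trialWeight floor l (s i))) / (s i).η
      - ∑ i, 29 * (s i).w * (s i).η * g i ^ 2 + 2 * θ := by
  have key : ∀ i, (s i).w * g i + l * (trialWeight floor l (s i) - u i) ≤ u i * g i
      + 32 * u i * (s i).η * g i ^ 2
      + (kl (u i) (s i).w - kl (u i) (trialWeight floor l (s i))) / (s i).η
      - 29 * (s i).w * (s i).η * g i ^ 2 := by
    intro i
    have hw0 : 0 < (s i).w := hf.trans_le (hw i)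
    have hv0 : 0 < trialWeight floor l (s i) := trialWeight_pos hf
    have hopt := trialWeight_optimality (l := l) hw0 (hη i) (hu i)
    have h3 := kl_three_point (hf.trans_le (hu i)) hv0 hw0
    have hfen := sub_le_kl_add (x := (s i).η * (s i).c) hv0 hw0
    have hcg := abs_corrected_le (hη i).le (hη' i) (hg i)
    rw [← hc i] at hcg
    have hx : |(s i).η * (s i).c| ≤ 1 := by
      rw [abs_mul, abs_of_pos (hη i)]
      nlinarith [hη i, hη' i, hg i, abs_nonneg (g i), abs_nonneg (s i).c]
    have hq := exp_neg_le_quadratic hx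
    set v := trialWeight floor l (s i)
    set w := (s i).w
    set η := (s i).η
    set c := (s i).c
    have hcsq : c ^ 2 ≤ 9 / 4 * g i ^ 2 := by
      have := mul_self_le_mul_self (abs_nonneg c) hcg
      nlinarith [sq_abs c, sq_abs (g i)]
    have hcc : c = g i + 32 * η * g i ^ 2 := hc i
    have hstab : (w - v) * c - kl v w / η ≤ w * η * c ^ 2 := by
      have h5 : w * Real.exp (-(η * c)) ≤ w * (1 - η * c + (η * c) ^ 2) := by gcongr
      have h6 : -kl v w ≤ v * (η * c) - w + w * (1 - η * c + (η * c) ^ 2) := by linarith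
      have h7 : -kl v w / η ≤ (v * (η * c) - w + w * (1 - η * c + (η * c) ^ 2)) / η := by
        gcongr; exact (hη i).le
      have h8 : (v * (η * c) - w + w * (1 - η * c + (η * c) ^ 2)) / η
          = (v - w) * c + w * η * c ^ 2 := by
        have hη0 : η ≠ 0 := (hη i).ne'
        field_simp
        ring
      rw [h8, neg_div] at h7
      linarith
    have h9 : (u i - v) * (Real.log (v / w) / η)
        = (kl (u i) w - kl (u i) v) / η - kl v w / η := by
      rw [← sub_div, h3]; ring
    have h10 : (u i - v) * (c + l + Real.log (v / w) / η)
        = (u i - v) * c + (u i - v) * l + (u i - v) * (Real.log (v / w) / η) := by ring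
    rw [h10, h9] at hopt
    have h11 : w * c = w * g i + 32 * w * η * g i ^ 2 := by rw [hcc]; ring
    have h12 : u i * c = u i * g i + 32 * u i * η * g i ^ 2 := by rw [hcc]; ring
    have h13 : w * η * c ^ 2 ≤ w * η * (9 / 4 * g i ^ 2) := by
      have : 0 ≤ w * η := mul_nonneg hw0.le (hη i).le
      gcongr
    have h14 : 0 ≤ w * η * g i ^ 2 := by
      have := hη i
      positivity
    nlinarith
  have hsum := Finset.sum_le_sum fun i (_ : i ∈ Finset.univ) => key i
  simp only [Finset.sum_add_distrib, Finset.sum_sub_distrib, ← Finset.mul_sum] at hsum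
  -- The multiplier would cancel if both weight vectors summed to `1`; an excess of at most `θ`
  -- costs at most `|l| θ ≤ 2 θ`.
  have hl2 : -(2 * θ) ≤ l * (∑ i, trialWeight floor l (s i) - ∑ i, u i) := by
    rw [hu1]
    have h1 := abs_le.mp hl
    nlinarith
  linarith

end OneStep

/-! ### The learning rates -/

theorem learningRate_pos (L V : ℝ) : 0 < learningRate L V := by
  unfold learningRate; positivity

theorem learningRate_le (L V : ℝ) : learningRate L V ≤ 1 / 64 := by
  unfold learningRate
  rw [one_div]
  exact inv_anti₀ (by norm_num) (le_max_left _ _)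

theorem inv_learningRate (L V : ℝ) : (learningRate L V)⁻¹ = max 64 √(V / L) := by
  unfold learningRate; rw [inv_inv]

theorem inv_learningRate_mono {L V V' : ℝ} (hL : 0 < L) (hV : V ≤ V') :
    (learningRate L V)⁻¹ ≤ (learningRate L V')⁻¹ := by
  rw [inv_learningRate, inv_learningRate]
  gcongr

/-- With `a = 1 / η`, this is `√(a² + x) ≤ a + x / a`. The growth of `1 / η` in a round is thus of
the same order `η g²` as the correction term that has to pay for it. -/
theorem inv_learningRate_add_sub_le {L V x : ℝ} (hL : 1 ≤ L) (hx : 0 ≤ x) :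
    (learningRate L (V + x))⁻¹ - (learningRate L V)⁻¹ ≤ learningRate L V * x := by
  rw [inv_learningRate, inv_learningRate]
  have hη : learningRate L V = (max 64 √(V / L))⁻¹ := rfl
  set a := max 64 √(V / L)
  have ha : 64 ≤ a := le_max_left _ _
  have ha2 : V / L ≤ a ^ 2 := by
    rw [← Real.sqrt_le_left (by linarith)]; exact le_max_right _ _
  have hb : √((V + x) / L) ≤ a + a⁻¹ * x := by
    rw [Real.sqrt_le_left (by positivity), add_div]
    have h1 : x / L ≤ x := div_le_self hx hL
    have h2 : a * (a⁻¹ * x) = x := by field_simp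
    nlinarith [sq_nonneg (a⁻¹ * x)]
  rw [hη]
  have : max 64 √((V + x) / L) ≤ a + a⁻¹ * x :=
    max_le (by nlinarith [mul_nonneg (inv_nonneg.mpr (by linarith : (0 : ℝ) ≤ a)) hx]) hb
  linarith

/-- The regret against an expert whose squared losses sum up to `V` is at most
`regretBound L V - regretBound L 0`. -/
def regretBound (L V : ℝ) : ℝ := L * (learningRate L V)⁻¹ + 128 * √(L * (V + 1))

theorem regretBound_mono {L V V' : ℝ} (hL : 0 < L) (hV : V ≤ V') :
    regretBound L V ≤ regretBound L V' := by
  unfold regretBound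
  have := inv_learningRate_mono hL hV
  gcongr

/-- The term with `L` telescopes by the definition of `regretBound`. The term `η g²` is an increment
of `√(L (V + 1))` up to a constant, because `b - a = L g² / (b + a)` and `η (a + b) ≤ 4 L`. -/
theorem regretBound_step {L V g : ℝ} (hL : 1 ≤ L) (hV : 0 ≤ V) (hg : |g| ≤ 1) :
    32 * learningRate L V * g ^ 2 + L * ((learningRate L (V + g ^ 2))⁻¹ - (learningRate L V)⁻¹)
      ≤ regretBound L (V + g ^ 2) - regretBound L V := by
  unfold regretBound
  suffices h : 32 * learningRate L V * g ^ 2 ≤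
      128 * (√(L * (V + g ^ 2 + 1)) - √(L * (V + 1))) by linarith
  have hg2 : g ^ 2 ≤ 1 := by rw [← sq_abs]; nlinarith [abs_nonneg g]
  have hη0 := learningRate_pos L V
  set η := learningRate L V
  set a := √(L * (V + 1))
  set b := √(L * (V + g ^ 2 + 1))
  have ha2 : a ^ 2 = L * (V + 1) := Real.sq_sqrt (by positivity)
  have hb2 : b ^ 2 = L * (V + g ^ 2 + 1) := Real.sq_sqrt (by positivity)
  have ha0 : 0 < a := Real.sqrt_pos.mpr (by positivity)
  have hab : a ≤ b := Real.sqrt_le_sqrt (by nlinarith [sq_nonneg g])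
  have hdiff : (b - a) * (b + a) = L * g ^ 2 := by nlinarith
  -- `η b ≤ 2 L`
  have hηb : η * b ≤ 2 * L := by
    have hb' : b ≤ 2 * L * (max 64 √(V / L)) := by
      rw [Real.sqrt_le_left (by positivity)]
      set c := max 64 √(V / L)
      have hc : 64 ≤ c := le_max_left _ _
      have hc2 : V / L ≤ c ^ 2 := by
        rw [← Real.sqrt_le_left (by linarith)]; exact le_max_right _ _
      have hV' : V ≤ c ^ 2 * L := by rwa [div_le_iff₀ (by linarith)] at hc2
      have h1 : V + g ^ 2 + 1 ≤ 2 * (c ^ 2 * L) := by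
        nlinarith [mul_le_mul hc hc (by norm_num) (by linarith : (0:ℝ) ≤ c), sq_nonneg c]
      calc L * (V + g ^ 2 + 1) ≤ L * (2 * (c ^ 2 * L)) := by gcongr
        _ ≤ (2 * L * c) ^ 2 := by nlinarith [sq_nonneg (L * c)]
    have hηc : η * (max 64 √(V / L)) = 1 := by
      have : η = (max 64 √(V / L))⁻¹ := rfl
      rw [this]; exact inv_mul_cancel₀ (by positivity)
    calc η * b ≤ η * (2 * L * (max 64 √(V / L))) := by gcongr
      _ = 2 * L * (η * (max 64 √(V / L))) := by ring
      _ = 2 * L := by rw [hηc, mul_one]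
  have h1 : η * (b + a) ≤ 4 * L := by nlinarith
  have h2 : η * g ^ 2 * L ≤ 4 * L * (b - a) := by
    calc η * g ^ 2 * L = η * ((b - a) * (b + a)) := by rw [hdiff]; ring
      _ = η * (b + a) * (b - a) := by ring
      _ ≤ 4 * L * (b - a) := by
        have : 0 ≤ b - a := by linarith
        gcongr
  have h3 : η * g ^ 2 ≤ 4 * (b - a) := by
    have hL0 : 0 < L := by linarith
    refine le_of_mul_le_mul_right ?_ hL0
    linarith
  linarith

theorem regretBound_le {L V : ℝ} (hL : 1 ≤ L) (hV : 0 ≤ V) :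
    regretBound L V ≤ 192 * L + 129 * √(L * V) := by
  unfold regretBound
  rw [inv_learningRate]
  have h1 : L * √(V / L) = √(L * V) := by
    have : L * V = L ^ 2 * (V / L) := by field_simp
    rw [this, Real.sqrt_mul (by positivity), Real.sqrt_sq (by linarith)]
  have h2 : √(L * (V + 1)) ≤ √(L * V) + L := by
    rw [Real.sqrt_le_left (by positivity)]
    nlinarith [Real.sq_sqrt (show 0 ≤ L * V by positivity), Real.sqrt_nonneg (L * V)]
  have h3 : L * max 64 √(V / L) ≤ 64 * L + √(L * V) := by
    rw [← h1]
    have : max 64 √(V / L) ≤ 64 + √(V / L) :=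
      max_le (by linarith [Real.sqrt_nonneg (V / L)]) (by linarith)
    nlinarith
  linarith

/-! ### One step of MsMwC as a potential inequality -/

/-- This is what the truncation of the simplex is for: with `v ≥ e^{-L}` the divergence stays
bounded, so a change of the learning rate between rounds has a bounded price. -/
theorem kl_le {u v L : ℝ} (hu : 0 < u) (hu1 : u ≤ 1) (hv : Real.exp (-L) ≤ v) :
    kl u v ≤ u * L + v := by
  have hv0 : 0 < v := (Real.exp_pos _).trans_le hv
  have h1 : Real.log (u / v) ≤ L := by
    rw [Real.log_le_iff_le_exp (by positivity), div_le_iff₀ hv0]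
    have : Real.exp L * Real.exp (-L) = 1 := by rw [← Real.exp_add]; simp
    nlinarith [Real.exp_pos L]
  unfold kl
  nlinarith

/-- The potential is `∑ kl (u, weights) / η`, with the learning rate of the current round. Passing
from `η` to `η'` costs `(u L + 2 w) (1/η' - 1/η)`: the part with `u` enters `regretBound`, and the
part with `w` is at most `2 w η g²`, which the term `-29 w η g²` of `mirror_step` absorbs. -/
theorem msmwc_step {κ : Type*} [Fintype κ] (s : κ → Slot) (g u V : κ → ℝ) {floor l θ L : ℝ}
    (hL : 1 ≤ L) (hfl : floor = Real.exp (-L)) (hw : ∀ i, floor ≤ (s i).w)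
    (hη : ∀ i, (s i).η = learningRate L (V i)) (hV : ∀ i, 0 ≤ V i)
    (hg : ∀ i, |g i| ≤ 1) (hc : ∀ i, (s i).c = g i + 32 * (s i).η * g i ^ 2)
    (hl : |l| ≤ 2) (hu : ∀ i, floor ≤ u i) (hu1 : ∑ i, u i = 1)
    (hv1 : 1 ≤ ∑ i, trialWeight floor l (s i)) (hvθ : ∑ i, trialWeight floor l (s i) ≤ 1 + θ) :
    ∑ i, (s i).w * g i
      + ∑ i, kl (u i) (trialWeight floor l (s i)) * (learningRate L (V i + g i ^ 2))⁻¹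
    ≤ ∑ i, u i * g i + ∑ i, u i * (regretBound L (V i + g i ^ 2) - regretBound L (V i))
      + ∑ i, kl (u i) (s i).w * (learningRate L (V i))⁻¹ + 2 * θ := by
  have hf : 0 < floor := hfl ▸ Real.exp_pos _
  have hη0 : ∀ i, 0 < (s i).η := fun i => hη i ▸ learningRate_pos _ _
  have hη1 : ∀ i, (s i).η ≤ 1 / 64 := fun i => hη i ▸ learningRate_le _ _
  have hstep := mirror_step s g u hf hw hη0 hη1 hg hc hl hu hu1 hv1 hvθ
  have hui : ∀ i, u i ≤ 1 := fun i => by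
    rw [← hu1]
    exact Finset.single_le_sum (fun j _ => (hf.trans_le (hu j)).le) (Finset.mem_univ i)
  have key : ∀ i, 32 * u i * (s i).η * g i ^ 2
      + (kl (u i) (s i).w - kl (u i) (trialWeight floor l (s i))) / (s i).η
      - 29 * (s i).w * (s i).η * g i ^ 2
      + kl (u i) (trialWeight floor l (s i)) * (learningRate L (V i + g i ^ 2))⁻¹
      ≤ u i * (regretBound L (V i + g i ^ 2) - regretBound L (V i))
      + kl (u i) (s i).w * (learningRate L (V i))⁻¹ := by
    intro i
    have hw0 : 0 < (s i).w := hf.trans_le (hw i)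
    have hu0 : 0 < u i := hf.trans_le (hu i)
    have h1 := regretBound_step hL (hV i) (hg i)
    have h2 := inv_learningRate_add_sub_le (V := V i) hL (sq_nonneg (g i))
    have h3 := inv_learningRate_mono (L := L) (by linarith)
      (show V i ≤ V i + g i ^ 2 by nlinarith [sq_nonneg (g i)])
    have hca : |(s i).c| ≤ 3 / 2 := by
      rw [hc i]
      have := abs_corrected_le (hη0 i).le (hη1 i) (hg i)
      have := hg i
      linarith
    have h4 := trialWeight_le_two_mul hf (hw i) (hη0 i) (hη1 i) hca hl
    have h5 : kl (u i) (trialWeight floor l (s i)) ≤ u i * L + trialWeight floor l (s i) :=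
      kl_le hu0 (hui i) (hfl ▸ floor_le_trialWeight floor l (s i))
    rw [hη i, div_eq_mul_inv]
    have hη2 := learningRate_pos L (V i)
    set η := learningRate L (V i)
    set η' := learningRate L (V i + g i ^ 2)
    set v := trialWeight floor l (s i)
    have h6 : kl (u i) v * (η'⁻¹ - η⁻¹) ≤ (u i * L + 2 * (s i).w) * (η'⁻¹ - η⁻¹) :=
      mul_le_mul_of_nonneg_right (by linarith) (by linarith)
    have h7 : 2 * (s i).w * (η'⁻¹ - η⁻¹) ≤ 2 * (s i).w * (η * g i ^ 2) := by gcongr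
    have h8 : u i * (32 * η * g i ^ 2 + L * (η'⁻¹ - η⁻¹))
        ≤ u i * (regretBound L (V i + g i ^ 2) - regretBound L (V i)) := by gcongr
    have h9 : 0 ≤ (s i).w * η * g i ^ 2 := by positivity
    nlinarith
  have hsum := Finset.sum_le_sum fun i (_ : i ∈ Finset.univ) => key i
  simp only [Finset.sum_add_distrib, Finset.sum_sub_distrib] at hsum ⊢ hstep
  linarith


/-! ### Values and costs of the combinators -/

@[simp] theorem Timed.bind_val {α β : Type} (x : Timed α) (f : α → Timed β) :
    (x >>= f).val = (f x.val).val := rfl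

@[simp] theorem Timed.bind_cost {α β : Type} (x : Timed α) (f : α → Timed β) :
    (x >>= f).cost = x.cost + (f x.val).cost := rfl

@[simp] theorem op_val {α : Type} (a : α) : (op a).val = a := rfl
@[simp] theorem op_cost {α : Type} (a : α) : (op a).cost = 1 := rfl
@[simp] theorem pow2_val (k : ℕ) : (pow2 k).val = 2 ^ k := rfl
@[simp] theorem pow2_cost (k : ℕ) : (pow2 k).cost = k + 1 := rfl
@[simp] theorem ceilT_val (x : ℝ) : (ceilT x).val = ⌈x⌉₊ := rfl
@[simp] theorem rangeT_val (n : ℕ) : (rangeT n).val = List.range n := rfl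
@[simp] theorem rangeT_cost (n : ℕ) : (rangeT n).cost = n + 1 := rfl
@[simp] theorem lengthT_val {α : Type} (l : List α) : (lengthT l).val = l.length := rfl
@[simp] theorem lengthT_cost {α : Type} (l : List α) : (lengthT l).cost = l.length + 1 := rfl
@[simp] theorem appendT_val {α : Type} (l l' : List α) : (appendT l l').val = l ++ l' := rfl
@[simp] theorem appendT_cost {α : Type} (l l' : List α) :
    (appendT l l').cost = l.length + 1 := rfl

@[simp] theorem mapT_val {α β : Type} (f : α → Timed β) (l : List α) :
    (mapT f l).val = l.map fun a => (f a).val := by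
  induction l with
  | nil => rfl
  | cons a l ih => simp [mapT, ih]

@[simp] theorem flatMapT_val {α β : Type} (f : α → Timed (List β)) (l : List α) :
    (flatMapT f l).val = l.flatMap fun a => (f a).val := by
  induction l with
  | nil => rfl
  | cons a l ih => simp [flatMapT, ih]

@[simp] theorem zipWithT_val {α β γ : Type} (f : α → β → Timed γ) (l : List α) (l' : List β) :
    (zipWithT f l l').val = List.zipWith (fun a b => (f a b).val) l l' := by
  induction l generalizing l' with
  | nil => cases l' <;> rfl
  | cons a l ih =>
    cases l' with
    | nil => rfl
    | cons b l' => simp [zipWithT, ih]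

@[simp] theorem sumT_val {α : Type} (f : α → Timed ℝ) (l : List α) :
    (sumT f l).val = (l.map fun a => (f a).val).sum := by
  induction l with
  | nil => rfl
  | cons a l ih => simp [sumT, ih]

/-! ### What the analysis needs from the subroutines -/

/-- The properties of the subroutines that the analysis uses.  The total weight may exceed `1`; the
excess is governed by `ε`, with `ε = 0` for the exact base algorithm. -/
structure Sound (ε : ℝ) (S : Subroutines) : Prop where
  solve : ∀ (m : ℕ) (floor : ℝ) (slots : List Slot) (j : ℕ), 0 < floor →
    (∀ s ∈ slots, floor ≤ s.w ∧ 0 < s.η ∧ s.η ≤ 1 / 64 ∧ |s.c| ≤ 3 / 2) →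
    1 ≤ (slots.map Slot.w).sum → (slots.map Slot.w).sum ≤ Real.exp (j * (ε * (1 / 2) ^ (3 * m))) →
    ∃ l : ℝ, |l| ≤ 2 ∧ (S.solve m floor slots).val = slots.map (trialWeight floor l) ∧
      1 ≤ (slots.map (trialWeight floor l)).sum ∧
      (slots.map (trialWeight floor l)).sum ≤ Real.exp ((j + 1 : ℕ) * (ε * (1 / 2) ^ (3 * m)))
  pick : ∀ (m : ℕ) (es : List Expert), (potential es 0).val ≤ 0 → 0 < (potential es 1).val →
    IsSignChange m es (S.pick m es).val

/-- Corrected losses are at most `3/2` in absolute value, so at `l = 2` every exponent is negative,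
and at `l = -2` positive. Hence the multiplier can be sought in `[-2, 2]`. -/
theorem trialWeight_two_le {floor : ℝ} {s : Slot} (hf : 0 < floor) (hw : floor ≤ s.w)
    (hη : 0 < s.η) (hc : |s.c| ≤ 3 / 2) : trialWeight floor 2 s ≤ s.w := by
  refine max_le hw ?_
  have h1 := abs_le.mp hc
  have : Real.exp (-s.η * (s.c + 2)) ≤ 1 := Real.exp_le_one_iff.mpr (by nlinarith)
  nlinarith

theorem le_trialWeight_neg_two {floor : ℝ} {s : Slot} (hf : 0 < floor) (hw : floor ≤ s.w)
    (hη : 0 < s.η) (hc : |s.c| ≤ 3 / 2) : s.w ≤ trialWeight floor (-2) s := by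
  refine le_trans ?_ (le_max_right _ _)
  have h1 := abs_le.mp hc
  have : 1 ≤ Real.exp (-s.η * (s.c + -2)) := Real.one_le_exp (by nlinarith)
  nlinarith

/-- Since `η ≤ 1/64`, the total weight is log-Lipschitz in the multiplier, so the accuracy of the
bisection becomes a multiplicative excess of the weights. -/
theorem trialWeight_le_exp_mul {floor l r : ℝ} {s : Slot} (hf : 0 < floor) (hw : floor ≤ s.w)
    (hη : 0 < s.η) (hη' : s.η ≤ 1 / 64) (hlr : l ≤ r) :
    trialWeight floor l s ≤ Real.exp ((r - l) / 64) * trialWeight floor r s := by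
  have h0 : 1 ≤ Real.exp ((r - l) / 64) := Real.one_le_exp (by linarith)
  refine max_le ?_ ?_
  · have := floor_le_trialWeight floor r s
    nlinarith
  · calc s.w * Real.exp (-s.η * (s.c + l))
        ≤ s.w * (Real.exp ((r - l) / 64) * Real.exp (-s.η * (s.c + r))) := by
          rw [← Real.exp_add]
          have : 0 < s.w := hf.trans_le hw
          gcongr
          nlinarith
      _ = Real.exp ((r - l) / 64) * (s.w * Real.exp (-s.η * (s.c + r))) := by ring
      _ ≤ _ := by
          gcongr
          exact le_max_right _ _

/-! ### The exact subroutines -/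

theorem objective_cons (s : Slot) (slots : List Slot) (x : ℝ) (v : List ℝ) :
    objective (s :: slots) (x :: v) =
      x * s.c + kl x s.w / s.η + objective slots v := by
  simp [objective, kl]

/-- A Lagrangian lower bound with an explicit strong convexity remainder. When both vectors sum to
`1` the multiplier drops out: a nonnegative remainder gives minimality, and its vanishing only at
equality gives uniqueness. -/
theorem objective_ge {floor l : ℝ} (hf : 0 < floor) (slots : List Slot) (v : List ℝ)
    (hlen : v.length = slots.length) (hs : ∀ s ∈ slots, floor ≤ s.w ∧ 0 < s.η)
    (hv : ∀ x ∈ v, floor ≤ x) :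
    objective slots (slots.map (trialWeight floor l)) +
      (List.zipWith (fun (s : Slot) x => kl x (trialWeight floor l s) / s.η) slots v).sum
      - l * (v.sum - (slots.map (trialWeight floor l)).sum) ≤ objective slots v := by
  induction slots generalizing v with
  | nil =>
    have : v = [] := List.length_eq_zero_iff.mp hlen
    subst this
    simp [objective]
  | cons s slots ih =>
    obtain _ | ⟨x, v⟩ := v
    · simp at hlen
    have ih' := ih v (by simpa using hlen) (fun s hs' => hs s (List.mem_cons_of_mem _ hs'))
      (fun x hx => hv x (List.mem_cons_of_mem _ hx))
    obtain ⟨hw, hη⟩ := hs s List.mem_cons_self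
    have hx := hv x List.mem_cons_self
    have hopt := trialWeight_optimality (l := l) (hf.trans_le hw) hη hx
    have h3 := kl_three_point (hf.trans_le hx) (trialWeight_pos (l := l) (s := s) hf)
      (hf.trans_le hw)
    simp only [List.map_cons, List.zipWith_cons_cons, List.sum_cons, objective_cons]
    set t := trialWeight floor l s
    have h9 : (x - t) * (Real.log (t / s.w) / s.η)
        = kl x s.w / s.η - kl x t / s.η - kl t s.w / s.η := by
      rw [← sub_div, ← sub_div, h3]; ring
    have h10 : (x - t) * (s.c + l + Real.log (t / s.w) / s.η)
        = (x - t) * s.c + (x - t) * l + (x - t) * (Real.log (t / s.w) / s.η) := by ring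
    rw [h10, h9] at hopt
    linarith

theorem sum_zipWith_kl_nonneg {floor l : ℝ} (hf : 0 < floor) (slots : List Slot) (v : List ℝ)
    (hs : ∀ s ∈ slots, 0 < s.η) (hv : ∀ x ∈ v, floor ≤ x) :
    0 ≤ (List.zipWith (fun (s : Slot) x => kl x (trialWeight floor l s) / s.η) slots v).sum := by
  refine List.sum_nonneg fun y hy => ?_
  obtain ⟨i, hi, rfl⟩ := List.mem_iff_getElem.mp hy
  simp only [List.getElem_zipWith]
  refine div_nonneg (kl_nonneg (hf.trans_le (hv _ (List.getElem_mem _))) (trialWeight_pos hf))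
    (hs _ (List.getElem_mem _)).le

theorem eq_of_sum_zipWith_kl_le_zero {floor l : ℝ} (hf : 0 < floor) (slots : List Slot)
    (v : List ℝ) (hlen : v.length = slots.length) (hs : ∀ s ∈ slots, 0 < s.η)
    (hv : ∀ x ∈ v, floor ≤ x)
    (h : (List.zipWith (fun (s : Slot) x => kl x (trialWeight floor l s) / s.η) slots v).sum ≤ 0) :
    v = slots.map (trialWeight floor l) := by
  induction slots generalizing v with
  | nil => simpa using hlen
  | cons s slots ih =>
    obtain _ | ⟨x, v⟩ := v
    · simp at hlen
    simp only [List.zipWith_cons_cons, List.sum_cons] at h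
    have hx := hf.trans_le (hv x List.mem_cons_self)
    have hη := hs s List.mem_cons_self
    have hs' := fun s hs' => hs s (List.mem_cons_of_mem _ hs')
    have hv' := fun x hx => hv x (List.mem_cons_of_mem _ hx)
    have h1 := sum_zipWith_kl_nonneg (l := l) hf slots v hs' hv'
    have ht := trialWeight_pos (l := l) (s := s) hf
    have h2 := div_nonneg (kl_nonneg hx ht) hη.le
    rw [List.map_cons, ih v (by simpa using hlen) hs' hv' (by linarith),
      eq_of_kl_le_zero hx ht]
    have : kl x (trialWeight floor l s) / s.η ≤ 0 := by linarith
    rwa [div_le_iff₀ hη, zero_mul] at this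

theorem isMinimizer_iff {floor l : ℝ} (hf : 0 < floor) (slots : List Slot)
    (hs : ∀ s ∈ slots, floor ≤ s.w ∧ 0 < s.η)
    (hsum : (slots.map (trialWeight floor l)).sum = 1) (v : List ℝ) :
    IsMinimizer floor slots v ↔ v = slots.map (trialWeight floor l) := by
  have hfeas : Feasible floor slots (slots.map (trialWeight floor l)) := by
    refine ⟨by simp, fun x hx => ?_, hsum⟩
    obtain ⟨s, -, rfl⟩ := List.mem_map.mp hx
    exact floor_le_trialWeight _ _ _
  constructor
  · rintro ⟨⟨hlen, hv, hv1⟩, hmin⟩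
    have h1 := objective_ge (l := l) hf slots v hlen hs hv
    have h2 := hmin _ hfeas
    rw [hv1, hsum, sub_self, mul_zero] at h1
    exact eq_of_sum_zipWith_kl_le_zero hf slots v hlen (fun s h => (hs s h).2) hv (by linarith)
  · rintro rfl
    refine ⟨hfeas, fun v ⟨hlen, hv, hv1⟩ => ?_⟩
    have h1 := objective_ge (l := l) hf slots v hlen hs hv
    have h2 := sum_zipWith_kl_nonneg (l := l) hf slots v (fun s h => (hs s h).2) hv
    rw [hv1, hsum, sub_self, mul_zero] at h1
    linarith

theorem continuous_sum_trialWeight (floor : ℝ) (slots : List Slot) :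
    Continuous fun l => (slots.map (trialWeight floor l)).sum := by
  induction slots with
  | nil => simpa using continuous_const
  | cons s slots ih =>
    simp only [List.map_cons, List.sum_cons]
    refine Continuous.add ?_ ih
    unfold trialWeight
    fun_prop

theorem exists_isSignChange (m : ℕ) (es : List Expert) (h0 : (potential es 0).val ≤ 0)
    (h1 : 0 < (potential es 1).val) : ∃ i, IsSignChange m es i := by
  by_contra! hne
  have : ∀ i : ℕ, i ≤ 2 ^ m → (potential es ((i : ℝ) / 2 ^ m)).val ≤ 0 := by
    intro i
    induction i with
    | zero => intro _; simpa using h0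
    | succ i ih =>
      intro hi
      have h2 := ih (by omega)
      by_contra! h3
      refine hne i ⟨by omega, ?_⟩
      push_cast at h3
      nlinarith
  have h4 := this (2 ^ m) le_rfl
  rw [Nat.cast_pow, Nat.cast_ofNat, div_self (by positivity)] at h4
  linarith

/-- The total trial weight is continuous in the multiplier and crosses `1` on `[-2, 2]`. The trial
vector at the crossing is the unique minimizer, so any exact solver must return it. -/
theorem Subroutines.Exact.sound {S : Subroutines} (hS : S.Exact) : Sound 0 S where
  solve m floor slots j hf hs h1 h2 := by
    simp only [zero_mul, mul_zero, Real.exp_zero] at h2 ⊢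
    have hG := continuous_sum_trialWeight floor slots
    have hlow : 1 ≤ (slots.map (trialWeight floor (-2))).sum :=
      h1.trans (List.sum_le_sum fun s h =>
        le_trialWeight_neg_two hf (hs s h).1 (hs s h).2.1 (hs s h).2.2.2)
    have hhigh : (slots.map (trialWeight floor 2)).sum ≤ 1 :=
      (List.sum_le_sum fun s h =>
        trialWeight_two_le hf (hs s h).1 (hs s h).2.1 (hs s h).2.2.2).trans h2
    obtain ⟨l, ⟨hl1, hl2⟩, hl⟩ := intermediate_value_Icc' (by norm_num : (-2 : ℝ) ≤ 2)
      hG.continuousOn ⟨hhigh, hlow⟩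
    have hiff := isMinimizer_iff hf slots (fun s h => ⟨(hs s h).1, (hs s h).2.1⟩) hl
    refine ⟨l, abs_le.mpr ⟨hl1, hl2⟩, ?_, hl.ge, hl.le⟩
    exact (hiff _).mp (hS.1 m floor slots ⟨_, (hiff _).mpr rfl⟩)
  pick m es h0 h1 := hS.2 m es (exists_isSignChange m es h0 h1)

/-! ### The fast subroutines -/

/-- The right end point either is still the initial `2` or is a midpoint where the sum was below
`1`. The alternative is needed because the old weights may already exceed `1`, and then the sum at
`2` may as well. -/
theorem bisect_spec {floor : ℝ} (slots : List Slot) (k : ℕ) (l r : ℝ) (hlr : l ≤ r)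
    (hl : 1 ≤ (slots.map (trialWeight floor l)).sum)
    (hr : r = 2 ∨ (slots.map (trialWeight floor r)).sum ≤ 1) :
    ∃ r', l ≤ (bisect floor slots k l r).val ∧ r' ≤ r ∧
      r' - (bisect floor slots k l r).val = (r - l) * (1 / 2) ^ k ∧
      1 ≤ (slots.map (trialWeight floor (bisect floor slots k l r).val)).sum ∧
      (r' = 2 ∨ (slots.map (trialWeight floor r')).sum ≤ 1) := by
  induction k generalizing l r with
  | zero => exact ⟨r, le_rfl, le_rfl, by simp [bisect], hl, hr⟩
  | succ k ih =>
    unfold bisect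
    simp only [Timed.bind_val, op_val, sumT_val]
    split_ifs with h
    · obtain ⟨r', h1, h2, h3, h4, h5⟩ := ih ((l + r) / 2) r (by linarith) h hr
      exact ⟨r', by linarith, h2, by rw [h3]; ring, h4, h5⟩
    · obtain ⟨r', h1, h2, h3, h4, h5⟩ := ih l ((l + r) / 2) (by linarith) hl
        (Or.inr (not_le.mp h).le)
      exact ⟨r', h1, by linarith, by rw [h3]; ring, h4, h5⟩

/-- Invariant of the binary search: `Φ ≤ 0` at the left end of the window and `Φ > 0` at the right
end. -/
theorem search_spec (m : ℕ) (es : List Expert) (j i : ℕ) (hij : i + 2 ^ j ≤ 2 ^ m)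
    (h0 : (potential es ((i : ℝ) / 2 ^ m)).val ≤ 0)
    (h1 : 0 < (potential es (((i + 2 ^ j : ℕ) : ℝ) / 2 ^ m)).val) :
    IsSignChange m es (search m es j i).val := by
  induction j generalizing i with
  | zero =>
    refine ⟨by simp [search] at hij ⊢; omega, ?_⟩
    simp only [search, op_val]
    rw [pow_zero, Nat.cast_add, Nat.cast_one] at h1
    nlinarith
  | succ j ih =>
    unfold search
    simp only [Timed.bind_val, pow2_val]
    have hc : (((2 ^ m : ℕ) : ℝ)) = 2 ^ m := by push_cast; rfl
    rw [hc]
    have h2 : i + 2 ^ (j + 1) = i + 2 ^ j + 2 ^ j := by ring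
    have h3 : 0 < 2 ^ j := by positivity
    split_ifs with h
    · exact ih _ (by omega) h (by rwa [← h2])
    · exact ih _ (by omega) h0 (not_le.mp h)

/-- After `3 m` halvings of `[-2, 2]` the bracket has length `4 · 2^{-3m}`, hence the sum at its
left end exceeds that at its right end by a factor of at most `exp (2^{-3m} / 16)`. The sum at the
right end is at most the larger of `1` and the old total weight, so one round adds at most one unit
`2^{-3m}` to the exponent. -/
theorem fast_sound : Sound 1 fast where
  solve m floor slots j hf hs h1 h2 := by
    have hlow : 1 ≤ (slots.map (trialWeight floor (-2))).sum :=
      h1.trans (List.sum_le_sum fun s h =>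
        le_trialWeight_neg_two hf (hs s h).1 (hs s h).2.1 (hs s h).2.2.2)
    have hhigh : (slots.map (trialWeight floor 2)).sum ≤ (slots.map Slot.w).sum :=
      List.sum_le_sum fun s h => trialWeight_two_le hf (hs s h).1 (hs s h).2.1 (hs s h).2.2.2
    obtain ⟨r, hl1, hl2, hl3, hl4, hl5⟩ :=
      bisect_spec (floor := floor) slots (3 * m) (-2) 2 (by norm_num) hlow (Or.inl rfl)
    set l := (bisect floor slots (3 * m) (-2) 2).val with hl
    have hp : (0 : ℝ) < (1 / 2) ^ (3 * m) := by positivity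
    have hlr : l ≤ r := by linarith
    refine ⟨l, abs_le.mpr ⟨hl1, hlr.trans hl2⟩, ?_, hl4, ?_⟩
    · simp [fast, hl]
    · have hr : (slots.map (trialWeight floor r)).sum ≤ Real.exp (j * (1 * (1 / 2) ^ (3 * m))) := by
        rcases hl5 with rfl | h
        · exact hhigh.trans h2
        · exact h.trans (Real.one_le_exp (by positivity))
      calc (slots.map (trialWeight floor l)).sum
          ≤ (slots.map fun s => Real.exp ((r - l) / 64) * trialWeight floor r s).sum :=
            List.sum_le_sum fun s h =>
              trialWeight_le_exp_mul hf (hs s h).1 (hs s h).2.1 (hs s h).2.2.1 hlr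
        _ = Real.exp ((r - l) / 64) * (slots.map (trialWeight floor r)).sum := by
            rw [List.sum_map_mul_left]
        _ ≤ Real.exp ((r - l) / 64) * Real.exp (j * (1 * (1 / 2) ^ (3 * m))) := by gcongr
        _ ≤ _ := by
            rw [← Real.exp_add]
            gcongr
            push_cast
            linarith
  pick m es h0 h1 := by
    refine search_spec m es m 0 (by simp) (by simpa using h0) ?_
    rw [zero_add, Nat.cast_pow, Nat.cast_ofNat, div_self (by positivity)]
    exact h1


/-! ### Cells, gains and plans -/

theorem Cell.ind_of_mem {J : Cell} {u : ℝ} (h : u ∈ J.toSet) : J.ind u = 1 := by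
  simp [Cell.ind, h]

theorem Cell.ind_of_notMem {J : Cell} {u : ℝ} (h : u ∉ J.toSet) : J.ind u = 0 := by
  simp [Cell.ind, h]

theorem Cell.ind_eq_or (J : Cell) (u : ℝ) : J.ind u = 0 ∨ J.ind u = 1 := by
  by_cases h : u ∈ J.toSet
  · exact Or.inr (ind_of_mem h)
  · exact Or.inl (ind_of_notMem h)

theorem Cell.ind_nonneg (J : Cell) (u : ℝ) : 0 ≤ J.ind u := by
  rcases J.ind_eq_or u with h | h <;> rw [h]; norm_num

theorem Cell.ind_le_one (J : Cell) (u : ℝ) : J.ind u ≤ 1 := by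
  rcases J.ind_eq_or u with h | h <;> rw [h]; norm_num

theorem Cell.mem_of_ind {J : Cell} {u : ℝ} (h : J.ind u ≠ 0) : u ∈ J.toSet := by
  by_contra h'
  exact h (ind_of_notMem h')

theorem outcome_mem (y : Bool) : outcome y ∈ Set.Icc (0 : ℝ) 1 := by
  cases y <;> simp [outcome]

/-- `E_{u ∼ p} [1{u ∈ J}]`. -/
def Plan.prob (p : Plan) (J : Cell) : ℝ := p.pr * J.ind p.u₀ + (1 - p.pr) * J.ind p.u₁

/-- `E_{u ∼ p} [1{u ∈ J} (u - y)]`. -/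
def Plan.gain (p : Plan) (y : Bool) (J : Cell) : ℝ :=
  p.pr * (J.ind p.u₀ * (p.u₀ - outcome y)) + (1 - p.pr) * (J.ind p.u₁ * (p.u₁ - outcome y))

theorem expertGain_eq (p : Plan) (y : Bool) (e : Expert) :
    expertGain p y e = e.sign * p.gain y e.cell := rfl

/-- A randomization over `[0,1]` whose predictions are the grid predictions of `cells`. -/
structure Plan.Legal (cells : List Cell) (p : Plan) : Prop where
  pr : p.pr ∈ Set.Icc (0 : ℝ) 1
  u₀ : p.u₀ ∈ Set.Icc (0 : ℝ) 1
  u₁ : p.u₁ ∈ Set.Icc (0 : ℝ) 1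
  z₀ : ∃ J : Fin cells.length, p.u₀ ∈ (cells.get J).toSet ∧ p.z₀ = (cells.get J).hi
  z₁ : ∃ J : Fin cells.length, p.u₁ ∈ (cells.get J).toSet ∧ p.z₁ = (cells.get J).hi

theorem Plan.prob_nonneg {p : Plan} (h : p.pr ∈ Set.Icc (0 : ℝ) 1) (J : Cell) : 0 ≤ p.prob J :=
  add_nonneg (mul_nonneg h.1 (J.ind_nonneg _))
    (mul_nonneg (by linarith [h.2]) (J.ind_nonneg _))

theorem Plan.prob_le_one {p : Plan} (h : p.pr ∈ Set.Icc (0 : ℝ) 1) (J : Cell) :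
    p.prob J ≤ 1 := by
  unfold Plan.prob
  nlinarith [h.1, h.2, J.ind_le_one p.u₀, J.ind_le_one p.u₁]

theorem abs_sub_outcome_le {u : ℝ} (hu : u ∈ Set.Icc (0 : ℝ) 1) (y : Bool) :
    |u - outcome y| ≤ 1 := by
  have := outcome_mem y
  rw [abs_le]
  constructor <;> linarith [hu.1, hu.2, this.1, this.2]

theorem Plan.abs_gain_le {p : Plan} (h : p.pr ∈ Set.Icc (0 : ℝ) 1)
    (h0 : p.u₀ ∈ Set.Icc (0 : ℝ) 1) (h1 : p.u₁ ∈ Set.Icc (0 : ℝ) 1) (y : Bool) (J : Cell) :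
    |p.gain y J| ≤ p.prob J := by
  have h2 := abs_sub_outcome_le h0 y
  have h3 := abs_sub_outcome_le h1 y
  have h4 : 0 ≤ 1 - p.pr := by linarith [h.2]
  unfold Plan.gain Plan.prob
  refine (abs_add_le _ _).trans ?_
  rw [abs_mul, abs_mul, abs_mul, abs_mul, abs_of_nonneg h.1, abs_of_nonneg h4,
    abs_of_nonneg (J.ind_nonneg _), abs_of_nonneg (J.ind_nonneg _)]
  have h5 := mul_le_mul_of_nonneg_left h2 (J.ind_nonneg p.u₀)
  have h6 := mul_le_mul_of_nonneg_left h3 (J.ind_nonneg p.u₁)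
  have h7 := mul_le_mul_of_nonneg_left h5 h.1
  have h8 := mul_le_mul_of_nonneg_left h6 h4
  linarith

/-! ### The distribution of the base algorithm -/

theorem locate_cons (e : Expert) (es : List Expert) (u : ℝ) [Decidable (u ∈ e.cell.toSet)] :
    (locate (e :: es) u).val = if u ∈ e.cell.toSet then e.cell.hi else (locate es u).val := by
  by_cases h : u ∈ e.cell.toSet <;> simp [locate, h]

open Classical in
theorem locate_spec {es : List Expert} {u : ℝ} (h : ∃ e ∈ es, u ∈ e.cell.toSet) :
    ∃ e ∈ es, u ∈ e.cell.toSet ∧ (locate es u).val = e.cell.hi := by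
  induction es with
  | nil => simp at h
  | cons e es ih =>
    rw [locate_cons]
    split_ifs with hu
    · exact ⟨e, List.mem_cons_self, hu, rfl⟩
    · obtain ⟨e', he', hu'⟩ := h
      rcases List.mem_cons.mp he' with rfl | he'
      · exact absurd hu' hu
      · obtain ⟨e₂, h1, h2⟩ := ih ⟨e', he', hu'⟩
        exact ⟨e₂, List.mem_cons_of_mem _ h1, h2⟩

/-- The masses are chosen so that `Φ` has mean `0`; therefore neither `y` nor the common location
matters, and only `Φ` times the grid spacing remains. -/
theorem mix_le {a b n W fa fb y : ℝ} (hn : 0 < n) (hab : b = a + 1 / n)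
    (hsgn : fa * fb ≤ 0) (ha : |fa| ≤ W) :
    (if |fa| + |fb| = 0 then 1 else |fb| / (|fa| + |fb|)) * (fa * (a - y)) +
      (1 - (if |fa| + |fb| = 0 then 1 else |fb| / (|fa| + |fb|))) * (fb * (b - y)) ≤ W / n := by
  have hW : 0 ≤ W := (abs_nonneg _).trans ha
  split_ifs with h
  · have : fa = 0 := by
      have := abs_nonneg fa; have := abs_nonneg fb
      exact abs_eq_zero.mp (by linarith)
    rw [this]
    simp only [zero_mul, mul_zero, sub_self, add_zero]
    positivity
  · have hs : 0 < |fa| + |fb| :=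
      lt_of_le_of_ne (add_nonneg (abs_nonneg _) (abs_nonneg _)) (Ne.symm h)
    have h1 : 1 - |fb| / (|fa| + |fb|) = |fa| / (|fa| + |fb|) := by field_simp; ring
    rw [h1, div_mul_eq_mul_div, div_mul_eq_mul_div, ← add_div, div_le_div_iff₀ hs hn, hab]
    have h2 : |fb| * fa + |fa| * fb = 0 := by
      rcases le_total 0 fa with h3 | h3 <;> rcases le_total 0 fb with h4 | h4
      · have : fa * fb = 0 := le_antisymm hsgn (mul_nonneg h3 h4)
        rw [abs_of_nonneg h3, abs_of_nonneg h4]; linarith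
      · rw [abs_of_nonneg h3, abs_of_nonpos h4]; ring
      · rw [abs_of_nonpos h3, abs_of_nonneg h4]; ring
      · have : fa * fb = 0 := le_antisymm hsgn (by nlinarith)
        rw [abs_of_nonpos h3, abs_of_nonpos h4]; linarith
    have h3 : (|fb| * (fa * (a - y)) + |fa| * (fb * (a + 1 / n - y))) * n = |fa| * fb := by
      have : |fb| * (fa * (a - y)) + |fa| * (fb * (a + 1 / n - y)) =
        (|fb| * fa + |fa| * fb) * (a - y) + |fa| * fb / n := by ring
      rw [this, h2]
      field_simp
      ring
    rw [h3]
    have h4 := abs_nonneg fa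
    have h5 := le_abs_self fb
    have h6 := abs_nonneg fb
    nlinarith [mul_le_mul_of_nonneg_left h5 h4, mul_le_mul_of_nonneg_right ha h6]

/-- The mean of `Φ(u) (u - y)` is nearly nonpositive for every `y ∈ [0,1]`. At an end point of
`[0,1]` the sign of `u - y` is known and the rule for `P` makes it opposite to that of `Φ`;
otherwise the two neighbouring grid points cancel. -/
theorem basePlan_spec {ε : ℝ} {S : Subroutines} (hS : Sound ε S) (m : ℕ) (es : List Expert) :
    let p := (basePlan S m es).val
    let Φ := fun u => (potential es u).val
    p.pr ∈ Set.Icc (0 : ℝ) 1 ∧ p.u₀ ∈ Set.Icc (0 : ℝ) 1 ∧ p.u₁ ∈ Set.Icc (0 : ℝ) 1 ∧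
      p.z₀ = (locate es p.u₀).val ∧ p.z₁ = (locate es p.u₁).val ∧
      ∀ W y, (∀ u, |Φ u| ≤ W) → y ∈ Set.Icc (0 : ℝ) 1 →
        p.pr * (Φ p.u₀ * (p.u₀ - y)) + (1 - p.pr) * (Φ p.u₁ * (p.u₁ - y)) ≤ W / 2 ^ m := by
  intro p Φ
  have hp : p = (basePlan S m es).val := rfl
  unfold basePlan at hp
  simp only [Timed.bind_val] at hp
  by_cases h0 : 0 < (potential es 0).val
  · rw [if_pos h0] at hp
    simp only [Timed.bind_val, op_val] at hp
    rw [hp]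
    refine ⟨by simp, by simp, by simp, rfl, rfl, fun W y hW hy => ?_⟩
    have hW0 : 0 ≤ W := (abs_nonneg _).trans (hW 0)
    have h2 : (0 : ℝ) ≤ W / 2 ^ m := by positivity
    have h3 : 0 < Φ 0 := h0
    dsimp only
    nlinarith [hy.1]
  rw [if_neg h0] at hp
  simp only [Timed.bind_val] at hp
  by_cases h1 : (potential es 1).val ≤ 0
  · rw [if_pos h1] at hp
    simp only [Timed.bind_val, op_val] at hp
    rw [hp]
    refine ⟨by simp, by simp, by simp, rfl, rfl, fun W y hW hy => ?_⟩
    have hW0 : 0 ≤ W := (abs_nonneg _).trans (hW 0)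
    have h2 : (0 : ℝ) ≤ W / 2 ^ m := by positivity
    have h3 : Φ 1 ≤ 0 := h1
    dsimp only
    nlinarith [hy.2]
  · rw [if_neg h1] at hp
    simp only [Timed.bind_val, op_val, pow2_val, Nat.cast_pow, Nat.cast_ofNat] at hp
    obtain ⟨hi, hsgn⟩ := hS.pick m es (not_lt.mp h0) (not_le.mp h1)
    set i := (S.pick m es).val
    have hn : (0 : ℝ) < 2 ^ m := by positivity
    have hi' : (i : ℝ) + 1 ≤ 2 ^ m := by exact_mod_cast hi
    rw [hp]
    refine ⟨?_, ⟨by positivity, ?_⟩, ⟨by positivity, ?_⟩, rfl, rfl, fun W y hW hy => ?_⟩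
    · dsimp only
      split_ifs with h
      · simp
      · exact ⟨by positivity,
          div_le_one_of_le₀ (le_add_of_nonneg_left (abs_nonneg _)) (by positivity)⟩
    · exact div_le_one_of_le₀ (by linarith) hn.le
    · exact div_le_one_of_le₀ hi' hn.le
    · exact mix_le hn (by ring) hsgn (hW _)

/-! ### Experts indexed by a cell and a sign -/

/-- The order of the experts in the list. -/
def expertOrder (N : ℕ) : List (Fin N × Bool) :=
  (List.finRange N).flatMap fun J => [(J, true), (J, false)]

theorem mem_expertOrder {N : ℕ} (i : Fin N × Bool) : i ∈ expertOrder N := by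
  rcases i with ⟨J, _ | _⟩ <;> simp [expertOrder]

theorem length_expertOrder (N : ℕ) : (expertOrder N).length = 2 * N := by
  simp [expertOrder, List.length_flatMap, mul_comm]

theorem sum_expertOrder {N : ℕ} (f : Fin N × Bool → ℝ) :
    ((expertOrder N).map f).sum = ∑ i, f i := by
  rw [Fintype.sum_prod_type, expertOrder, List.map_flatMap, List.flatMap_def, List.sum_flatten,
    List.map_map]
  rw [← List.ofFn_id, List.map_ofFn, List.sum_ofFn]
  simp

/-- The sign `σ ∈ {±1}`. -/
def sgn (σ : Bool) : ℝ := if σ then 1 else -1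

theorem abs_sgn (σ : Bool) : |sgn σ| = 1 := by cases σ <;> simp [sgn]

/-- `log (d n)` for two experts per cell and `2 ^ m` rounds. -/
def logSize (N m : ℕ) : ℝ := Real.log (2 * N * 2 ^ m)

/-- The state of the experts of a run on `cells` of `2 ^ m` rounds after `j` rounds. -/
structure Pool (ε : ℝ) (cells : List Cell) (m j : ℕ) (es : List Expert)
    (E : Fin cells.length × Bool → Expert) : Prop where
  eq : es = (expertOrder cells.length).map E
  cell : ∀ i, (E i).cell = cells.get i.1
  sign : ∀ i, (E i).sign = sgn i.2
  floor : ∀ i, Real.exp (-logSize cells.length m) ≤ (E i).weight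
  one_le : 1 ≤ ∑ i, (E i).weight
  le_exp : ∑ i, (E i).weight ≤ Real.exp (j * (ε * (1 / 2) ^ (3 * m)))
  sqSum : ∀ i, 0 ≤ (E i).sqSum

variable {ε : ℝ} {cells : List Cell} {m j : ℕ} {es : List Expert}
  {E : Fin cells.length × Bool → Expert}

theorem Pool.sum_eq (h : Pool ε cells m j es E) (f : Expert → ℝ) :
    (es.map f).sum = ∑ i, f (E i) := by
  rw [h.eq, List.map_map, sum_expertOrder]
  rfl

theorem Pool.length (h : Pool ε cells m j es E) : es.length = 2 * cells.length := by
  rw [h.eq, List.length_map, length_expertOrder]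

theorem exp_neg_logSize {N : ℕ} (hN : 0 < N) (m : ℕ) :
    Real.exp (-logSize N m) = 1 / (2 * N * 2 ^ m) := by
  rw [logSize, Real.exp_neg, Real.exp_log (by positivity), one_div]

theorem one_le_logSize {N m : ℕ} (hN : 0 < N) (hm : 1 ≤ m) : 1 ≤ logSize N m := by
  rw [logSize, Real.le_log_iff_exp_le (by positivity)]
  have h1 : (2 : ℝ) ≤ 2 ^ m := by
    calc (2 : ℝ) = 2 ^ 1 := by norm_num
      _ ≤ 2 ^ m := pow_le_pow_right₀ (by norm_num) hm
  have h2 : (1 : ℝ) ≤ N := by exact_mod_cast hN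
  have h3 := Real.exp_one_lt_d9
  nlinarith [mul_le_mul h2 h1 (by norm_num) (by linarith)]

theorem initExperts_val (cells : List Cell) :
    (initExperts cells).val = (expertOrder cells.length).map fun i =>
      ⟨cells.get i.1, sgn i.2, 1 / (2 * (cells.length : ℝ)), 0⟩ := by
  have h : (initExperts cells).val = cells.flatMap fun J =>
      [⟨J, 1, 1 / (2 * (cells.length : ℝ)), 0⟩, ⟨J, -1, 1 / (2 * (cells.length : ℝ)), 0⟩] := by
    simp [initExperts]
  rw [h]
  generalize 1 / (2 * (cells.length : ℝ)) = c
  conv_lhs => rw [← List.map_get_finRange cells, List.flatMap_map]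
  simp [expertOrder, List.map_flatMap, sgn]

theorem pool_initExperts (hc : 0 < cells.length) (m : ℕ) :
    Pool ε cells m 0 (initExperts cells).val fun i =>
      ⟨cells.get i.1, sgn i.2, 1 / (2 * (cells.length : ℝ)), 0⟩ where
  eq := initExperts_val cells
  cell _ := rfl
  sign _ := rfl
  floor i := by
    rw [exp_neg_logSize hc]
    have h1 : (1 : ℝ) ≤ 2 ^ m := one_le_pow₀ (by norm_num)
    have h2 : (0 : ℝ) < cells.length := by exact_mod_cast hc
    refine one_div_le_one_div_of_le (by positivity) ?_
    nlinarith
  one_le := by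
    have h2 : (cells.length : ℝ) ≠ 0 := by exact_mod_cast hc.ne'
    simp only [Finset.sum_const, Finset.card_univ, Fintype.card_prod, Fintype.card_fin,
      Fintype.card_bool, nsmul_eq_mul, Nat.cast_mul, Nat.cast_ofNat]
    field_simp
    norm_num
  le_exp := by
    have h2 : (cells.length : ℝ) ≠ 0 := by exact_mod_cast hc.ne'
    simp only [Finset.sum_const, Finset.card_univ, Fintype.card_prod, Fintype.card_fin,
      Fintype.card_bool, nsmul_eq_mul, Nat.cast_mul, Nat.cast_ofNat, Nat.cast_zero, zero_mul,
      Real.exp_zero]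
    field_simp
    norm_num
  sqSum _ := le_rfl

theorem Pool.potential_eq (h : Pool ε cells m j es E) (u : ℝ) :
    (potential es u).val = ∑ i, (E i).weight * sgn i.2 * (cells.get i.1).ind u := by
  simp only [potential, sumT_val, op_val]
  rw [h.sum_eq]
  exact Finset.sum_congr rfl fun i _ => by rw [h.sign, h.cell]

theorem Pool.weight_pos (h : Pool ε cells m j es E) (i) : 0 < (E i).weight :=
  (Real.exp_pos _).trans_le (h.floor i)

theorem Pool.abs_potential_le (h : Pool ε cells m j es E) (u : ℝ) :
    |(potential es u).val| ≤ ∑ i, (E i).weight := by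
  rw [h.potential_eq]
  refine (Finset.abs_sum_le_sum_abs _ _).trans (Finset.sum_le_sum fun i _ => ?_)
  rw [abs_mul, abs_mul, abs_sgn, abs_of_pos (h.weight_pos i), abs_of_nonneg (Cell.ind_nonneg _ _)]
  nlinarith [h.weight_pos i, (cells.get i.1).ind_le_one u]

theorem Pool.sum_weight_gain (h : Pool ε cells m j es E) (p : Plan) (y : Bool) :
    ∑ i, (E i).weight * expertGain p y (E i) =
      p.pr * ((potential es p.u₀).val * (p.u₀ - outcome y)) +
      (1 - p.pr) * ((potential es p.u₁).val * (p.u₁ - outcome y)) := by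
  rw [h.potential_eq, h.potential_eq]
  simp only [Finset.sum_mul, Finset.mul_sum]
  rw [← Finset.sum_add_distrib]
  refine Finset.sum_congr rfl fun i _ => ?_
  simp only [expertGain, h.sign, h.cell]
  ring

theorem Pool.sum_weight_gain_le (h : Pool ε cells m j es E) {S : Subroutines} (hS : Sound ε S)
    (y : Bool) :
    ∑ i, (E i).weight * expertGain (basePlan S m es).val y (E i) ≤
      (∑ i, (E i).weight) / 2 ^ m := by
  rw [h.sum_weight_gain]
  exact (basePlan_spec hS m es).2.2.2.2.2 _ _ h.abs_potential_le (outcome_mem y)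

/-- The cells contain every number of `[0,1]` exactly once. -/
def Covers (cells : List Cell) : Prop :=
  ∀ u ∈ Set.Icc (0 : ℝ) 1, ∑ J : Fin cells.length, (cells.get J).ind u = 1

theorem Covers.exists_mem (hc : Covers cells) {u : ℝ} (hu : u ∈ Set.Icc (0 : ℝ) 1) :
    ∃ J : Fin cells.length, u ∈ (cells.get J).toSet := by
  by_contra! hne
  have := hc u hu
  rw [Finset.sum_eq_zero fun J _ => Cell.ind_of_notMem (hne J)] at this
  norm_num at this

theorem Pool.legal (h : Pool ε cells m j es E) {S : Subroutines} (hS : Sound ε S)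
    (hc : Covers cells) : (basePlan S m es).val.Legal cells := by
  obtain ⟨h1, h2, h3, h4, h5, -⟩ := basePlan_spec hS m es
  have key : ∀ u ∈ Set.Icc (0 : ℝ) 1, ∃ J : Fin cells.length,
      u ∈ (cells.get J).toSet ∧ (locate es u).val = (cells.get J).hi := by
    intro u hu
    obtain ⟨J, hJ⟩ := hc.exists_mem hu
    obtain ⟨e, he, hu', hz⟩ := locate_spec (es := es) (u := u)
      ⟨E (J, true), by rw [h.eq]; exact List.mem_map_of_mem (mem_expertOrder _),
        by rw [h.cell]; exact hJ⟩
    rw [h.eq] at he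
    obtain ⟨i, -, rfl⟩ := List.mem_map.mp he
    rw [h.cell] at hu' hz
    exact ⟨i.1, hu', hz⟩
  obtain ⟨J, hJ, hJ'⟩ := key _ h2
  obtain ⟨J', hJ2, hJ2'⟩ := key _ h3
  exact ⟨h1, h2, h3, ⟨J, hJ, h4.trans hJ'⟩, ⟨J', hJ2, h5.trans hJ2'⟩⟩

/-! ### One round of the base algorithm -/

theorem baseUpdate_val (S : Subroutines) (m : ℕ) (es : List Expert) (p : Plan) (y : Bool) :
    (baseUpdate S m es p y).val = List.zipWith
      (fun (e : Expert) (w : ℝ) =>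
        { e with weight := w, sqSum := e.sqSum + (-expertGain p y e) ^ 2 }) es
      (S.solve m (1 / ((es.length : ℝ) * 2 ^ m))
        (es.map (expertSlot (Real.log ((es.length : ℝ) * 2 ^ m)) p y))).val := by
  simp [baseUpdate]

/-- The experts after a round. -/
def nextExpert (L floor l : ℝ) (p : Plan) (y : Bool) (e : Expert) : Expert :=
  { e with
    weight := trialWeight floor l (expertSlot L p y e)
    sqSum := e.sqSum + (-expertGain p y e) ^ 2 }

/-- At most `2^m` rounds with `2^{-3m}` each give an exponent of at most `2^{-2m}`; this is why `3
m` bisection steps suffice. -/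
theorem excess_le {j m : ℕ} {ε : ℝ} (hε0 : 0 ≤ ε) (hε : ε ≤ 1) (hm : 1 ≤ m) (hj : j ≤ 2 ^ m) :
    Real.exp (j * (ε * (1 / 2) ^ (3 * m))) ≤ 1 + 1 / 2 ^ m := by
  have h2 : (2 : ℝ) ≤ 2 ^ m := by
    calc (2 : ℝ) = 2 ^ 1 := by norm_num
      _ ≤ 2 ^ m := pow_le_pow_right₀ (by norm_num) hm
  have hj' : (j : ℝ) ≤ 2 ^ m := by exact_mod_cast hj
  have h3 : ((1 : ℝ) / 2) ^ (3 * m) = 1 / (2 ^ m) ^ 3 := by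
    rw [mul_comm, pow_mul, ← one_div_pow, ← one_div_pow]
  rw [h3]
  set n : ℝ := 2 ^ m
  have hx0 : 0 ≤ j * (ε * (1 / n ^ 3)) := by positivity
  have hx : j * (ε * (1 / n ^ 3)) ≤ 1 / n ^ 2 := by
    calc j * (ε * (1 / n ^ 3)) ≤ n * (1 * (1 / n ^ 3)) := by gcongr
      _ = 1 / n ^ 2 := by field_simp
  have hx1 : 1 / n ^ 2 ≤ 1 / (2 * n) := one_div_le_one_div_of_le (by positivity) (by nlinarith)
  have hx2 : 1 / (2 * n) ≤ 1 / 4 := one_div_le_one_div_of_le (by norm_num) (by linarith)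
  have h4 := exp_le_quadratic (x := j * (ε * (1 / n ^ 3))) (by rw [abs_of_nonneg hx0]; linarith)
  have h5 : 1 / n = 2 * (1 / (2 * n)) := by field_simp
  nlinarith

/-- The two errors of size `2 / 2^m` are the weighted gain left by the grid, with total weight at
most `2`, and the price `2 θ` of the inexact normalization, with `θ = 2^{-m}`. Over a whole run they
sum up to a constant. -/
theorem Pool.step (h : Pool ε cells m j es E) {S : Subroutines} (hS : Sound ε S)
    (hε0 : 0 ≤ ε) (hε : ε ≤ 1) (hN : 0 < cells.length) (hm : 1 ≤ m) (hj : j + 1 ≤ 2 ^ m)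
    (hc : Covers cells) (y : Bool) :
    ∃ E', Pool ε cells m (j + 1) (baseUpdate S m es (basePlan S m es).val y).val E' ∧
      (∀ i, (E' i).sqSum = (E i).sqSum + expertGain (basePlan S m es).val y (E i) ^ 2) ∧
      ∀ u : Fin cells.length × Bool → ℝ,
        (∀ i, Real.exp (-logSize cells.length m) ≤ u i) → ∑ i, u i = 1 →
        ∑ i, u i * expertGain (basePlan S m es).val y (E i) +
          ∑ i, kl (u i) (E' i).weight * (learningRate (logSize cells.length m) (E' i).sqSum)⁻¹
        ≤ ∑ i, kl (u i) (E i).weight * (learningRate (logSize cells.length m) (E i).sqSum)⁻¹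
          + ∑ i, u i * (regretBound (logSize cells.length m) (E' i).sqSum -
            regretBound (logSize cells.length m) (E i).sqSum) + 4 / 2 ^ m := by
  set p := (basePlan S m es).val with hp
  set L := logSize cells.length m with hLdef
  have hL : 1 ≤ L := one_le_logSize hN hm
  have hleg := h.legal hS hc
  have hgain : ∀ i, |-expertGain p y (E i)| ≤ 1 := fun i => by
    rw [abs_neg, expertGain_eq, abs_mul, h.sign, abs_sgn, one_mul]
    exact (Plan.abs_gain_le hleg.pr hleg.u₀ hleg.u₁ y _).trans (Plan.prob_le_one hleg.pr _)
  have hsize : (es.length : ℝ) * 2 ^ m = 2 * cells.length * 2 ^ m := by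
    rw [h.length]; push_cast; ring
  have hlog : Real.log ((es.length : ℝ) * 2 ^ m) = L := by rw [hsize]; rfl
  have hfloor : 1 / ((es.length : ℝ) * 2 ^ m) = Real.exp (-L) := by
    rw [hsize, exp_neg_logSize hN]
  have hval := baseUpdate_val S m es p y
  rw [hlog, hfloor] at hval
  have hslots : ∀ i, Real.exp (-L) ≤ (expertSlot L p y (E i)).w ∧ 0 < (expertSlot L p y (E i)).η ∧
      (expertSlot L p y (E i)).η ≤ 1 / 64 ∧ |(expertSlot L p y (E i)).c| ≤ 3 / 2 := fun i => by
    refine ⟨h.floor i, learningRate_pos _ _, learningRate_le _ _, ?_⟩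
    have h1 := abs_corrected_le (learningRate_pos L (E i).sqSum).le (learningRate_le L _) (hgain i)
    exact h1.trans (by linarith [hgain i])
  have hsw : ((es.map (expertSlot L p y)).map Slot.w).sum = ∑ i, (E i).weight := by
    rw [List.map_map, h.sum_eq]; rfl
  obtain ⟨l, hl, hsolve, h1, h2⟩ := hS.solve m (Real.exp (-L)) (es.map (expertSlot L p y)) j
    (Real.exp_pos _) (by
      intro s hs
      rw [h.eq, List.map_map] at hs
      obtain ⟨i, -, rfl⟩ := List.mem_map.mp hs
      exact hslots i) (hsw ▸ h.one_le) (hsw ▸ h.le_exp)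
  have htw : ((es.map (expertSlot L p y)).map (trialWeight (Real.exp (-L)) l)).sum =
      ∑ i, trialWeight (Real.exp (-L)) l (expertSlot L p y (E i)) := by
    rw [List.map_map, h.sum_eq]; rfl
  rw [htw] at h1 h2
  have hpool : Pool ε cells m (j + 1) (baseUpdate S m es p y).val
      fun i => nextExpert L (Real.exp (-L)) l p y (E i) := by
    refine ⟨?_, h.cell, h.sign, fun i => floor_le_trialWeight _ _ _, h1, h2, fun i => ?_⟩
    · rw [hval, hsolve, h.eq]
      rw [List.map_map, List.map_map, List.zipWith_map, List.zipWith_self]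
      rfl
    · exact add_nonneg (h.sqSum i) (sq_nonneg _)
  refine ⟨_, hpool, fun i => by simp [nextExpert], fun u hu hu1 => ?_⟩
  have hexc := excess_le hε0 hε hm hj
  have hexc' := excess_le hε0 hε hm (show j ≤ 2 ^ m by omega)
  have hstep := msmwc_step (fun i => expertSlot L p y (E i)) (fun i => -expertGain p y (E i)) u
    (fun i => (E i).sqSum) hL rfl h.floor (fun i => rfl) h.sqSum hgain (fun i => rfl) hl hu hu1 h1
    (h2.trans hexc)
  have hwg := h.sum_weight_gain_le hS y
  rw [← hp] at hwg
  have hwg2 : (∑ i, (E i).weight) / 2 ^ m ≤ 2 / 2 ^ m := by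
    gcongr
    have h3 : (1 : ℝ) ≤ 2 ^ m := one_le_pow₀ (by norm_num)
    have h4 : 1 / (2 : ℝ) ^ m ≤ 1 := div_le_one_of_le₀ h3 (by positivity)
    have := h.le_exp
    linarith
  have h5 : ∀ i, (expertSlot L p y (E i)).w = (E i).weight := fun i => rfl
  simp only [h5, mul_neg, Finset.sum_neg_distrib] at hstep
  have h6 : (4 : ℝ) / 2 ^ m = 2 / 2 ^ m + 2 * (1 / 2 ^ m) := by ring
  simp only [nextExpert]
  rw [h6]
  linarith


/-! ### Runs of the forecaster -/

/-- What happens in round `t`: the memory before the round, the randomization, the coin `b` of the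
forecaster, and the outcome. -/
structure Rec where
  t : ℕ
  st : State
  p : Plan
  b : Bool
  y : Bool

/-- The point `u` that is drawn. -/
def Rec.u (r : Rec) : ℝ := if r.b then r.p.u₀ else r.p.u₁

/-- The prediction. -/
def Rec.z (r : Rec) : ℝ := if r.b then r.p.z₀ else r.p.z₁

def nextState (S : Subroutines) (P : Params) (first : ℕ → ℝ) (st : State) (y : Bool) : State :=
  (update S P st (plan S first st).val y).val

/-- The rounds that start in round `t` with the memory `st`, for given coins and outcomes. -/
def recs (S : Subroutines) (P : Params) (first : ℕ → ℝ) :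
    ℕ → State → List (Bool × Bool) → List Rec
  | _, _, [] => []
  | t, st, x :: l => ⟨t, st, (plan S first st).val, x.1, x.2⟩ ::
      recs S P first (t + 1) (nextState S P first st x.2) l

section Run

variable (S : Subroutines) (P : Params) (first : ℕ → ℝ)

theorem length_recs (l : List (Bool × Bool)) (t : ℕ) (st : State) :
    (recs S P first t st l).length = l.length := by
  induction l generalizing t st with
  | nil => rfl
  | cons x l ih => simp [recs, ih]

theorem recs_append (l l' : List (Bool × Bool)) (t : ℕ) (st : State) :
    recs S P first t st (l ++ l') = recs S P first t st l ++
      recs S P first (t + l.length)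
        (l.foldl (fun st x => nextState S P first st x.2) st) l' := by
  induction l generalizing t st with
  | nil => rfl
  | cons x l ih =>
    simp only [List.cons_append, recs, ih, List.length_cons, List.foldl_cons]
    rw [show t + 1 + l.length = t + (l.length + 1) by ring]

theorem stateAfter_map_snd (l : List (Bool × Bool)) :
    stateAfter S P first (l.map Prod.snd) =
      l.foldl (fun st x => nextState S P first st x.2) initState := by
  rw [stateAfter, List.foldl_map]
  rfl

theorem sum_recs_t (l : List (Bool × Bool)) (t : ℕ) (st : State) (f : ℕ → ℝ) :
    ((recs S P first t st l).map fun r => f r.t).sum = ∑ i ∈ Finset.range l.length, f (t + i) := by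
  induction l generalizing t st with
  | nil => simp [recs]
  | cons x l ih =>
    simp only [recs, List.map_cons, List.sum_cons, ih, List.length_cons]
    rw [Finset.sum_range_succ', add_comm]
    congr 1
    refine Finset.sum_congr rfl fun i _ => ?_
    congr 1
    ring

theorem plan_of_ne {st : State} (h : st.m ≠ 1) :
    (plan S first st).val = (basePlan S st.m st.experts).val := by
  simp [plan, h]

theorem plan_of_eq {st : State} (h : st.m = 1) : (plan S first st).val =
    ⟨first st.seen, first st.seen, 1, first st.seen, first st.seen⟩ := by
  simp [plan, h]

/-- The experts after a round that does not end the epoch. -/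
def midExperts (st : State) (p : Plan) (y : Bool) : List Expert :=
  if st.m = 1 then [] else (baseUpdate S st.m st.experts p y).val

theorem nextState_mid {st : State} (h : st.seen + 1 ≠ 2 ^ st.m) (y : Bool) :
    nextState S P first st y = ⟨st.m, st.seen + 1, st.ySum + outcome y,
      midExperts S st (plan S first st).val y⟩ := by
  by_cases h1 : st.m = 1
  · have h2 : st.seen ≠ 1 := by rw [h1] at h; omega
    simp [nextState, update, midExperts, h1, h2]
  · simp [nextState, update, midExperts, h, h1]

theorem nextState_end {st : State} (h : st.seen + 1 = 2 ^ st.m) (y : Bool) :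
    nextState S P first st y = ⟨st.m + 1, 0, 0,
      (initExperts (buildPartition P (st.m + 1) ((st.ySum + outcome y) / 2 ^ st.m)).val).val⟩ := by
  by_cases h1 : st.m = 1
  · rw [h1] at h; simp [nextState, update, h, h1]
  · simp [nextState, update, h, h1]

/-! ### A run of the base algorithm -/

/-- The rounds of a run on `cells` of at most `2 ^ m` rounds. -/
structure Rec.InEpoch (cells : List Cell) (m : ℕ) (r : Rec) : Prop where
  m_eq : r.st.m = m
  legal : r.p.Legal cells
  experts : ∃ E : Fin cells.length × Bool → Expert,
    r.st.experts = (expertOrder cells.length).map E ∧ ∀ i, (E i).cell = cells.get i.1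

variable {S P first} {ε : ℝ} {cells : List Cell} {m : ℕ}

/-- The one-round potential inequality telescopes. The start is an arbitrary pool within the run,
which is what the induction on the remaining rounds needs. -/
theorem epoch_run (hS : Sound ε S) (hε0 : 0 ≤ ε) (hε : ε ≤ 1) (hN : 0 < cells.length)
    (hm : 2 ≤ m) (hc : Covers cells) (l : List (Bool × Bool)) :
    ∀ (t : ℕ) (st : State) (E : Fin cells.length × Bool → Expert), st.m = m →
      st.seen + l.length ≤ 2 ^ m → Pool ε cells m st.seen st.experts E →
      (∀ r ∈ recs S P first t st l, r.InEpoch cells m) ∧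
      ∀ u : Fin cells.length × Bool → ℝ,
        (∀ i, Real.exp (-logSize cells.length m) ≤ u i) → ∑ i, u i = 1 →
        ∑ i, u i * ((recs S P first t st l).map fun r => sgn i.2 * r.p.gain r.y (cells.get i.1)).sum
        ≤ ∑ i, kl (u i) (E i).weight * (learningRate (logSize cells.length m) (E i).sqSum)⁻¹
          + ∑ i, u i * (regretBound (logSize cells.length m) ((E i).sqSum +
              ((recs S P first t st l).map fun r => r.p.gain r.y (cells.get i.1) ^ 2).sum) -
            regretBound (logSize cells.length m) (E i).sqSum) + l.length * (4 / 2 ^ m) := by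
  induction l with
  | nil =>
    intro t st E _ _ hE
    refine ⟨by simp [recs], fun u hu _ => ?_⟩
    simp only [recs, List.map_nil, List.sum_nil, mul_zero, Finset.sum_const_zero, add_zero,
      sub_self, List.length_nil, Nat.cast_zero, zero_mul]
    exact Finset.sum_nonneg fun i _ => mul_nonneg
      (kl_nonneg ((Real.exp_pos _).trans_le (hu i)) (hE.weight_pos i))
      (inv_nonneg.mpr (learningRate_pos _ _).le)
  | cons x l ih =>
    intro t st E hst hlen hE
    have hm1 : st.m ≠ 1 := by omega
    have hplan := plan_of_ne S first hm1
    rw [hst] at hplan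
    rw [List.length_cons] at hlen
    obtain ⟨E', hE', hV, hstep⟩ :=
      hE.step hS hε0 hε hN (by omega : 1 ≤ m) (by omega) hc x.2
    have hsign : ∀ i, expertGain (basePlan S m st.experts).val x.2 (E i)
        = sgn i.2 * (basePlan S m st.experts).val.gain x.2 (cells.get i.1) := fun i => by
      rw [expertGain_eq, hE.sign, hE.cell]
    have hsq : ∀ i : Fin cells.length × Bool,
        (sgn i.2 * (basePlan S m st.experts).val.gain x.2 (cells.get i.1)) ^ 2
        = (basePlan S m st.experts).val.gain x.2 (cells.get i.1) ^ 2 := fun i => by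
      rw [mul_pow, ← sq_abs (sgn _), abs_sgn]; ring
    have hfirst : Rec.InEpoch cells m ⟨t, st, (plan S first st).val, x.1, x.2⟩ :=
      ⟨hst, hplan ▸ hE.legal hS hc, E, hE.eq, hE.cell⟩
    -- The last round is treated separately: it may end the epoch, and then the next memory holds
    -- the experts of a new partition.
    rcases eq_or_ne l [] with rfl | hl
    · simp only [recs, List.mem_singleton, forall_eq, List.map_cons, List.map_nil, List.sum_cons,
        List.sum_nil, add_zero, List.length_cons, List.length_nil, hplan]
      refine ⟨hplan ▸ hfirst, fun u hu hu1 => ?_⟩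
      have h1 := hstep u hu hu1
      simp only [hsign, hV, hsq] at h1
      have h2 : 0 ≤ ∑ i, kl (u i) (E' i).weight *
          (learningRate (logSize cells.length m) ((E i).sqSum +
            (basePlan S m st.experts).val.gain x.2 (cells.get i.1) ^ 2))⁻¹ :=
        Finset.sum_nonneg fun i _ => mul_nonneg
          (kl_nonneg ((Real.exp_pos _).trans_le (hu i)) (hE'.weight_pos i))
          (inv_nonneg.mpr (learningRate_pos _ _).le)
      simp only [zero_add, Nat.cast_one, one_mul]
      linarith
    · have hlpos : 0 < l.length := List.length_pos_iff.mpr hl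
      have hnext := nextState_mid S P first (st := st) (by rw [hst]; omega) x.2
      have hmid : midExperts S st (plan S first st).val x.2
          = (baseUpdate S m st.experts (basePlan S m st.experts).val x.2).val := by
        rw [midExperts, if_neg hm1, hplan, hst]
      rw [hmid, hst] at hnext
      obtain ⟨ih1, ih2⟩ := ih (t + 1) (nextState S P first st x.2) E' (by rw [hnext])
        (by rw [hnext]; dsimp only; omega) (by rw [hnext]; exact hE')
      simp only [recs, List.mem_cons, forall_eq_or_imp, List.map_cons, List.sum_cons,
        List.length_cons]
      refine ⟨⟨hfirst, ih1⟩, fun u hu hu1 => ?_⟩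
      have h1 := hstep u hu hu1
      have h2 := ih2 u hu hu1
      simp only [hV, hsq, hsign] at h1 h2
      rw [hplan]
      simp only [mul_add, mul_sub, Finset.sum_add_distrib, Finset.sum_sub_distrib,
        Nat.cast_add, Nat.cast_one, add_mul, one_mul, ← add_assoc] at h1 h2 ⊢
      linarith

theorem sum_list_le_length {R : List Rec} {f : Rec → ℝ} (h : ∀ r ∈ R, f r ≤ 1) :
    (R.map f).sum ≤ R.length := by
  have := List.sum_le_card_nsmul (R.map f) 1 (by simpa using h)
  simpa using this

theorem length_le_sum_list {R : List Rec} {f : Rec → ℝ} (h : ∀ r ∈ R, -1 ≤ f r) :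
    -(R.length : ℝ) ≤ (R.map f).sum := by
  have := List.card_nsmul_le_sum (R.map f) (-1) (by simpa using h)
  simpa using this

/-- Regret against the experts `(J, 1)` and `(J, -1)` bounds the accumulated gain of `J` from both
sides. The bound depends only on the squared gains of `J`, so rarely visited cells get small bounds.
-/
theorem calibration_of_epoch (hS : Sound ε S) (hε0 : 0 ≤ ε) (hε : ε ≤ 1)
    (hN : 0 < cells.length) (hm : 2 ≤ m) (hc : Covers cells) (l : List (Bool × Bool))
    (hlen : l.length ≤ 2 ^ m) (t : ℕ) {st : State} (hst : st.m = m) (hseen : st.seen = 0)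
    (hes : st.experts = (initExperts cells).val) :
    (∀ r ∈ recs S P first t st l, r.InEpoch cells m) ∧
    ∀ J : Fin cells.length,
      |((recs S P first t st l).map fun r => r.p.gain r.y (cells.get J)).sum| ≤
      2000 * (logSize cells.length m + √(logSize cells.length m *
        ((recs S P first t st l).map fun r => r.p.gain r.y (cells.get J) ^ 2).sum)) := by
  have hpool : Pool ε cells m st.seen st.experts fun i =>
      ⟨cells.get i.1, sgn i.2, 1 / (2 * (cells.length : ℝ)), 0⟩ := by
    rw [hes, hseen]; exact pool_initExperts hN m
  obtain ⟨h1, h2⟩ := epoch_run (P := P) (first := first) hS hε0 hε hN hm hc l t st _ hst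
    (by omega) hpool
  refine ⟨h1, ?_⟩
  have hL := one_le_logSize hN (by omega : 1 ≤ m)
  have hfl := exp_neg_logSize hN m
  have hRlen := length_recs S P first l t st
  set L := logSize cells.length m
  set R := recs S P first t st l
  set N := cells.length
  have hn4 : (4 : ℝ) ≤ 2 ^ m := by
    calc (4 : ℝ) = 2 ^ 2 := by norm_num
      _ ≤ 2 ^ m := pow_le_pow_right₀ (by norm_num) hm
  have hlen' : (R.length : ℝ) ≤ 2 ^ m := by rw [hRlen]; exact_mod_cast hlen
  have hN1 : (1 : ℝ) ≤ N := by exact_mod_cast hN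
  set n : ℝ := 2 ^ m
  have hfl0 := Real.exp_pos (-L)
  set fl := Real.exp (-L)
  have hdfl : 2 * N * fl = 1 / n := by rw [hfl]; field_simp
  have hn1 : 1 / n ≤ 1 / 4 := one_div_le_one_div_of_le (by norm_num) hn4
  have hgain : ∀ r ∈ R, ∀ J : Cell, |r.p.gain r.y J| ≤ 1 := fun r hr J =>
    (Plan.abs_gain_le (h1 r hr).legal.pr (h1 r hr).legal.u₀ (h1 r hr).legal.u₁ _ _).trans
      (Plan.prob_le_one (h1 r hr).legal.pr _)
  have hV0 : ∀ J : Cell, 0 ≤ (R.map fun r => r.p.gain r.y J ^ 2).sum := fun J =>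
    List.sum_nonneg (by simpa using fun r _ => sq_nonneg _)
  have hV1 : ∀ J : Cell, (R.map fun r => r.p.gain r.y J ^ 2).sum ≤ n := fun J =>
    (sum_list_le_length fun r hr => by
      rw [← sq_abs]; nlinarith [abs_nonneg (r.p.gain r.y J), hgain r hr J]).trans hlen'
  have hx : ∀ i : Fin N × Bool,
      -n ≤ (R.map fun r => sgn i.2 * r.p.gain r.y (cells.get i.1)).sum := fun i => by
    have := length_le_sum_list (R := R) (f := fun r => sgn i.2 * r.p.gain r.y (cells.get i.1))
      fun r hr => by
        refine (abs_le.mp ?_).1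
        rw [abs_mul, abs_sgn, one_mul]
        exact hgain r hr _
    linarith
  have hrB : regretBound L n ≤ 321 * L * n := by
    have h3 := regretBound_le hL (by linarith : 0 ≤ n)
    have h4 : √(L * n) ≤ L * n := by
      rw [Real.sqrt_le_left (by positivity)]
      nlinarith [mul_le_mul hL (by linarith : 1 ≤ n) (by norm_num) (by linarith)]
    nlinarith
  intro J
  have key : ∀ σ : Bool, sgn σ * (R.map fun r => r.p.gain r.y (cells.get J)).sum ≤
      2000 * (L + √(L * (R.map fun r => r.p.gain r.y (cells.get J) ^ 2).sum)) := by
    intro σ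
    set V := (R.map fun r => r.p.gain r.y (cells.get J) ^ 2).sum
    let i₀ : Fin N × Bool := (J, σ)
    -- The point mass at `i₀` is not in the truncated simplex. The floor on all `2 N` experts takes
    -- a total mass of `2 N fl = 1 / n`, so that the floor contributes only constants and multiples
    -- of `L` below.
    let u : Fin N × Bool → ℝ := fun i => fl + if i = i₀ then 1 - 1 / n else 0
    have husum : ∀ f : Fin N × Bool → ℝ,
        ∑ i, u i * f i = fl * ∑ i, f i + (1 - 1 / n) * f i₀ := fun f => by
      simp [u, add_mul, Finset.sum_add_distrib, Finset.mul_sum, ite_mul]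
    have hcard : ∑ _i : Fin N × Bool, (1 : ℝ) = 2 * N := by simp [mul_comm]
    have hu1 : ∑ i, u i = 1 := by
      have := husum fun _ => 1
      simp only [mul_one] at this
      rw [hcard] at this
      rw [this]; linarith
    have hu : ∀ i, fl ≤ u i := fun i => by
      simp only [u]; split_ifs <;> linarith
    have hui : ∀ i, u i ≤ 1 := fun i => by
      rw [← hu1]
      exact Finset.single_le_sum (fun j _ => (hfl0.trans_le (hu j)).le) (Finset.mem_univ i)
    have h3 := h2 u hu hu1
    rw [husum, husum] at h3
    have hmain : (R.map fun r => sgn i₀.2 * r.p.gain r.y (cells.get i₀.1)).sum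
        = sgn σ * (R.map fun r => r.p.gain r.y (cells.get J)).sum := by
      rw [← List.sum_map_mul_left]
    rw [hmain] at h3
    set x := sgn σ * (R.map fun r => r.p.gain r.y (cells.get J)).sum
    have h4 : -1 ≤ fl * ∑ i : Fin N × Bool,
        (R.map fun r => sgn i.2 * r.p.gain r.y (cells.get i.1)).sum := by
      have h5 : 2 * N * (-n) ≤ ∑ i : Fin N × Bool,
          (R.map fun r => sgn i.2 * r.p.gain r.y (cells.get i.1)).sum := by
        have := Finset.sum_le_sum fun i (_ : i ∈ Finset.univ) => hx i
        rw [← hcard, Finset.sum_mul]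
        simpa using this
      have h6 := mul_le_mul_of_nonneg_left h5 hfl0.le
      have h7 : fl * (2 * N * (-n)) = -1 := by
        rw [show fl * (2 * N * (-n)) = -(2 * N * fl * n) by ring, hdfl]; field_simp
      linarith
    have h5 : ∑ i, kl (u i) (1 / (2 * (N : ℝ))) * (learningRate L 0)⁻¹ ≤ 64 * (L + 1) := by
      have h6 : (learningRate L 0)⁻¹ = 64 := by rw [inv_learningRate]; simp
      rw [h6, ← Finset.sum_mul]
      have h7 : ∑ i, kl (u i) (1 / (2 * (N : ℝ))) ≤ ∑ i, (u i * L + 1 / (2 * (N : ℝ))) := by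
        refine Finset.sum_le_sum fun i _ => kl_le (hfl0.trans_le (hu i)) (hui i) ?_
        change fl ≤ _
        rw [hfl]
        refine one_div_le_one_div_of_le (by positivity) ?_
        nlinarith
      have h8 : ∑ i, (u i * L + 1 / (2 * (N : ℝ))) = L + 1 := by
        rw [Finset.sum_add_distrib, ← Finset.sum_mul, hu1]
        have := hcard
        rw [← mul_one (1 / (2 * (N : ℝ))), ← Finset.mul_sum, hcard]
        field_simp
      linarith
    have h6 : fl * ∑ i : Fin N × Bool, (regretBound L
        (0 + (R.map fun r => r.p.gain r.y (cells.get i.1) ^ 2).sum) - regretBound L 0)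
        ≤ 321 * L := by
      have h7 : ∀ i : Fin N × Bool, regretBound L
          (0 + (R.map fun r => r.p.gain r.y (cells.get i.1) ^ 2).sum) - regretBound L 0
          ≤ 321 * L * n := fun i => by
        have h8 := regretBound_mono (L := L) (by linarith)
          (show 0 + (R.map fun r => r.p.gain r.y (cells.get i.1) ^ 2).sum ≤ n by
            rw [zero_add]; exact hV1 _)
        have h9 : 0 ≤ regretBound L 0 := by
          unfold regretBound
          have := learningRate_pos L 0
          positivity
        linarith
      have h8 := Finset.sum_le_sum fun i (_ : i ∈ Finset.univ) => h7 i
      have h9 : ∑ _i : Fin N × Bool, 321 * L * n = 2 * N * (321 * L * n) := by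
        rw [← hcard, Finset.sum_mul]; simp
      rw [h9] at h8
      have h10 := mul_le_mul_of_nonneg_left h8 hfl0.le
      have h11 : fl * (2 * N * (321 * L * n)) = 321 * L := by
        rw [show fl * (2 * N * (321 * L * n)) = 2 * N * fl * n * (321 * L) by ring, hdfl]
        field_simp
      linarith
    have h7 : regretBound L (0 + V) - regretBound L 0 ≤ 192 * L + 129 * √(L * V) := by
      have h9 : 0 ≤ regretBound L 0 := by
        unfold regretBound
        have := learningRate_pos L 0
        positivity
      rw [zero_add]
      have := regretBound_le hL (hV0 (cells.get J))
      linarith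
    have h8 : (1 - 1 / n) * (regretBound L (0 + V) - regretBound L 0)
        ≤ 192 * L + 129 * √(L * V) := by
      have h10 : 0 ≤ regretBound L (0 + V) - regretBound L 0 :=
        sub_nonneg.mpr (regretBound_mono (by linarith) (by simpa using hV0 _))
      have h11 : 0 ≤ 1 / n := by positivity
      nlinarith
    have h9 : (l.length : ℝ) * (4 / n) ≤ 4 := by
      rw [← hRlen, mul_div_assoc', div_le_iff₀ (by linarith)]
      linarith
    have h10 : (1 - 1 / n) * x ≤ 1 + 64 * (L + 1) + 321 * L + (192 * L + 129 * √(L * V)) + 4 := by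
      simp only [i₀] at h3
      linarith
    have h11 : 0 ≤ √(L * V) := Real.sqrt_nonneg _
    -- For `x ≥ 0`, dividing by `1 - 1/n ≥ 3/4` keeps the constants below `2000`; for `x < 0`
    -- nothing is to be shown.
    by_cases hx0 : 0 ≤ x
    · nlinarith
    · nlinarith
  rw [abs_le]
  have k1 := key true
  have k2 := key false
  rw [show sgn true = 1 from rfl, one_mul] at k1
  rw [show sgn false = -1 from rfl, neg_one_mul] at k2
  exact ⟨by linarith, k1⟩

end Run


/-! ### The value of the partition -/

def unifCells (I : Cell) (N : ℕ) : List Cell :=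
  (List.range N).map fun k : ℕ =>
    { lo := I.lo + (k : ℝ) / N * (I.hi - I.lo)
      hi := if k + 1 = N then I.hi else I.lo + ((k : ℝ) + 1) / N * (I.hi - I.lo)
      loClosed := if k = 0 then I.loClosed else true
      hiClosed := if k + 1 = N then I.hiClosed else false }

open Classical in
def bandCells (B : Cell) (K : ℕ) : List Cell := if B.lo < B.hi then unifCells B K else []

/-- The interval `I_m`. -/
def inner (P : Params) (m : ℕ) (ybar : ℝ) : Cell :=
  Cell.clip ⟨ybar - 2 * radius P (2 ^ (m - 1)), ybar + 2 * radius P (2 ^ (m - 1)), true, true⟩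

def leftBand (a r w : ℝ) : Cell := ⟨a - (2 * w - 1) * r, a - (w - 1) * r, true, false⟩

def rightBand (b r w : ℝ) : Cell := ⟨b + (w - 1) * r, b + (2 * w - 1) * r, false, true⟩

def innerCount (P : Params) (m : ℕ) (ybar : ℝ) : ℕ :=
  ⌈innerGrid P (2 ^ m) ((inner P m ybar).hi - (inner P m ybar).lo)⌉₊

def outerCount (P : Params) : ℕ := ⌈outerGrid P⌉₊

/-- The number of doublings of the bands. -/
def bandCount (P : Params) : ℕ := ⌈Real.logb 2 P.T⌉₊

theorem unifPart_val (I : Cell) (N : ℕ) : (unifPart I N).val = unifCells I N := by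
  have h : ∀ k : ℕ, ((k : ℝ) + 1 = N) ↔ k + 1 = N := fun k => by
    rw [← Nat.cast_succ, Nat.cast_inj]
  simp [unifPart, unifCells, ← List.map_eq_flatMap, Function.comp_def, h]

theorem bandPart_val (B : Cell) (K : ℕ) : (bandPart B K).val = bandCells B K := by
  by_cases h : B.lo < B.hi <;> simp [bandPart, bandCells, h, unifPart_val]

theorem buildPartition_val (P : Params) (m : ℕ) (ybar : ℝ) :
    (buildPartition P m ybar).val = unifCells (inner P m ybar) (innerCount P m ybar) ++
      (List.range (bandCount P + 1)).flatMap fun q =>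
        bandCells (leftBand (inner P m ybar).lo (radius P (2 ^ (m - 1))) (2 ^ q)).clip
          (outerCount P) ++
        bandCells (rightBand (inner P m ybar).hi (radius P (2 ^ (m - 1))) (2 ^ q)).clip
          (outerCount P) := by
  simp [buildPartition, unifPart_val, bandPart_val, inner, innerCount, outerCount, bandCount,
    leftBand, rightBand]

/-! ### Partitions and cuts -/

open Classical in
/-- `1` if `u` lies below the interval. -/
def Cell.below (J : Cell) (u : ℝ) : ℝ :=
  if J.loClosed then (if u < J.lo then 1 else 0) else (if u ≤ J.lo then 1 else 0)

open Classical in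
/-- `1` if `u` does not lie above the interval. -/
def Cell.upto (J : Cell) (u : ℝ) : ℝ :=
  if J.hiClosed then (if u ≤ J.hi then 1 else 0) else (if u < J.hi then 1 else 0)

/-- An indicator is a difference of two cuts, and adjacent cells share a cut; covering exactly once
becomes a telescoping sum in which the open and closed ends take care of themselves. -/
theorem Cell.ind_eq (J : Cell) (h : J.lo < J.hi) (u : ℝ) : J.ind u = J.upto u - J.below u := by
  classical
  rcases J with ⟨lo, hi, _ | _, _ | _⟩ <;> dsimp only at h <;>
    simp only [Cell.ind, Cell.upto, Cell.below, Cell.toSet, Set.indicator, Set.mem_ofPred_eq,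
      Pi.one_apply, Bool.false_eq_true, if_false, if_true, false_and, true_and, or_false] <;>
    split_ifs <;> grind

/-- A degenerate band is half-open and hence empty, so leaving it out of the partition loses no
point. -/
theorem Cell.ind_eq_zero (J : Cell) (h : ¬J.lo < J.hi)
    (h' : J.loClosed = false ∨ J.hiClosed = false) (u : ℝ) : J.ind u = 0 := by
  refine Cell.ind_of_notMem fun hu => ?_
  simp only [Cell.toSet, Set.mem_ofPred_eq] at hu
  grind

theorem Cell.ind_clip (J : Cell) {u : ℝ} (hu : u ∈ Set.Icc (0 : ℝ) 1) :
    J.clip.ind u = J.ind u := by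
  by_cases h : u ∈ J.toSet
  · rw [ind_of_mem h, ind_of_mem (by rw [toSet_clip]; exact ⟨h, hu⟩)]
  · rw [ind_of_notMem h, ind_of_notMem (by rw [toSet_clip]; exact fun h' => h h'.1)]

theorem Cell.clip_loClosed (J : Cell) (h : 0 ≤ J.lo) : J.clip.loClosed = J.loClosed := by
  simp [Cell.clip, not_lt.mpr h]

theorem Cell.clip_hiClosed (J : Cell) (h : J.hi ≤ 1) : J.clip.hiClosed = J.hiClosed := by
  simp [Cell.clip, not_lt.mpr h]

theorem sum_map_range (f : ℕ → ℝ) (n : ℕ) :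
    ((List.range n).map f).sum = ∑ i ∈ Finset.range n, f i := by
  induction n with
  | zero => simp
  | succ n ih => simp [List.range_succ, Finset.sum_range_succ, ih]

theorem unifCells_bounds {I : Cell} (h : I.lo < I.hi) {N : ℕ} {J : Cell}
    (hJ : J ∈ unifCells I N) :
    I.lo ≤ J.lo ∧ J.lo < J.hi ∧ J.hi ≤ I.hi ∧ J.hi - J.lo = (I.hi - I.lo) / N := by
  obtain ⟨k, hk, rfl⟩ := List.mem_map.mp hJ
  rw [List.mem_range] at hk
  have hN : (0 : ℝ) < N := by exact_mod_cast (by omega : 0 < N)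
  have hd : 0 < I.hi - I.lo := by linarith
  have hk' : (k : ℝ) + 1 ≤ N := by exact_mod_cast hk
  have hhi : (if k + 1 = N then I.hi else I.lo + ((k : ℝ) + 1) / N * (I.hi - I.lo)) =
      I.lo + ((k : ℝ) + 1) / N * (I.hi - I.lo) := by
    split_ifs with h1
    · have : (k : ℝ) + 1 = N := by exact_mod_cast h1
      rw [this, div_self hN.ne']; ring
    · rfl
  dsimp only
  rw [hhi]
  have h1 : ((k : ℝ) + 1) / N ≤ 1 := div_le_one_of_le₀ hk' hN.le
  have h2 : 0 ≤ (k : ℝ) / N := by positivity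
  have h3 : ((k : ℝ) + 1) / N = k / N + 1 / N := by ring
  have h4 : 0 < 1 / (N : ℝ) := by positivity
  refine ⟨by nlinarith, by rw [h3]; nlinarith, by nlinarith, by rw [h3]; ring⟩

theorem sum_ind_unifCells {I : Cell} (h : I.lo < I.hi) {N : ℕ} (hN : 0 < N) (u : ℝ) :
    ((unifCells I N).map fun J => J.ind u).sum = I.ind u := by
  classical
  let c : ℕ → ℝ := fun k => if k = 0 then I.below u else if k = N then I.upto u else
    if u < I.lo + (k : ℝ) / N * (I.hi - I.lo) then 1 else 0
  have key : ((unifCells I N).map fun J => J.ind u).sum = ∑ k ∈ Finset.range N, (c (k + 1) - c k) := by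
    rw [unifCells, List.map_map, sum_map_range]
    refine Finset.sum_congr rfl fun k hk => ?_
    rw [Finset.mem_range] at hk
    rw [Function.comp, Cell.ind_eq _ (unifCells_bounds h (List.mem_map_of_mem
      (List.mem_range.mpr hk))).2.1]
    congr 1
    · simp only [c, Cell.upto, Nat.succ_ne_zero, if_false]
      by_cases h1 : k + 1 = N
      · simp [h1]
      · simp [h1]
    · simp only [c, Cell.below]
      by_cases h1 : k = 0
      · simp [h1]
      · simp [h1, show k ≠ N by omega]
  rw [key, Finset.sum_range_sub]
  simp only [c, hN.ne', if_true, if_false]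
  rw [Cell.ind_eq _ h]

theorem sum_ind_bandCells {B : Cell} (h : B.loClosed = false ∨ B.hiClosed = false) {K : ℕ}
    (hK : 0 < K) (u : ℝ) : ((bandCells B K).map fun J => J.ind u).sum = B.ind u := by
  unfold bandCells
  split_ifs with h1
  · exact sum_ind_unifCells h1 hK u
  · simp [B.ind_eq_zero h1 h]

theorem sum_get_eq (cells : List Cell) (f : Cell → ℝ) :
    ∑ J : Fin cells.length, f (cells.get J) = (cells.map f).sum := by
  rw [← List.sum_ofFn]
  congr 1
  conv_rhs => rw [← List.ofFn_get cells, List.map_ofFn]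
  rfl

/-! ### Covering property, geometry and size of the partition of an epoch -/

section Partition

variable {P : Params} {m : ℕ} {ybar : ℝ}

theorem inner_spec (hr : 0 < radius P (2 ^ (m - 1))) (hy : ybar ∈ Set.Icc (0 : ℝ) 1) :
    0 ≤ (inner P m ybar).lo ∧ (inner P m ybar).lo < (inner P m ybar).hi ∧
      (inner P m ybar).hi ≤ 1 ∧
      (inner P m ybar).hi - (inner P m ybar).lo ≤ 4 * radius P (2 ^ (m - 1)) := by
  simp only [inner, Cell.clip]
  refine ⟨le_max_right _ _, ?_, min_le_right _ _, ?_⟩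
  · rw [max_lt_iff, lt_min_iff, lt_min_iff]
    refine ⟨⟨by linarith, by linarith [hy.2]⟩, by linarith [hy.1], by norm_num⟩
  · have h1 := min_le_left (ybar + 2 * radius P (2 ^ (m - 1))) 1
    have h2 := le_max_left (ybar - 2 * radius P (2 ^ (m - 1))) 0
    linarith

theorem innerGrid_pos (hι : 0 < P.ι) {s len : ℝ} (hs : 0 < s) (hlen : 0 < len) :
    0 < innerGrid P s len := by
  unfold innerGrid
  positivity

theorem outerGrid_pos (hι : 0 < P.ι) (hC : 0 ≤ P.C) : 0 < outerGrid P := by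
  unfold outerGrid
  have : 0 < (1 + P.C) / P.ι := by positivity
  positivity

theorem T_le_two_pow_bandCount (hT : 1 ≤ P.T) : (P.T : ℝ) ≤ 2 ^ bandCount P := by
  have h := Nat.le_ceil (Real.logb 2 P.T)
  have hT' : (0 : ℝ) < P.T := by exact_mod_cast hT
  rw [Real.logb_le_iff_le_rpow (by norm_num) hT'] at h
  rwa [Real.rpow_natCast] at h

theorem covers_buildPartition (hι : 0 < P.ι) (hC : 0 ≤ P.C) (hT : 1 ≤ P.T)
    (hr : 1 ≤ P.T * radius P (2 ^ (m - 1))) (hr0 : 0 < radius P (2 ^ (m - 1)))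
    (hy : ybar ∈ Set.Icc (0 : ℝ) 1) : Covers (buildPartition P m ybar).val := by
  classical
  intro u hu
  rw [sum_get_eq _ fun J => J.ind u, buildPartition_val]
  obtain ⟨hI0, hI, hI1, -⟩ := inner_spec hr0 hy
  have hN : 0 < innerCount P m ybar :=
    Nat.ceil_pos.mpr (innerGrid_pos hι (by positivity) (by linarith))
  have hK : 0 < outerCount P := Nat.ceil_pos.mpr (outerGrid_pos hι hC)
  rw [List.map_append, List.sum_append, sum_ind_unifCells hI hN, List.map_flatMap,
    List.flatMap_def, List.sum_flatten, List.map_map, sum_map_range]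
  have hclosed : (inner P m ybar).loClosed = true ∧ (inner P m ybar).hiClosed = true := by
    simp [inner, Cell.clip]
  rw [Cell.ind_eq _ hI]
  simp only [Cell.upto, Cell.below, hclosed.1, hclosed.2, if_true]
  set a := (inner P m ybar).lo
  set b := (inner P m ybar).hi
  set r := radius P (2 ^ (m - 1))
  -- The outer end of band `q` is the inner end of band `q + 1`, and for `q = 0` the cuts are the
  -- end points of the inner interval, so all cuts cancel except the outermost.
  let cL : ℕ → ℝ := fun q => if u < a - (2 ^ q - 1) * r then 1 else 0
  let cR : ℕ → ℝ := fun q => if u ≤ b + (2 ^ q - 1) * r then 1 else 0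
  have hband : ∀ q : ℕ, ((bandCells (leftBand a r (2 ^ q)).clip (outerCount P) ++
      bandCells (rightBand b r (2 ^ q)).clip (outerCount P)).map fun J => J.ind u).sum =
      (cR (q + 1) - cR q) - (cL (q + 1) - cL q) := by
    intro q
    have hw : (1 : ℝ) ≤ 2 ^ q := one_le_pow₀ (by norm_num)
    have hwr : 0 ≤ ((2 : ℝ) ^ q - 1) * r := mul_nonneg (by linarith) hr0.le
    have hwr2 : 0 < (2 : ℝ) ^ q * r := by positivity
    rw [List.map_append, List.sum_append, sum_ind_bandCells _ hK, sum_ind_bandCells _ hK,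
      Cell.ind_clip _ hu, Cell.ind_clip _ hu, Cell.ind_eq, Cell.ind_eq]
    · simp only [Cell.upto, Cell.below, leftBand, rightBand, if_true, Bool.false_eq_true,
        if_false, cL, cR, pow_succ']
      ring_nf
    · simp only [rightBand]; nlinarith
    · simp only [leftBand]; nlinarith
    · left
      rw [Cell.clip_loClosed _ (by simp only [rightBand]; linarith)]
      rfl
    · right
      rw [Cell.clip_hiClosed _ (by simp only [leftBand]; linarith)]
      rfl
  simp only [Function.comp_apply, hband]
  rw [Finset.sum_sub_distrib, Finset.sum_range_sub,
    Finset.sum_range_sub]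
  -- The last band reaches out to a distance of at least `(2 T - 1) r ≥ T r ≥ 1`, beyond all of
  -- `[0,1]`.
  have hbig : (1 : ℝ) ≤ (2 ^ (bandCount P + 1) - 1) * r := by
    have h1 := T_le_two_pow_bandCount hT
    have h2 : (1 : ℝ) ≤ P.T := by exact_mod_cast hT
    rw [pow_succ]
    nlinarith
  have h1 : cL (bandCount P + 1) = 0 := if_neg (by linarith [hu.1])
  have h2 : cR (bandCount P + 1) = 1 := if_pos (by linarith [hu.2])
  rw [h1, h2]
  simp only [cL, cR, pow_zero, sub_self, zero_mul, sub_zero, add_zero]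
  ring

/-- For a cell in band `q` the witness is `ρ = 2^q r`: the band has width at most `ρ` and begins at
distance `2 r + (2^q - 1) r = r + ρ` from the average. The extra `r` leaves distance `ρ` from any
centre within the confidence radius. -/
theorem buildPartition_cell (hr0 : 0 < radius P (2 ^ (m - 1)))
    (hy : ybar ∈ Set.Icc (0 : ℝ) 1) {J : Cell} (hJ : J ∈ (buildPartition P m ybar).val) :
    0 ≤ J.lo ∧ J.lo < J.hi ∧ J.hi ≤ 1 ∧
      (J.hi - J.lo = ((inner P m ybar).hi - (inner P m ybar).lo) / innerCount P m ybar ∨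
      ∃ ρ, 0 < ρ ∧ J.hi - J.lo ≤ ρ / outerCount P ∧
        (J.hi ≤ ybar - radius P (2 ^ (m - 1)) - ρ ∨
          ybar + radius P (2 ^ (m - 1)) + ρ ≤ J.lo)) := by
  rw [buildPartition_val, List.mem_append] at hJ
  obtain ⟨hI0, hI, hI1, -⟩ := inner_spec hr0 hy
  rcases hJ with hJ | hJ
  · obtain ⟨h1, h2, h3, h4⟩ := unifCells_bounds hI hJ
    exact ⟨hI0.trans h1, h2, h3.trans hI1, Or.inl h4⟩
  · obtain ⟨q, -, hJ⟩ := List.mem_flatMap.mp hJ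
    have ha : (inner P m ybar).lo = max (ybar - 2 * radius P (2 ^ (m - 1))) 0 := rfl
    have hb : (inner P m ybar).hi = min (ybar + 2 * radius P (2 ^ (m - 1))) 1 := rfl
    set a := (inner P m ybar).lo
    set b := (inner P m ybar).hi
    set r := radius P (2 ^ (m - 1))
    have hw : (1 : ℝ) ≤ 2 ^ q := one_le_pow₀ (by norm_num)
    have hwr : 0 ≤ ((2 : ℝ) ^ q - 1) * r := mul_nonneg (by linarith) hr0.le
    have hwr2 : 0 < (2 : ℝ) ^ q * r := by positivity
    rcases List.mem_append.mp hJ with hJ | hJ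
    · unfold bandCells at hJ
      split_ifs at hJ with hlt
      · obtain ⟨h1, h2, h3, h4⟩ := unifCells_bounds hlt hJ
        simp only [leftBand, Cell.clip] at h1 h3 h4 hlt
        obtain ⟨h5, -⟩ := lt_min_iff.mp hlt
        obtain ⟨-, h6⟩ := max_lt_iff.mp h5
        -- A nonempty clipped left band forces `a > 0`, so the inner interval was not cut off at `0`
        -- on this side.
        have h7 : a = ybar - 2 * r := by
          rcases max_choice (ybar - 2 * r) 0 with h | h
          · rw [ha, h]
          · rw [h] at ha; linarith
        refine ⟨(le_max_right _ _).trans h1, h2, h3.trans (min_le_right _ _),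
          Or.inr ⟨2 ^ q * r, hwr2, ?_, Or.inl ?_⟩⟩
        · rw [h4]
          gcongr
          have h8 := min_le_left (a - (2 ^ q - 1) * r) 1
          have h9 := le_max_left (a - (2 * 2 ^ q - 1) * r) 0
          linarith
        · have := h3.trans (min_le_left _ _)
          linarith
      · simp at hJ
    · unfold bandCells at hJ
      split_ifs at hJ with hlt
      · obtain ⟨h1, h2, h3, h4⟩ := unifCells_bounds hlt hJ
        simp only [rightBand, Cell.clip] at h1 h3 h4 hlt
        obtain ⟨h5, -⟩ := max_lt_iff.mp hlt
        obtain ⟨-, h6⟩ := lt_min_iff.mp h5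
        have h7 : b = ybar + 2 * r := by
          rcases min_choice (ybar + 2 * r) 1 with h | h
          · rw [hb, h]
          · rw [h] at hb; linarith
        refine ⟨(le_max_right _ _).trans h1, h2, h3.trans (min_le_right _ _),
          Or.inr ⟨2 ^ q * r, hwr2, ?_, Or.inr ?_⟩⟩
        · rw [h4]
          gcongr
          have h8 := min_le_left (b + (2 * 2 ^ q - 1) * r) 1
          have h9 := le_max_left (b + (2 ^ q - 1) * r) 0
          linarith
        · have := (le_max_left _ _).trans h1
          linarith
      · simp at hJ

theorem length_bandCells_le (B : Cell) (K : ℕ) : (bandCells B K).length ≤ K := by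
  unfold bandCells
  split_ifs <;> simp [unifCells]

theorem length_flatMap_le {α β : Type} (f : α → List β) (l : List α) (k : ℕ)
    (h : ∀ a ∈ l, (f a).length ≤ k) : (l.flatMap f).length ≤ l.length * k := by
  induction l with
  | nil => simp
  | cons a l ih =>
    have h1 := h a List.mem_cons_self
    have h2 := ih fun b hb => h b (List.mem_cons_of_mem _ hb)
    rw [List.flatMap_cons, List.length_append, List.length_cons, add_mul]
    omega

theorem length_buildPartition (P : Params) (m : ℕ) (ybar : ℝ) :
    (buildPartition P m ybar).val.length ≤
      innerCount P m ybar + (bandCount P + 1) * (2 * outerCount P) := by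
  rw [buildPartition_val, List.length_append]
  have h := length_flatMap_le (fun q : ℕ =>
        bandCells (leftBand (inner P m ybar).lo (radius P (2 ^ (m - 1))) (2 ^ q)).clip
          (outerCount P) ++
        bandCells (rightBand (inner P m ybar).hi (radius P (2 ^ (m - 1))) (2 ^ q)).clip
          (outerCount P)) (List.range (bandCount P + 1)) (2 * outerCount P) (fun q _ => by
      rw [List.length_append]
      have h1 := length_bandCells_le
        (leftBand (inner P m ybar).lo (radius P (2 ^ (m - 1))) (2 ^ q)).clip (outerCount P)
      have h2 := length_bandCells_le
        (rightBand (inner P m ybar).hi (radius P (2 ^ (m - 1))) (2 ^ q)).clip (outerCount P)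
      omega)
  rw [List.length_range] at h
  have h3 : (unifCells (inner P m ybar) (innerCount P m ybar)).length = innerCount P m ybar := by
    simp [unifCells]
  omega

end Partition


/-! ### The calibration error is subadditive -/

/-- Cauchy–Schwarz in quotient form. The conditions at zero make it agree with the convention that
division by zero gives zero. -/
theorem add_sq_div_add_le {a b x y : ℝ} (hx : 0 ≤ x) (hy : 0 ≤ y) (hxa : x = 0 → a = 0)
    (hyb : y = 0 → b = 0) : (a + b) ^ 2 / (x + y) ≤ a ^ 2 / x + b ^ 2 / y := by
  rcases hx.eq_or_lt with hx | hx
  · simp [← hx, hxa hx.symm]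
  rcases hy.eq_or_lt with hy | hy
  · simp [← hy, hyb hy.symm]
  rw [div_add_div _ _ hx.ne' hy.ne', div_le_div_iff₀ (by positivity) (by positivity)]
  nlinarith [sq_nonneg (a * y - b * x), mul_pos hx hy]

theorem sum_sq_div_sum_le {κ : Type*} (s : Finset κ) (S n : κ → ℝ) (hn : ∀ k ∈ s, 0 ≤ n k)
    (h0 : ∀ k ∈ s, n k = 0 → S k = 0) :
    (∑ k ∈ s, S k) ^ 2 / ∑ k ∈ s, n k ≤ ∑ k ∈ s, S k ^ 2 / n k := by
  classical
  induction s using Finset.induction_on with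
  | empty => simp
  | insert a s ha ih =>
    have hn' := fun k hk => hn k (Finset.mem_insert_of_mem hk)
    have h0' := fun k hk => h0 k (Finset.mem_insert_of_mem hk)
    rw [Finset.sum_insert ha, Finset.sum_insert ha, Finset.sum_insert ha]
    refine (add_sq_div_add_le (hn a (Finset.mem_insert_self _ _)) (Finset.sum_nonneg hn')
      (h0 a (Finset.mem_insert_self _ _)) fun h => ?_).trans (by linarith [ih hn' h0'])
    exact Finset.sum_eq_zero fun k hk => h0' k hk ((Finset.sum_eq_zero_iff_of_nonneg hn').mp h k hk)

open Classical in
theorem visits_eq (h : List (ℝ × Bool)) (p : ℝ) :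
    (visits h p : ℝ) = (h.map fun x => if x.1 = p then (1 : ℝ) else 0).sum := by
  induction h with
  | nil => simp [visits]
  | cons x h ih =>
    rw [List.map_cons, List.sum_cons, ← ih]
    by_cases hx : x.1 = p
    · simp [visits, hx]; ring
    · simp [visits, hx]

open Classical in
theorem hits_sub_eq (h : List (ℝ × Bool)) (p : ℝ) :
    (hits h p : ℝ) - visits h p * p =
      (h.map fun x => if x.1 = p then outcome x.2 - p else 0).sum := by
  induction h with
  | nil => simp [visits, hits]
  | cons x h ih =>
    rw [List.map_cons, List.sum_cons, ← ih]
    by_cases hx : x.1 = p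
    · cases hy : x.2
      · simp [visits, hits, hx, hy, outcome]; ring
      · simp [visits, hits, hx, hy, outcome]; ring
    · simp [visits, hits, hx]

theorem mul_abs_div_sub_sq (n a p : ℝ) : n * |a / n - p| ^ 2 = (a - n * p) ^ 2 / n := by
  rcases eq_or_ne n 0 with rfl | hn
  · simp
  · rw [sq_abs]; field_simp

open Classical in
-- The quotient form has numerators and denominators additive in the transcript; a larger index set
-- `F` lets different transcripts be compared term by term.
theorem calError_two_eq (h : List (ℝ × Bool)) (F : Finset ℝ) (hF : (h.map Prod.fst).toFinset ⊆ F) :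
    calError 2 h = ∑ p ∈ F,
      ((h.map fun x => if x.1 = p then outcome x.2 - p else 0).sum) ^ 2 /
      (h.map fun x => if x.1 = p then (1 : ℝ) else 0).sum := by
  have h1 : ∀ p, ((h.map fun x => if x.1 = p then outcome x.2 - p else 0).sum) ^ 2 /
      (h.map fun x => if x.1 = p then (1 : ℝ) else 0).sum
      = (visits h p : ℝ) * |(hits h p : ℝ) / (visits h p : ℝ) - p| ^ 2 := fun p => by
    rw [mul_abs_div_sub_sq, hits_sub_eq, visits_eq]
  simp only [h1]
  unfold calError
  refine Finset.sum_subset hF fun p _ hp => ?_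
  have : visits h p = 0 := by
    simp only [visits, List.length_eq_zero_iff, List.filter_eq_nil_iff]
    intro x hx hxp
    exact hp (List.mem_toFinset.mpr (List.mem_map.mpr ⟨x, hx, by simpa using hxp⟩))
  simp [this]

/-- The rounds are distributed over finitely many classes `k`, on each of which the prediction is
constant. -/
theorem calError_le_sum {α κ : Type*} [Fintype κ] (R : List α) (zr : α → ℝ) (y : α → Bool)
    (a : κ → α → ℝ) (z : κ → ℝ) (ha0 : ∀ r ∈ R, ∀ k, 0 ≤ a k r)
    (ha1 : ∀ r ∈ R, ∑ k, a k r = 1) (hz : ∀ r ∈ R, ∀ k, a k r ≠ 0 → z k = zr r) :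
    calError 2 (R.map fun r => (zr r, y r)) ≤
      ∑ k, ((R.map fun r => a k r * (outcome (y r) - z k)).sum) ^ 2 / (R.map (a k)).sum := by
  classical
  set F := ((R.map fun r => (zr r, y r)).map Prod.fst).toFinset
  rw [calError_two_eq _ F subset_rfl]
  have hn0 : ∀ k, 0 ≤ (R.map (a k)).sum := fun k =>
    List.sum_nonneg (by simpa using fun r hr => ha0 r hr k)
  have hS0 : ∀ k, (R.map (a k)).sum = 0 →
      (R.map fun r => a k r * (outcome (y r) - z k)).sum = 0 := by
    intro k
    clear_value F
    clear hn0 ha1 hz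
    induction R with
    | nil => simp
    | cons r R ih =>
      intro h
      rw [List.map_cons, List.sum_cons] at h ⊢
      have h1 := ha0 r List.mem_cons_self k
      have h2 : 0 ≤ (R.map (a k)).sum :=
        List.sum_nonneg (by simpa using fun r hr => ha0 r (List.mem_cons_of_mem _ hr) k)
      rw [ih (fun r hr => ha0 r (List.mem_cons_of_mem _ hr)) (by linarith),
        show a k r = 0 by linarith]
      simp
  -- Several classes may share one prediction `p`; their sums add up to those of `p`, and
  -- Cauchy–Schwarz then separates the classes.
  have key : ∀ (p : ℝ) (f : α → ℝ),
      (R.map fun r => if zr r = p then f r else 0).sum =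
        ∑ k ∈ Finset.univ.filter (fun k => z k = p), (R.map fun r => a k r * f r).sum := by
    intro p f
    clear hS0 hn0
    clear_value F
    induction R with
    | nil => simp
    | cons r R ih =>
      simp only [List.map_cons, List.sum_cons, Finset.sum_add_distrib]
      rw [ih (fun r hr => ha0 r (List.mem_cons_of_mem _ hr))
        (fun r hr => ha1 r (List.mem_cons_of_mem _ hr))
        (fun r hr => hz r (List.mem_cons_of_mem _ hr)), ← Finset.sum_mul]
      congr 1
      have h1 : ∑ k ∈ Finset.univ.filter (fun k => z k = p), a k r
          = if zr r = p then 1 else 0 := by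
        split_ifs with h
        · rw [← ha1 r List.mem_cons_self]
          refine Finset.sum_subset (Finset.subset_univ _) fun k _ hk => ?_
          by_contra hne
          exact hk (by simpa using (hz r List.mem_cons_self k hne).trans h)
        · refine Finset.sum_eq_zero fun k hk => ?_
          by_contra hne
          rw [Finset.mem_filter] at hk
          exact h ((hz r List.mem_cons_self k hne).symm.trans hk.2)
      rw [h1]
      split_ifs <;> simp
  calc _ = ∑ p ∈ F, (∑ k ∈ Finset.univ.filter (fun k => z k = p),
        (R.map fun r => a k r * (outcome (y r) - z k)).sum) ^ 2 /
        ∑ k ∈ Finset.univ.filter (fun k => z k = p), (R.map (a k)).sum := by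
        refine Finset.sum_congr rfl fun p _ => ?_
        rw [List.map_map, List.map_map]
        congr 1
        · congr 1
          refine (key p fun r => outcome (y r) - p).trans (Finset.sum_congr rfl fun k hk => ?_)
          rw [(Finset.mem_filter.mp hk).2]
        · refine (key p fun _ => 1).trans (Finset.sum_congr rfl fun k _ => ?_)
          simp
    _ ≤ ∑ p ∈ F, ∑ k ∈ Finset.univ.filter (fun k => z k = p),
        ((R.map fun r => a k r * (outcome (y r) - z k)).sum) ^ 2 / (R.map (a k)).sum :=
        Finset.sum_le_sum fun p _ => sum_sq_div_sum_le _ _ _ (fun k _ => hn0 k) fun k _ => hS0 k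
    _ ≤ ∑ k, ((R.map fun r => a k r * (outcome (y r) - z k)).sum) ^ 2 / (R.map (a k)).sum := by
        rw [Finset.sum_fiberwise_eq_sum_filter]
        exact Finset.sum_le_sum_of_subset_of_nonneg (Finset.filter_subset _ _)
          fun k _ _ => div_nonneg (sq_nonneg _) (hn0 k)

/-- Convexity of `(S, n) ↦ S² / n`: merging the visits to a value in two epochs never costs more
than counting them separately, so epochs can be analysed one at a time. -/
theorem calError_append_le (h h' : List (ℝ × Bool)) :
    calError 2 (h ++ h') ≤ calError 2 h + calError 2 h' := by
  classical
  have h1 : ∀ (l : List (ℝ × Bool)) p,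
      (l.map fun x => if x.1 = p then (1 : ℝ) else 0).sum = 0 →
      (l.map fun x => if x.1 = p then outcome x.2 - p else 0).sum = 0 := by
    intro l p hl
    rw [← hits_sub_eq]
    rw [← visits_eq] at hl
    have hle : hits l p ≤ visits l p := by
      unfold hits visits
      rw [← List.countP_eq_length_filter, ← List.countP_eq_length_filter]
      exact List.countP_mono_left fun x _ hx => by simp at hx ⊢; exact hx.1
    have hv : visits l p = 0 := by exact_mod_cast hl
    have hh : hits l p = 0 := by omega
    simp [hv, hh]
  have h2 : ∀ (l : List (ℝ × Bool)) p,
      0 ≤ (l.map fun x => if x.1 = p then (1 : ℝ) else 0).sum := fun l p => by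
    rw [← visits_eq]; positivity
  rw [calError_two_eq (h ++ h') _ subset_rfl,
    calError_two_eq h ((h ++ h').map Prod.fst).toFinset (by intro x; simp; tauto),
    calError_two_eq h' ((h ++ h').map Prod.fst).toFinset (by intro x; simp; tauto),
    ← Finset.sum_add_distrib]
  refine Finset.sum_le_sum fun p _ => ?_
  rw [List.map_append, List.sum_append, List.map_append, List.sum_append]
  exact add_sq_div_add_le (h2 _ _) (h2 _ _) (h1 _ _) (h1 _ _)


/-! ### Expectations -/

/-- The expectation of `F` under `p`. -/
def expect {α : Type*} (p : PMF α) (F : α → ℝ≥0∞) : ℝ≥0∞ := ∑' a, p a * F a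

theorem expect_pure {α : Type*} (a : α) (F : α → ℝ≥0∞) : expect (PMF.pure a) F = F a := by
  unfold expect
  rw [tsum_eq_single a fun b hb => by simp [PMF.pure_apply, hb]]
  simp

theorem expect_bind {α β : Type*} (p : PMF α) (f : α → PMF β) (F : β → ℝ≥0∞) :
    expect (p.bind f) F = expect p fun a => expect (f a) F := by
  unfold expect
  simp only [PMF.bind_apply, ← ENNReal.tsum_mul_right, ← ENNReal.tsum_mul_left]
  rw [ENNReal.tsum_comm]
  exact tsum_congr fun a => tsum_congr fun b => by rw [mul_assoc]

theorem expect_mono {α : Type*} (p : PMF α) {F G : α → ℝ≥0∞} (h : ∀ a ∈ p.support, F a ≤ G a) :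
    expect p F ≤ expect p G := by
  refine ENNReal.tsum_le_tsum fun a => ?_
  by_cases ha : a ∈ p.support
  · exact mul_le_mul_right (h a ha) _
  · rw [PMF.mem_support_iff, not_not] at ha
    simp [ha]

theorem expect_coin {x : ℝ} (hx : x ∈ Set.Icc (0 : ℝ) 1) {f : Bool → ℝ} (hf : ∀ b, 0 ≤ f b) :
    expect (coin x) (fun b => ENNReal.ofReal (f b)) =
      ENNReal.ofReal (x * f true + (1 - x) * f false) := by
  have h1 : min x.toNNReal 1 = x.toNNReal := min_eq_left (Real.toNNReal_le_one.mpr hx.2)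
  have ht : coin x true = ENNReal.ofReal x := by
    simp only [coin, PMF.bernoulli_apply, h1, cond_true]
    rfl
  have hf' : coin x false = ENNReal.ofReal (1 - x) := by
    simp only [coin, PMF.bernoulli_apply, h1, cond_false]
    rw [ENNReal.ofReal_sub _ hx.1, ENNReal.ofReal_one]
    simp [ENNReal.ofReal]
  unfold expect
  rw [tsum_bool, ht, hf', ← ENNReal.ofReal_mul hx.1, ← ENNReal.ofReal_mul (by linarith [hx.2]),
    ← ENNReal.ofReal_add (mul_nonneg (by linarith [hx.2]) (hf _)) (mul_nonneg hx.1 (hf _)),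
    add_comm]

/-- The exponential moment of a product of two independent factors, one of which is centered. -/
theorem exp_moment_le {a q v : ℝ} {A B : Bool → ℝ} (ha : a ∈ Set.Icc (0 : ℝ) 1)
    (hq : q ∈ Set.Icc (0 : ℝ) 1) (hA : ∀ b, |A b| ≤ 1) (hB : ∀ y, |B y| ≤ 1)
    (h0 : a * A true + (1 - a) * A false = 0 ∨ q * B true + (1 - q) * B false = 0)
    (hv : a * A true ^ 2 + (1 - a) * A false ^ 2 ≤ v) {l : ℝ} (hl : |l| ≤ 1) :
    a * (q * Real.exp (l * (A true * B true) - l ^ 2 * v) +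
        (1 - q) * Real.exp (l * (A true * B false) - l ^ 2 * v)) +
      (1 - a) * (q * Real.exp (l * (A false * B true) - l ^ 2 * v) +
        (1 - q) * Real.exp (l * (A false * B false) - l ^ 2 * v)) ≤ 1 := by
  have ha' : 0 ≤ 1 - a := by linarith [ha.2]
  have hq' : 0 ≤ 1 - q := by linarith [hq.2]
  have hBsq : ∀ y, B y ^ 2 ≤ 1 := fun y => by
    rw [← sq_abs]; nlinarith [abs_nonneg (B y), hB y]
  -- The second order term keeps `A²` and drops `B² ≤ 1`. After averaging, the linear term vanishes
  -- because one of the two independent factors is centered.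
  have hterm : ∀ b y, Real.exp (l * (A b * B y) - l ^ 2 * v) ≤
      (1 + l * (A b * B y) + l ^ 2 * A b ^ 2) * Real.exp (-(l ^ 2 * v)) := by
    intro b y
    rw [sub_eq_add_neg, Real.exp_add]
    refine mul_le_mul_of_nonneg_right ?_ (Real.exp_pos _).le
    have h1 : |A b * B y| ≤ 1 := by
      rw [abs_mul]; nlinarith [abs_nonneg (A b), abs_nonneg (B y), hA b, hB y]
    have h2 : |l * (A b * B y)| ≤ 1 := by
      rw [abs_mul]; nlinarith [abs_nonneg l, abs_nonneg (A b * B y)]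
    refine (exp_le_quadratic h2).trans ?_
    have h3 : (l * (A b * B y)) ^ 2 = (l * A b) ^ 2 * B y ^ 2 := by ring
    have h4 : l ^ 2 * A b ^ 2 = (l * A b) ^ 2 := by ring
    rw [h3, h4]
    nlinarith [hBsq y, sq_nonneg (l * A b)]
  set e := Real.exp (-(l ^ 2 * v)) with he
  have he0 : 0 < e := Real.exp_pos _
  have hsum : a * (q * Real.exp (l * (A true * B true) - l ^ 2 * v) +
        (1 - q) * Real.exp (l * (A true * B false) - l ^ 2 * v)) +
      (1 - a) * (q * Real.exp (l * (A false * B true) - l ^ 2 * v) +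
        (1 - q) * Real.exp (l * (A false * B false) - l ^ 2 * v)) ≤
      a * (q * ((1 + l * (A true * B true) + l ^ 2 * A true ^ 2) * e) +
        (1 - q) * ((1 + l * (A true * B false) + l ^ 2 * A true ^ 2) * e)) +
      (1 - a) * (q * ((1 + l * (A false * B true) + l ^ 2 * A false ^ 2) * e) +
        (1 - q) * ((1 + l * (A false * B false) + l ^ 2 * A false ^ 2) * e)) := by
    have hq0 := hq.1
    have ha0 := ha.1
    gcongr <;> exact hterm _ _
  refine hsum.trans ?_
  have heq : a * (q * ((1 + l * (A true * B true) + l ^ 2 * A true ^ 2) * e) +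
        (1 - q) * ((1 + l * (A true * B false) + l ^ 2 * A true ^ 2) * e)) +
      (1 - a) * (q * ((1 + l * (A false * B true) + l ^ 2 * A false ^ 2) * e) +
        (1 - q) * ((1 + l * (A false * B false) + l ^ 2 * A false ^ 2) * e)) =
      (1 + l * ((a * A true + (1 - a) * A false) * (q * B true + (1 - q) * B false)) +
        l ^ 2 * (a * A true ^ 2 + (1 - a) * A false ^ 2)) * e := by ring
  have hzero : (a * A true + (1 - a) * A false) * (q * B true + (1 - q) * B false) = 0 := by
    rcases h0 with h | h <;> rw [h] <;> ring
  rw [heq, hzero, mul_zero, add_zero]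
  have h1 : 1 + l ^ 2 * (a * A true ^ 2 + (1 - a) * A false ^ 2) ≤ Real.exp (l ^ 2 * v) := by
    have := Real.add_one_le_exp (l ^ 2 * v)
    have := mul_le_mul_of_nonneg_left hv (sq_nonneg l)
    linarith
  calc _ ≤ Real.exp (l ^ 2 * v) * e := by gcongr
    _ = 1 := by rw [he, ← Real.exp_add]; simp

/-! ### The law of the coins and outcomes -/

section Law

variable (S : Subroutines) (P : Params) (first : ℕ → ℝ) (q : ℕ → ℝ)

/-- The law of the coins of the forecaster and of the outcomes. -/
def coinLaw : ℕ → PMF (List (Bool × Bool))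
  | 0 => PMF.pure []
  | t + 1 => (coinLaw t).bind fun h =>
      (coin (plan S first (stateAfter S P first (h.map Prod.snd))).val.pr).bind fun b =>
        (coin (q t)).bind fun y => PMF.pure (h ++ [(b, y)])

/-- The rounds of the whole game. -/
def gameRecs (h : List (Bool × Bool)) : List Rec := recs S P first 0 initState h

def transcript (R : List Rec) : List (ℝ × Bool) := R.map fun r => (r.z, r.y)

theorem gameRecs_concat (h : List (Bool × Bool)) (b y : Bool) :
    gameRecs S P first (h ++ [(b, y)]) = gameRecs S P first h ++
      [⟨h.length, stateAfter S P first (h.map Prod.snd),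
        (plan S first (stateAfter S P first (h.map Prod.snd))).val, b, y⟩] := by
  rw [gameRecs, recs_append, zero_add, stateAfter_map_snd]
  rfl

theorem map_snd_transcript (h : List (Bool × Bool)) (t : ℕ) (st : State) :
    (transcript (recs S P first t st h)).map Prod.snd = h.map Prod.snd := by
  induction h generalizing t st with
  | nil => rfl
  | cons x h ih => simpa [recs, transcript] using ih _ _

/-- The memory depends only on the outcomes, so the game is a function of coins and outcomes.
Working with coins keeps the drawn point `u`, which the transcript forgets. -/
theorem law_eq (t : ℕ) :
    law S P first q t = (coinLaw S P first q t).map fun h => transcript (gameRecs S P first h) := by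
  induction t with
  | zero => simp only [law, coinLaw, PMF.pure_map]; rfl
  | succ t ih =>
    simp only [law, coinLaw, ih, PMF.map_bind, PMF.bind_map, PMF.pure_map]
    congr 1
    funext h
    simp only [Function.comp_apply, gameRecs_concat]
    have := map_snd_transcript S P first h 0 initState
    rw [← gameRecs] at this
    rw [this]
    simp [transcript, Rec.z]

theorem length_of_mem_support (t : ℕ) {h : List (Bool × Bool)}
    (hh : h ∈ (coinLaw S P first q t).support) : h.length = t := by
  induction t generalizing h with
  | zero => simp only [coinLaw, PMF.support_pure, Set.mem_singleton_iff] at hh; simp [hh]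
  | succ t ih =>
    simp only [coinLaw, PMF.mem_support_bind_iff, PMF.support_pure, Set.mem_singleton_iff] at hh
    obtain ⟨h', hh', b, -, y, -, rfl⟩ := hh
    simp [ih hh']

variable {S P first q}

/-- A random quantity of one round whose exponential has mean at most `1`. -/
def SubUnit (S : Subroutines) (first q : ℕ → ℝ) (f : Rec → ℝ) : Prop :=
  ∀ (t : ℕ) (st : State), (plan S first st).val.pr ∈ Set.Icc (0 : ℝ) 1 →
    expect (coin (plan S first st).val.pr) (fun b => expect (coin (q t)) fun y =>
      ENNReal.ofReal (Real.exp (f ⟨t, st, (plan S first st).val, b, y⟩))) ≤ 1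

/-- An exponential supermartingale: given the history, the factor of the next round has mean at most
`1`. The tail bound after it is Markov's inequality. -/
theorem expect_exp_sum_le (hpr : ∀ st, (plan S first st).val.pr ∈ Set.Icc (0 : ℝ) 1)
    {f : Rec → ℝ} (hf : SubUnit S first q f) (t : ℕ) :
    expect (coinLaw S P first q t)
      (fun h => ENNReal.ofReal (Real.exp ((gameRecs S P first h).map f).sum)) ≤ 1 := by
  induction t with
  | zero => simp [coinLaw, expect_pure, gameRecs, recs]
  | succ t ih =>
    simp only [coinLaw, expect_bind, expect_pure, gameRecs_concat]
    refine (expect_mono _ fun h hh => ?_).trans ih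
    rw [length_of_mem_support S P first q t hh]
    simp only [List.map_append, List.sum_append, List.map_cons, List.map_nil, List.sum_cons,
      List.sum_nil, add_zero, Real.exp_add]
    simp only [ENNReal.ofReal_mul (Real.exp_pos _).le]
    have h1 := hf t (stateAfter S P first (h.map Prod.snd)) (hpr _)
    simp only [expect] at h1 ⊢
    simp only [mul_left_comm _ (ENNReal.ofReal (Real.exp (List.map f (gameRecs S P first h)).sum)) _,
      ENNReal.tsum_mul_left]
    exact mul_le_of_le_one_right zero_le h1

theorem prob_lt_sum_le (hpr : ∀ st, (plan S first st).val.pr ∈ Set.Icc (0 : ℝ) 1)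
    {f : Rec → ℝ} (hf : SubUnit S first q f) (t : ℕ) (x : ℝ) :
    (coinLaw S P first q t).toOuterMeasure {h | x < ((gameRecs S P first h).map f).sum} ≤
      ENNReal.ofReal (Real.exp (-x)) := by
  rw [PMF.toOuterMeasure_apply]
  calc _ ≤ ∑' h, coinLaw S P first q t h *
        ENNReal.ofReal (Real.exp ((gameRecs S P first h).map f).sum) *
          ENNReal.ofReal (Real.exp (-x)) := by
        classical
        refine ENNReal.tsum_le_tsum fun h => ?_
        rw [Set.indicator_apply]
        split_ifs with hh
        swap
        · exact bot_le
        rw [mul_assoc, ← ENNReal.ofReal_mul (Real.exp_pos _).le, ← Real.exp_add]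
        refine le_mul_of_one_le_right bot_le ?_
        rw [ENNReal.one_le_ofReal]
        have hh' : x < ((gameRecs S P first h).map f).sum := hh
        exact Real.one_le_exp (by linarith)
    _ ≤ 1 * ENNReal.ofReal (Real.exp (-x)) := by
        rw [ENNReal.tsum_mul_right]
        exact mul_le_mul_left (expect_exp_sum_le hpr hf t) _
    _ = _ := one_mul _

/-! ### The deviations that have to be controlled -/

/-- The cell of the expert at position `j`. -/
def Rec.cell (j : ℕ) (r : Rec) : Cell :=
  (r.st.experts.getD j ⟨⟨0, 0, false, false⟩, 0, 0, 0⟩).cell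

/-- The factor of a deviation that depends on the coin of the forecaster. -/
def coinFactor (j : ℕ) (k : Fin 4) (r : Rec) : ℝ :=
  match k with
  | 0 => 1
  | 1 => (r.cell j).ind r.u - r.p.prob (r.cell j)
  | 2 => (r.cell j).ind r.u - r.p.prob (r.cell j)
  | 3 => r.p.prob (r.cell j)

/-- The factor of a deviation that depends on the outcome. -/
def outcomeFactor (q : ℕ → ℝ) (k : Fin 4) (r : Rec) : ℝ :=
  match k with
  | 0 => outcome r.y - q r.t
  | 1 => 1
  | 2 => outcome r.y
  | 3 => outcome r.y - q r.t

/-- A centered quantity of the rounds of epoch `m`. -/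
def deviate (q : ℕ → ℝ) (m j : ℕ) (k : Fin 4) (r : Rec) : ℝ :=
  if r.st.m = m then coinFactor j k r * outcomeFactor q k r else 0

/-- A bound for its conditional variance. -/
def varBound (m j : ℕ) (k : Fin 4) (r : Rec) : ℝ :=
  if r.st.m = m then (if k = 0 then 1 else r.p.prob (r.cell j)) else 0

/-- The four kinds compare outcomes with their means over an epoch (`0`), visits to a cell with
their probabilities (`1`), the same weighted by the outcome (`2`), and outcomes with means weighted
by the visit probability (`3`). In `1` and `2` the coin factor is centered, in `0` and `3` the
outcome factor. -/
theorem subUnit_deviate (hq : ∀ t, q t ∈ Set.Icc (0 : ℝ) 1) (m j : ℕ) (k : Fin 4) {l : ℝ}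
    (hl : |l| ≤ 1) :
    SubUnit S first q fun r => l * deviate q m j k r - l ^ 2 * varBound m j k r := by
  intro t st hpr
  set p := (plan S first st).val
  have hinner : ∀ b, expect (coin (q t)) (fun y => ENNReal.ofReal (Real.exp
      (l * deviate q m j k ⟨t, st, p, b, y⟩ - l ^ 2 * varBound m j k ⟨t, st, p, b, y⟩))) = _ :=
    fun b => expect_coin (hq t) fun y => (Real.exp_pos _).le
  simp only [hinner]
  have hq1 : 0 ≤ 1 - q t := by linarith [(hq t).2]
  rw [expect_coin hpr fun b => add_nonneg (mul_nonneg (hq t).1 (Real.exp_pos _).le)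
    (mul_nonneg hq1 (Real.exp_pos _).le), ← ENNReal.ofReal_one]
  refine ENNReal.ofReal_le_ofReal ?_
  by_cases hm : st.m = m
  · simp only [deviate, varBound, hm, if_true]
    set J : Cell := (st.experts.getD j ⟨⟨0, 0, false, false⟩, 0, 0, 0⟩).cell
    have hJ : ∀ b y, Rec.cell j ⟨t, st, p, b, y⟩ = J := fun _ _ => rfl
    have hp0 := Plan.prob_nonneg hpr J
    have hp1 := Plan.prob_le_one hpr J
    have hB : ∀ y, |outcome y - q t| ≤ 1 := fun y => by
      rw [abs_sub_comm]; exact abs_sub_outcome_le (hq t) y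
    have hB0 : q t * (outcome true - q t) + (1 - q t) * (outcome false - q t) = 0 := by
      simp [outcome]; ring
    have hy : ∀ y, |outcome y| ≤ 1 := fun y => by
      rw [abs_of_nonneg (outcome_mem y).1]; exact (outcome_mem y).2
    have hA : ∀ u, |J.ind u - p.prob J| ≤ 1 := fun u => by
      rw [abs_le]
      constructor <;> linarith [J.ind_nonneg u, J.ind_le_one u]
    have hA0 : p.pr * (J.ind p.u₀ - p.prob J) + (1 - p.pr) * (J.ind p.u₁ - p.prob J) = 0 := by
      unfold Plan.prob; ring
    have hA2 : p.pr * (J.ind p.u₀ - p.prob J) ^ 2 + (1 - p.pr) * (J.ind p.u₁ - p.prob J) ^ 2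
        ≤ p.prob J := by
      have h1 : p.pr * (J.ind p.u₀ - p.prob J) ^ 2 + (1 - p.pr) * (J.ind p.u₁ - p.prob J) ^ 2
          = p.pr * J.ind p.u₀ ^ 2 + (1 - p.pr) * J.ind p.u₁ ^ 2 - p.prob J ^ 2 := by
        unfold Plan.prob; ring
      have h2 : ∀ u, J.ind u ^ 2 = J.ind u := fun u => by
        rcases J.ind_eq_or u with h | h <;> rw [h] <;> norm_num
      rw [h1, h2, h2]
      have h3 : p.prob J = p.pr * J.ind p.u₀ + (1 - p.pr) * J.ind p.u₁ := rfl
      nlinarith [sq_nonneg (p.prob J)]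
    fin_cases k
    · simpa [coinFactor, outcomeFactor] using exp_moment_le (A := fun _ => 1)
        (B := fun y => outcome y - q t) (v := 1) hpr (hq t) (by simp) hB (Or.inr hB0) (by simp) hl
    · simpa [coinFactor, outcomeFactor, hJ, Rec.u] using exp_moment_le
        (A := fun b => J.ind (if b then p.u₀ else p.u₁) - p.prob J)
        (B := fun _ => 1) (v := p.prob J) hpr (hq t) (fun _ => hA _) (by simp)
        (Or.inl (by simpa using hA0)) (by simpa using hA2) hl
    · simpa [coinFactor, outcomeFactor, hJ, Rec.u] using exp_moment_le
        (A := fun b => J.ind (if b then p.u₀ else p.u₁) - p.prob J)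
        (B := outcome) (v := p.prob J) hpr (hq t) (fun _ => hA _) hy
        (Or.inl (by simpa using hA0)) (by simpa using hA2) hl
    · simpa [coinFactor, outcomeFactor, hJ] using exp_moment_le (A := fun _ => p.prob J)
        (B := fun y => outcome y - q t) (v := p.prob J) hpr (hq t)
        (fun _ => by rw [abs_of_nonneg hp0]; exact hp1) hB (Or.inr hB0) (by nlinarith) hl
  · simp only [deviate, varBound, hm, if_false, mul_zero, sub_zero, Real.exp_zero]
    linarith

/-- All deviations are controlled, at every scale `1 / i` up to `1 / T`. -/
def Controlled (q : ℕ → ℝ) (T M D : ℕ) (x : ℝ) (R : List Rec) : Prop :=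
  ∀ m < M, ∀ j < D, ∀ (k : Fin 4) (σ : Bool), ∀ i < T,
    (R.map fun r => sgn σ * (1 / ((i : ℝ) + 1)) * deviate q m j k r -
      (sgn σ * (1 / ((i : ℝ) + 1))) ^ 2 * varBound m j k r).sum ≤ x

theorem prob_not_controlled_le (hpr : ∀ st, (plan S first st).val.pr ∈ Set.Icc (0 : ℝ) 1)
    (hq : ∀ t, q t ∈ Set.Icc (0 : ℝ) 1) (t T M D : ℕ) (x : ℝ) :
    (coinLaw S P first q t).toOuterMeasure {h | ¬Controlled q T M D x (gameRecs S P first h)} ≤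
      (M * D * 4 * 2 * T : ℕ) * ENNReal.ofReal (Real.exp (-x)) := by
  set μ := (coinLaw S P first q t).toOuterMeasure
  let s := Finset.range M ×ˢ Finset.range D ×ˢ (Finset.univ : Finset (Fin 4)) ×ˢ
    (Finset.univ : Finset Bool) ×ˢ Finset.range T
  let bad : ℕ × ℕ × Fin 4 × Bool × ℕ → Set (List (Bool × Bool)) := fun a =>
    {h | x < ((gameRecs S P first h).map fun r =>
      sgn a.2.2.2.1 * (1 / ((a.2.2.2.2 : ℝ) + 1)) * deviate q a.1 a.2.1 a.2.2.1 r -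
      (sgn a.2.2.2.1 * (1 / ((a.2.2.2.2 : ℝ) + 1))) ^ 2 * varBound a.1 a.2.1 a.2.2.1 r).sum}
  have hsub : {h | ¬Controlled q T M D x (gameRecs S P first h)} ⊆ ⋃ a ∈ s, bad a := by
    intro h hh
    simp only [Set.mem_ofPred_eq, Controlled] at hh
    push Not at hh
    obtain ⟨m, hm, j, hj, k, σ, i, hi, hx⟩ := hh
    refine Set.mem_biUnion (x := (m, j, k, σ, i)) ?_ hx
    simp only [s, Finset.coe_product, Set.mem_prod, Finset.mem_coe, Finset.mem_range,
      Finset.mem_univ, true_and]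
    exact ⟨hm, hj, hi⟩
  have hcard : s.card = M * D * 4 * 2 * T := by
    simp only [s, Finset.card_product, Finset.card_range, Finset.card_univ, Fintype.card_fin,
      Fintype.card_bool]
    ring
  calc μ _ ≤ μ (⋃ a ∈ s, bad a) := MeasureTheory.measure_mono hsub
    _ ≤ ∑ a ∈ s, μ (bad a) := MeasureTheory.measure_biUnion_finset_le _ _
    _ ≤ ∑ _a ∈ s, ENNReal.ofReal (Real.exp (-x)) := by
        refine Finset.sum_le_sum fun a _ => prob_lt_sum_le hpr (subUnit_deviate hq _ _ _ ?_) t x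
        rw [abs_mul, abs_sgn, one_mul, abs_of_nonneg (by positivity)]
        exact div_le_one_of_le₀ (by linarith [(Nat.cast_nonneg a.2.2.2.2 : (0:ℝ) ≤ _)])
          (by positivity)
    _ = _ := by rw [Finset.sum_const, hcard, nsmul_eq_mul]

/-- The conclusion for a single deviation. -/
theorem abs_le_of_scales {X V x : ℝ} {T : ℕ} (hx : 1 ≤ x) (hV : 0 ≤ V) (hVT : V ≤ T)
    (hT : 1 ≤ T)
    (h : ∀ (σ : Bool), ∀ i < T, sgn σ * (1 / ((i : ℝ) + 1)) * X -
      (sgn σ * (1 / ((i : ℝ) + 1))) ^ 2 * V ≤ x) :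
    |X| ≤ 2 * √(x * V) + x := by
  have hT' : (1 : ℝ) ≤ T := by exact_mod_cast hT
  -- The optimal scale is about `√(x / V)`. As `V` is random it is chosen only now, from the grid `1
  -- / (i + 1)`; rounding costs the additive `x`, and `V ≤ T` keeps `i` below `T`.
  have key : ∃ i < T, (i : ℝ) ≤ √(V / x) ∧ √(V / x) ≤ i + 1 := by
    have h1 : √(V / x) ≤ T := by
      rw [Real.sqrt_le_left (by linarith)]
      have : V / x ≤ V := div_le_self hV hx
      nlinarith
    rcases (Real.sqrt_nonneg (V / x)).eq_or_lt with h0 | h0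
    · exact ⟨0, by omega, by simp [← h0], by rw [← h0]; positivity⟩
    · have h2 : 0 < ⌈√(V / x)⌉₊ := Nat.ceil_pos.mpr h0
      refine ⟨⌈√(V / x)⌉₊ - 1, ?_, ?_, ?_⟩
      · have : ⌈√(V / x)⌉₊ ≤ T := Nat.ceil_le.mpr h1
        omega
      · have := Nat.ceil_lt_add_one h0.le
        rw [Nat.cast_sub h2]
        push_cast
        linarith
      · have := Nat.le_ceil √(V / x)
        rw [Nat.cast_sub h2]
        push_cast
        linarith
  obtain ⟨i, hi, hi1, hi2⟩ := key
  have hs : √(x * V) = √(V / x) * x := by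
    have : x * V = V / x * x ^ 2 := by field_simp
    rw [this, Real.sqrt_mul (by positivity), Real.sqrt_sq (by linarith)]
  have hs2 : √(V / x) * √(V / x) * x = V := by
    rw [Real.mul_self_sqrt (by positivity)]; field_simp
  set s := √(V / x)
  have hi0 : (0 : ℝ) ≤ i := Nat.cast_nonneg i
  have hpos : (0 : ℝ) < (i : ℝ) + 1 := by positivity
  have hone : ∀ σ, sgn σ * X ≤ 2 * (s * x) + x := by
    intro σ
    have h1 := h σ i hi
    have h2 : (sgn σ * (1 / ((i : ℝ) + 1))) ^ 2 = (1 / ((i : ℝ) + 1)) ^ 2 := by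
      rw [mul_pow, ← sq_abs (sgn σ), abs_sgn]; ring
    rw [h2] at h1
    have h3 : sgn σ * X ≤ x * ((i : ℝ) + 1) + V / ((i : ℝ) + 1) := by
      have h4 : sgn σ * X = (sgn σ * (1 / ((i : ℝ) + 1)) * X) * ((i : ℝ) + 1) := by field_simp
      have h5 : V / ((i : ℝ) + 1) = (1 / ((i : ℝ) + 1)) ^ 2 * V * ((i : ℝ) + 1) := by field_simp
      rw [h4, h5]
      nlinarith
    have h6 : V / ((i : ℝ) + 1) ≤ s * x := by
      rw [div_le_iff₀ hpos, ← hs2]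
      have : 0 ≤ s * x := by have := Real.sqrt_nonneg (V / x); positivity
      nlinarith
    nlinarith
  rw [hs, abs_le]
  have h1 := hone true
  have h2 := hone false
  simp only [sgn, if_true, one_mul, Bool.false_eq_true, if_false, neg_one_mul] at h1 h2
  constructor <;> linarith

end Law


/-! ### Bounds for a single cell -/

/-- With fewer than `i` visits the trivial `S² ≤ n²` is enough. Otherwise `N` and `n` are
comparable, hence `s² ≲ i n`, and the square of the calibration bound can be divided by `n`. -/
theorem cell_error_le {S n N w i s : ℝ} (hi : 0 < i) (hn : 0 ≤ n) (hN : 0 ≤ N) (hw : 0 ≤ w)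
    (hs : s = √(i * N)) (hS1 : |S| ≤ n) (hS2 : |S| ≤ 2002 * (i + s) + N * w)
    (hnN : |n - N| ≤ s / 2 + i / 16) : S ^ 2 / n ≤ 10 ^ 8 * i + 18 * (n * w ^ 2) := by
  have hs0 : 0 ≤ s := hs ▸ Real.sqrt_nonneg _
  have hs2 : s ^ 2 = i * N := by rw [hs]; exact Real.sq_sqrt (by positivity)
  have hnw : 0 ≤ n * w ^ 2 := by positivity
  rcases hn.eq_or_lt with h0 | h0
  · rw [← h0]; simp; positivity
  rw [div_le_iff₀ h0]
  have hS0 := abs_nonneg S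
  rcases le_total n i with h | h
  · have h1 : S ^ 2 ≤ n * n := by rw [← sq_abs, sq]; gcongr
    have h2 : n * n ≤ i * n := by gcongr
    have h3 : 0 ≤ n * w ^ 2 * n := by positivity
    have h4 : 0 ≤ i * n := by positivity
    nlinarith
  · have hsN : s ≤ (N + i) / 2 := by nlinarith [sq_nonneg (N - i)]
    have h1 := (abs_le.mp hnN).1
    have hN3 : N ≤ 3 * n := by linarith
    have hs3 : s ^ 2 ≤ 3 * (i * n) := by rw [hs2]; nlinarith
    have hi2 : i ^ 2 ≤ i * n := by nlinarith
    have h2 : |S| ≤ 2002 * (i + s) + 3 * n * w :=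
      hS2.trans (by gcongr)
    have h3 : S ^ 2 ≤ (2002 * (i + s) + 3 * n * w) ^ 2 := by
      rw [← sq_abs]; gcongr
    have h4 : (i + s) ^ 2 ≤ 8 * (i * n) := by nlinarith [sq_nonneg (i - s)]
    have h5 : (2002 * (i + s) + 3 * n * w) ^ 2 ≤
        2 * (2002 ^ 2 * (i + s) ^ 2) + 2 * (9 * n ^ 2 * w ^ 2) := by
      nlinarith [sq_nonneg (2002 * (i + s) - 3 * n * w)]
    have h6 : 0 ≤ i * n := by positivity
    nlinarith

/-- Multiplying the bound on `N ρ` by `ρ` makes `s ρ = √i · √N ρ` absorbable into `N ρ² / 2` by the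
inequality of means; then `w ≤ ρ / K` turns `N ρ²` into `N w²`. -/
theorem far_cell_le {n N w i s ρ c K : ℝ} (hi : 0 < i) (hN : 0 ≤ N) (hw : 0 ≤ w)
    (hw1 : w ≤ 1) (hs : s = √(i * N)) (hnN : |n - N| ≤ s / 2 + i / 16) (hρ : 0 < ρ)
    (hρ1 : ρ ≤ 1) (hc : 0 ≤ c) (hK : 1 ≤ K) (hwρ : w ≤ ρ / K)
    (hN' : N * ρ ≤ c + 2001 * (i + s)) :
    n * w ^ 2 ≤ 4 * (c / K ^ 2) + 11 * 10 ^ 6 * i := by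
  have hs0 : 0 ≤ s := hs ▸ Real.sqrt_nonneg _
  have hs2 : s ^ 2 = i * N := by rw [hs]; exact Real.sq_sqrt (by positivity)
  have hsN : s ≤ (N + i) / 2 := by nlinarith [sq_nonneg (N - i)]
  have hn : n ≤ 2 * N + i := by linarith [(abs_le.mp hnN).2]
  have hw2 : w ^ 2 ≤ 1 := by nlinarith
  have h1 : 2001 * s * ρ ≤ N * ρ ^ 2 / 2 + 2001 ^ 2 * i / 2 := by
    have hsi : s = √i * √N := by rw [hs, Real.sqrt_mul hi.le]
    nlinarith [sq_nonneg (√N * ρ - 2001 * √i), Real.sq_sqrt hi.le, Real.sq_sqrt hN]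
  have h2 : N * ρ ^ 2 ≤ c * ρ + 2001 * i * ρ + 2001 * s * ρ := by nlinarith
  have h3 : c * ρ ≤ c := by nlinarith
  have h4 : i * ρ ≤ i := by nlinarith
  have h5 : N * ρ ^ 2 ≤ 2 * c + 4.1 * 10 ^ 6 * i := by nlinarith
  have h6 : w ^ 2 ≤ ρ ^ 2 / K ^ 2 := by
    rw [← div_pow]; gcongr
  have h7 : N * w ^ 2 ≤ 2 * (c / K ^ 2) + 4.1 * 10 ^ 6 * i := by
    calc N * w ^ 2 ≤ N * (ρ ^ 2 / K ^ 2) := by gcongr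
      _ = N * ρ ^ 2 / K ^ 2 := by ring
      _ ≤ (2 * c + 4.1 * 10 ^ 6 * i) / K ^ 2 := by gcongr
      _ = 2 * (c / K ^ 2) + 4.1 * 10 ^ 6 * i / K ^ 2 := by ring
      _ ≤ _ := by
        gcongr
        exact div_le_self (by positivity) (by nlinarith)
  have h8 : n * w ^ 2 ≤ (2 * N + i) * w ^ 2 := by gcongr
  nlinarith

/-! ### The sizes of the grids -/

/-- `C^{1/3} ι^{2/3}`. -/
def mainTerm (P : Params) : ℝ := P.C ^ ((1 : ℝ) / 3) * P.ι ^ ((2 : ℝ) / 3)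

section Sizes

variable {P : Params}

theorem rpow_third_cube {x : ℝ} (hx : 0 ≤ x) : (x ^ ((1 : ℝ) / 3)) ^ 3 = x := by
  rw [← Real.rpow_natCast, ← Real.rpow_mul hx]
  norm_num

theorem rpow_two_thirds_cube {x : ℝ} (hx : 0 ≤ x) : (x ^ ((2 : ℝ) / 3)) ^ 3 = x ^ 2 := by
  rw [← Real.rpow_natCast, ← Real.rpow_mul hx, ← Real.rpow_natCast]
  norm_num

theorem mainTerm_nonneg (hι : 0 ≤ P.ι) (hC : 0 ≤ P.C) : 0 ≤ mainTerm P := by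
  unfold mainTerm; positivity

theorem mainTerm_cube (hι : 0 ≤ P.ι) (hC : 0 ≤ P.C) : mainTerm P ^ 3 = P.C * P.ι ^ 2 := by
  rw [mainTerm, mul_pow, rpow_third_cube hC, rpow_two_thirds_cube hι]

/-- Grid sizes are compared through their cubes, which removes the fractional exponents. The
identity also states the balance `G ι = s (len / G)²` between the cost of the cells and of their
width. -/
theorem innerGrid_cube (hι : 0 < P.ι) {s len : ℝ} (hs : 0 ≤ s) (hlen : 0 ≤ len) :
    innerGrid P s len ^ 3 * P.ι = s * len ^ 2 := by
  have h1 : (P.ι ^ (-(1 : ℝ) / 3)) ^ 3 = P.ι⁻¹ := by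
    rw [← Real.rpow_natCast, ← Real.rpow_mul hι.le, ← Real.rpow_neg_one]
    norm_num
  rw [innerGrid, mul_pow, mul_pow, rpow_third_cube hs, rpow_two_thirds_cube hlen, h1]
  field_simp

theorem outerGrid_cube (hι : 0 < P.ι) (hC : 0 ≤ P.C) : outerGrid P ^ 3 * P.ι = 1 + P.C := by
  rw [outerGrid, rpow_third_cube (by positivity)]
  field_simp

theorem le_of_cube_le {x y : ℝ} (hy : 0 ≤ y) (h : x ^ 3 ≤ y ^ 3) : x ≤ y :=
  le_of_pow_le_pow_left₀ (by norm_num) hy h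

theorem add_cube_le {x y : ℝ} (hx : 0 ≤ x) (hy : 0 ≤ y) : x ^ 3 + y ^ 3 ≤ (x + y) ^ 3 := by
  have : 0 ≤ x * y * (x + y) := by positivity
  nlinarith

/-- After cubing: `(1 + C) ι² ≤ ι³ + C ι²`, a sum of the two cubes. -/
theorem outerGrid_mul_le (hι : 1 ≤ P.ι) (hC : 0 ≤ P.C) :
    outerGrid P * P.ι ≤ P.ι + mainTerm P := by
  have hι0 : 0 < P.ι := by linarith
  have hB := mainTerm_nonneg hι0.le hC
  refine le_of_cube_le (by positivity) (le_trans ?_ (add_cube_le hι0.le hB))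
  have h1 := outerGrid_cube hι0 hC
  rw [mainTerm_cube hι0.le hC]
  have h2 : (outerGrid P * P.ι) ^ 3 = (outerGrid P ^ 3 * P.ι) * P.ι ^ 2 := by ring
  rw [h2, h1]
  nlinarith [sq_nonneg P.ι]

theorem outerCount_mul_le (hι : 1 ≤ P.ι) (hC : 0 ≤ P.C) :
    outerCount P * P.ι ≤ 2 * (P.ι + mainTerm P) := by
  have h1 := Nat.ceil_lt_add_one (outerGrid_pos (by linarith) hC).le
  have h2 := outerGrid_mul_le hι hC
  have h3 := mainTerm_nonneg (P := P) (by linarith) hC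
  unfold outerCount
  nlinarith

theorem one_le_outerCount (hι : 0 < P.ι) (hC : 0 ≤ P.C) : (1 : ℝ) ≤ outerCount P := by
  exact_mod_cast Nat.ceil_pos.mpr (outerGrid_pos hι hC)

theorem C_div_outerCount_sq_le (hι : 1 ≤ P.ι) (hC : 0 ≤ P.C) :
    P.C / (outerCount P : ℝ) ^ 2 ≤ P.ι + mainTerm P := by
  have hι0 : 0 < P.ι := by linarith
  have h0 := outerGrid_pos hι0 hC
  have h1 : outerGrid P ≤ outerCount P := Nat.le_ceil _
  have h2 := outerGrid_cube hι0 hC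
  calc P.C / (outerCount P : ℝ) ^ 2 ≤ P.C / outerGrid P ^ 2 := by gcongr
    _ ≤ outerGrid P * P.ι := by
      rw [div_le_iff₀ (by positivity)]
      nlinarith
    _ ≤ _ := outerGrid_mul_le hι hC

variable {m : ℕ} {ybar : ℝ}

theorem radius_pos (hι : 0 < P.ι) (hC : 0 ≤ P.C) {s : ℝ} (hs : 0 < s) : 0 < radius P s := by
  unfold radius
  positivity

/-- If `C ≤ s`, the squared radius is of order `ι / s + (C / s)²` and `(C / s)² s ≤ C`. If `C ≥ s`,
clipping to `[0,1]` gives length at most `1`, and `s ≤ C`. -/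
theorem length_inner_sq_le (hι : 1 ≤ P.ι) (hC : 0 ≤ P.C) (hm : 1 ≤ m)
    (hy : ybar ∈ Set.Icc (0 : ℝ) 1) :
    2 ^ m * ((inner P m ybar).hi - (inner P m ybar).lo) ^ 2 ≤ 64 * (P.ι + P.C) := by
  have hι0 : 0 < P.ι := by linarith
  obtain ⟨h0, h1, h2, h3⟩ := inner_spec (radius_pos hι0 hC (by positivity)) hy
  have hs : (2 : ℝ) ^ m = 2 * 2 ^ (m - 1) := by
    rw [← pow_succ', Nat.sub_add_cancel hm]
  rw [hs]
  have hs0 : (0 : ℝ) < 2 ^ (m - 1) := by positivity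
  set s : ℝ := 2 ^ (m - 1)
  set d := (inner P m ybar).hi - (inner P m ybar).lo with hd
  have hd0 : 0 ≤ d := by linarith
  have hd1 : d ≤ 1 := by linarith
  rcases le_total P.C s with h | h
  · have h4 : d ^ 2 ≤ 32 * (P.ι / s + (P.C / s) ^ 2) := by
      have h5 : d ^ 2 ≤ (4 * radius P s) ^ 2 := by gcongr
      have h6 := Real.sq_sqrt (show 0 ≤ P.ι / s by positivity)
      unfold radius at h5
      nlinarith [sq_nonneg (√(P.ι / s) - P.C / s)]
    have h5 : s * (P.ι / s + (P.C / s) ^ 2) ≤ P.ι + P.C := by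
      have h6 : s * (P.ι / s + (P.C / s) ^ 2) = P.ι + P.C * (P.C / s) := by field_simp
      rw [h6]
      have h7 : P.C / s ≤ 1 := div_le_one_of_le₀ h hs0.le
      nlinarith
    nlinarith
  · have h4 : d ^ 2 ≤ 1 := by nlinarith
    nlinarith

theorem innerGrid_mul_le (hι : 1 ≤ P.ι) (hC : 0 ≤ P.C) (hm : 1 ≤ m)
    (hy : ybar ∈ Set.Icc (0 : ℝ) 1) :
    innerGrid P (2 ^ m) ((inner P m ybar).hi - (inner P m ybar).lo) * P.ι ≤
      4 * (P.ι + mainTerm P) := by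
  have hι0 : 0 < P.ι := by linarith
  obtain ⟨h0, h1, h2, h3⟩ := inner_spec (radius_pos hι0 hC (by positivity)) hy
  have hB := mainTerm_nonneg hι0.le hC
  have h4 := innerGrid_cube hι0 (s := 2 ^ m) (by positivity)
    (show 0 ≤ (inner P m ybar).hi - (inner P m ybar).lo by linarith)
  have h5 := length_inner_sq_le hι hC hm hy
  set G := innerGrid P (2 ^ m) ((inner P m ybar).hi - (inner P m ybar).lo)
  refine le_of_cube_le (by positivity) ?_
  have h6 := add_cube_le hι0.le hB
  rw [mainTerm_cube hι0.le hC] at h6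
  have h7 : (G * P.ι) ^ 3 = (G ^ 3 * P.ι) * P.ι ^ 2 := by ring
  have h8 : (4 * (P.ι + mainTerm P)) ^ 3 = 64 * (P.ι + mainTerm P) ^ 3 := by ring
  rw [h7, h4, h8]
  nlinarith [sq_nonneg P.ι]

theorem inner_grid_error_le (hι : 1 ≤ P.ι) (hC : 0 ≤ P.C) (hm : 1 ≤ m)
    (hy : ybar ∈ Set.Icc (0 : ℝ) 1) :
    2 ^ m * (((inner P m ybar).hi - (inner P m ybar).lo) / innerCount P m ybar) ^ 2 ≤
      4 * (P.ι + mainTerm P) := by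
  have hι0 : 0 < P.ι := by linarith
  obtain ⟨h0, h1, h2, h3⟩ := inner_spec (radius_pos hι0 hC (by positivity)) hy
  refine le_trans ?_ (innerGrid_mul_le hι hC hm hy)
  have h4 := innerGrid_cube hι0 (s := 2 ^ m) (by positivity)
    (show 0 ≤ (inner P m ybar).hi - (inner P m ybar).lo by linarith)
  have h5 := innerGrid_pos hι0 (s := 2 ^ m) (by positivity)
    (show 0 < (inner P m ybar).hi - (inner P m ybar).lo by linarith)
  have h6 : innerGrid P (2 ^ m) ((inner P m ybar).hi - (inner P m ybar).lo) ≤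
    innerCount P m ybar := Nat.le_ceil _
  set G := innerGrid P (2 ^ m) ((inner P m ybar).hi - (inner P m ybar).lo)
  rw [div_pow, mul_div_assoc', ← h4]
  calc G ^ 3 * P.ι / (innerCount P m ybar : ℝ) ^ 2 ≤ G ^ 3 * P.ι / G ^ 2 := by gcongr
    _ = G * P.ι := by field_simp

theorem length_buildPartition_mul_le (hι : 1 ≤ P.ι) (hC : 0 ≤ P.C) (hm : 1 ≤ m)
    (hy : ybar ∈ Set.Icc (0 : ℝ) 1) :
    ((buildPartition P m ybar).val.length : ℝ) * P.ι ≤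
      (4 * bandCount P + 9) * (P.ι + mainTerm P) := by
  have hι0 : 0 < P.ι := by linarith
  obtain ⟨h0, h1, h2, h3⟩ := inner_spec (radius_pos hι0 hC (by positivity)) hy
  have hB := mainTerm_nonneg hι0.le hC
  have h4 : ((buildPartition P m ybar).val.length : ℝ) ≤
      innerCount P m ybar + (bandCount P + 1) * (2 * outerCount P) := by
    exact_mod_cast length_buildPartition P m ybar
  have h5 := Nat.ceil_lt_add_one (innerGrid_pos hι0 (s := 2 ^ m) (by positivity)
    (show 0 < (inner P m ybar).hi - (inner P m ybar).lo by linarith)).le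
  have h6 := innerGrid_mul_le hι hC hm hy
  have h7 := outerCount_mul_le hι hC
  have h8 : (innerCount P m ybar : ℝ) * P.ι ≤ 5 * (P.ι + mainTerm P) := by
    unfold innerCount
    nlinarith
  have h9 : ((bandCount P : ℝ) + 1) * (2 * outerCount P) * P.ι ≤
      (bandCount P + 1) * (4 * (P.ι + mainTerm P)) := by
    rw [mul_assoc]
    exact mul_le_mul_of_nonneg_left (by linarith) (by positivity)
  nlinarith

end Sizes


/-! ### The error of one epoch -/

theorem sum_map_eq_sum_get {α : Type*} (R : List α) (f : α → ℝ) :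
    (R.map f).sum = ∑ i : Fin R.length, f (R.get i) := by
  rw [← List.sum_ofFn]
  congr 1
  conv_lhs => rw [← List.ofFn_get R, List.map_ofFn]
  rfl

theorem Covers.unique {cells : List Cell} (hc : Covers cells) {u : ℝ}
    (hu : u ∈ Set.Icc (0 : ℝ) 1) {J J' : Fin cells.length} (h : u ∈ (cells.get J).toSet)
    (h' : u ∈ (cells.get J').toSet) : J = J' := by
  by_contra hne
  have h1 := hc u hu
  have h2 := Finset.add_le_sum (s := Finset.univ) (f := fun J => (cells.get J).ind u)
    (fun k _ => Cell.ind_nonneg _ _) (Finset.mem_univ J) (Finset.mem_univ J') hne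
  simp only [Cell.ind_of_mem h, Cell.ind_of_mem h'] at h2
  linarith

theorem Rec.InEpoch.u_mem {cells : List Cell} {m : ℕ} {r : Rec} (h : r.InEpoch cells m) :
    r.u ∈ Set.Icc (0 : ℝ) 1 := by
  unfold Rec.u
  split_ifs
  · exact h.legal.u₀
  · exact h.legal.u₁

theorem Rec.InEpoch.exists_z {cells : List Cell} {m : ℕ} {r : Rec} (h : r.InEpoch cells m) :
    ∃ J : Fin cells.length, r.u ∈ (cells.get J).toSet ∧ r.z = (cells.get J).hi := by
  unfold Rec.u Rec.z
  split_ifs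
  · exact h.legal.z₀
  · exact h.legal.z₁

/-- The cells of an epoch are random, so the union bound runs over positions in the list of experts;
within an epoch a position always carries the same cell. -/
theorem exists_position {cells : List Cell} {m : ℕ} (J : Fin cells.length) :
    ∃ j < 2 * cells.length, ∀ r : Rec, r.InEpoch cells m → r.cell j = cells.get J := by
  obtain ⟨j, hj, hjJ⟩ := List.mem_iff_getElem.mp (mem_expertOrder (J, true))
  have hj' := hj
  rw [length_expertOrder] at hj'
  refine ⟨j, hj', fun r hr => ?_⟩
  obtain ⟨E, hE, hcell⟩ := hr.experts
  unfold Rec.cell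
  rw [hE, List.getD_eq_getElem _ _ (by rw [List.length_map]; exact hj), List.getElem_map, hjJ,
    hcell]

theorem Plan.gain_add (p : Plan) (y : Bool) (J : Cell) (c : ℝ) :
    p.gain y J + p.prob J * (outcome y - c) =
      p.pr * (J.ind p.u₀ * (p.u₀ - c)) + (1 - p.pr) * (J.ind p.u₁ * (p.u₁ - c)) := by
  unfold Plan.gain Plan.prob
  ring

theorem Cell.ind_mul_le {J : Cell} {f : ℝ → ℝ} {b : ℝ} (h : ∀ u ∈ J.toSet, f u ≤ b) (u : ℝ) :
    J.ind u * f u ≤ J.ind u * b := by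
  by_cases hu : u ∈ J.toSet
  · rw [ind_of_mem hu]; simpa using h u hu
  · rw [ind_of_notMem hu]; simp

/-- If the points of `J` satisfy an affine bound, so does the expectation. -/
theorem Plan.affine_le {p : Plan} (hp : p.pr ∈ Set.Icc (0 : ℝ) 1) {J : Cell} {s c b : ℝ}
    (h : ∀ u ∈ J.toSet, s * (u - c) ≤ b) (y : Bool) :
    s * (p.gain y J + p.prob J * (outcome y - c)) ≤ p.prob J * b := by
  rw [Plan.gain_add]
  have h1 := Cell.ind_mul_le h p.u₀
  have h2 := Cell.ind_mul_le h p.u₁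
  have h3 : 0 ≤ 1 - p.pr := by linarith [hp.2]
  have h4 := mul_le_mul_of_nonneg_left h1 hp.1
  have h5 := mul_le_mul_of_nonneg_left h2 h3
  unfold Plan.prob
  linarith

section Epoch

variable {S : Subroutines} {P : Params} {first q : ℕ → ℝ} {ε : ℝ} {cells : List Cell} {m : ℕ}

/-- The error of a single cell in an epoch. -/
theorem cell_sum_le (R : List Rec) (hR : ∀ r ∈ R, r.InEpoch cells m) (hι : 1 ≤ P.ι)
    (J : Fin cells.length) {x ybar w₀ K : ℝ} (hy : ybar ∈ Set.Icc (0 : ℝ) 1) {rad : ℝ} (hrad : |ybar - x| ≤ rad) (hK : 1 ≤ K)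
    (hJ0 : 0 ≤ (cells.get J).lo) (hJ : (cells.get J).lo < (cells.get J).hi)
    (hJ1 : (cells.get J).hi ≤ 1)
    (hJw : (cells.get J).hi - (cells.get J).lo = w₀ ∨
      ∃ ρ, 0 < ρ ∧ (cells.get J).hi - (cells.get J).lo ≤ ρ / K ∧
        ((cells.get J).hi ≤ ybar - rad - ρ ∨ ybar + rad + ρ ≤ (cells.get J).lo))
    (hgain : |(R.map fun r => r.p.gain r.y (cells.get J)).sum| ≤
      2000 * (P.ι + √(P.ι * (R.map fun r => r.p.prob (cells.get J)).sum)))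
    (hctl : ∀ j < 2 * cells.length, ∀ k : Fin 4, |(R.map (deviate q m j k)).sum| ≤
      2 * √(P.ι / 16 * (R.map (varBound m j k)).sum) + P.ι / 16) :
    ((R.map fun r => (cells.get J).ind r.u * (outcome r.y - (cells.get J).hi)).sum) ^ 2 /
      (R.map fun r => (cells.get J).ind r.u).sum ≤
      3 * 10 ^ 8 * P.ι +
      72 * ((R.map fun r => r.p.prob (cells.get J) * |q r.t - x|).sum / K ^ 2) +
      18 * ((R.map fun r => (cells.get J).ind r.u).sum * w₀ ^ 2) := by
  obtain ⟨j, hj, hcell⟩ := exists_position (m := m) J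
  set c := cells.get J
  have hι0 : 0 < P.ι := by linarith
  have hget : ∀ i : Fin R.length, (R.get i).InEpoch cells m := fun i => hR _ (R.get_mem i)
  have hdev : ∀ k, (R.map (deviate q m j k)).sum = ∑ i : Fin R.length,
      deviate q m j k (R.get i) := fun k => sum_map_eq_sum_get _ _
  have hvar : ∀ k : Fin 4, k ≠ 0 → (R.map (varBound m j k)).sum = ∑ i : Fin R.length,
      (R.get i).p.prob c := fun k hk => by
    rw [sum_map_eq_sum_get]
    refine Finset.sum_congr rfl fun i _ => ?_
    rw [varBound, if_pos (hget i).m_eq, if_neg hk, hcell _ (hget i)]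
  simp only [sum_map_eq_sum_get] at hgain ⊢
  set n := ∑ i : Fin R.length, c.ind (R.get i).u
  set N := ∑ i : Fin R.length, (R.get i).p.prob c
  set Sx := ∑ i : Fin R.length, c.ind (R.get i).u * (outcome (R.get i).y - c.hi) with hSx
  set G := ∑ i : Fin R.length, (R.get i).p.gain (R.get i).y c with hG
  set CJ := ∑ i : Fin R.length, (R.get i).p.prob c * |q (R.get i).t - x|
  have hprob0 : ∀ i, 0 ≤ (R.get i).p.prob c := fun i => Plan.prob_nonneg (hget i).legal.pr _
  have hn0 : 0 ≤ n := Finset.sum_nonneg fun i _ => Cell.ind_nonneg _ _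
  have hN0 : 0 ≤ N := Finset.sum_nonneg fun i _ => hprob0 i
  have hCJ0 : 0 ≤ CJ := Finset.sum_nonneg fun i _ => mul_nonneg (hprob0 i) (abs_nonneg _)
  set s := √(P.ι * N) with hs
  have hs4 : 2 * √(P.ι / 16 * N) = s / 2 := by
    have : P.ι / 16 * N = (1 / 4) ^ 2 * (P.ι * N) := by ring
    rw [this, Real.sqrt_mul (by positivity), Real.sqrt_sq (by norm_num)]
    ring
  have hdevk : ∀ k : Fin 4, k ≠ 0 → |∑ i : Fin R.length, deviate q m j k (R.get i)| ≤
      s / 2 + P.ι / 16 := fun k hk => by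
    have := hctl j hj k
    rwa [hdev, hvar k hk, hs4] at this
  have hd1 : |n - N| ≤ s / 2 + P.ι / 16 := by
    have := hdevk 1 (by decide)
    rwa [Finset.sum_congr rfl fun i _ => show deviate q m j 1 (R.get i) =
      c.ind (R.get i).u - (R.get i).p.prob c by
        simp only [deviate, if_pos (hget i).m_eq, coinFactor, outcomeFactor, hcell _ (hget i),
          mul_one],
      Finset.sum_sub_distrib] at this
  have hd2 := hdevk 2 (by decide)
  rw [Finset.sum_congr rfl fun i _ => show deviate q m j 2 (R.get i) =
      (c.ind (R.get i).u - (R.get i).p.prob c) * outcome (R.get i).y by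
        simp only [deviate, if_pos (hget i).m_eq, coinFactor, outcomeFactor, hcell _ (hget i)]]
    at hd2
  have hd3 := hdevk 3 (by decide)
  rw [Finset.sum_congr rfl fun i _ => show deviate q m j 3 (R.get i) =
      (R.get i).p.prob c * (outcome (R.get i).y - q (R.get i).t) by
        simp only [deviate, if_pos (hget i).m_eq, coinFactor, outcomeFactor, hcell _ (hget i)]]
    at hd3
  set d2 := ∑ i : Fin R.length,
    (c.ind (R.get i).u - (R.get i).p.prob c) * outcome (R.get i).y with hd2def
  set d3 := ∑ i : Fin R.length,
    (R.get i).p.prob c * (outcome (R.get i).y - q (R.get i).t) with hd3def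
  -- the affine bounds summed up
  have haff : ∀ σ a b : ℝ, (∀ u ∈ c.toSet, σ * (u - a) ≤ b) →
      σ * (G + ∑ i : Fin R.length, (R.get i).p.prob c * (outcome (R.get i).y - a)) ≤ N * b := by
    intro σ a b h
    rw [hG, ← Finset.sum_add_distrib, Finset.mul_sum, Finset.sum_mul]
    exact Finset.sum_le_sum fun i _ => Plan.affine_le (hget i).legal.pr h _
  have hmem : ∀ u ∈ c.toSet, c.lo ≤ u ∧ u ≤ c.hi := by
    rintro u ⟨h1, h2⟩
    exact ⟨by rcases h1 with h | h; exacts [h.le, h.2.ge],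
      by rcases h2 with h | h; exacts [h.le, h.2.le]⟩
  set w := c.hi - c.lo
  have hw0 : 0 ≤ w := by linarith
  have hw1 : w ≤ 1 := by linarith
  have hS1 : |Sx| ≤ n := by
    refine (Finset.abs_sum_le_sum_abs _ _).trans (Finset.sum_le_sum fun i _ => ?_)
    rw [abs_mul, abs_of_nonneg (Cell.ind_nonneg _ _), abs_sub_comm]
    have := abs_sub_outcome_le (u := c.hi) ⟨by linarith, hJ1⟩ (R.get i).y
    nlinarith [c.ind_nonneg (R.get i).u]
  have hS2 : |Sx| ≤ 2002 * (P.ι + s) + N * w := by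
    have h1 := haff 1 c.hi 0 fun u hu => by linarith [(hmem u hu).2]
    have h2 := haff (-1) c.hi w fun u hu => by linarith [(hmem u hu).1]
    -- The actual sum is split into martingale deviations and an expected sum. The latter equals
    -- `-G` up to the displacement of `u` to the right end point, at most `w` per expected visit.
    have h3 : Sx = d2 - c.hi * (n - N) +
        ∑ i : Fin R.length, (R.get i).p.prob c * (outcome (R.get i).y - c.hi) := by
      rw [hSx, hd2def, ← Finset.sum_sub_distrib, Finset.mul_sum, ← Finset.sum_sub_distrib,
        ← Finset.sum_add_distrib]
      exact Finset.sum_congr rfl fun i _ => by ring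
    have h4 : |c.hi * (n - N)| ≤ s / 2 + P.ι / 16 := by
      rw [abs_mul, abs_of_nonneg (by linarith)]
      nlinarith [abs_nonneg (n - N)]
    have hs0 : 0 ≤ s := Real.sqrt_nonneg _
    obtain ⟨h5, h6⟩ := abs_le.mp h4
    obtain ⟨h7, h8⟩ := abs_le.mp hd2
    obtain ⟨h9, h10⟩ := abs_le.mp hgain
    rw [h3, abs_le]
    constructor <;> linarith
  refine (cell_error_le hι0 hn0 hN0 hw0 hs hS1 hS2 hd1).trans ?_
  have hKpos : 0 < K := by linarith
  have ht1 : 0 ≤ CJ / K ^ 2 := by positivity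
  rcases hJw with hJw | ⟨ρ, hρ, hwρ, hfar⟩
  · rw [hJw]
    linarith
  · obtain ⟨hr1, hr2⟩ := abs_le.mp hrad
    have hρ1 : ρ ≤ 1 := by
      have := hy.1; have := hy.2
      have : 0 ≤ rad := (abs_nonneg _).trans hrad
      rcases hfar with h | h <;> linarith
    have hqx : |∑ i : Fin R.length, (R.get i).p.prob c * (q (R.get i).t - x)| ≤ CJ := by
      refine (Finset.abs_sum_le_sum_abs _ _).trans (Finset.sum_le_sum fun i _ => ?_)
      rw [abs_mul, abs_of_nonneg (hprob0 i)]
    have hsplit : ∑ i : Fin R.length, (R.get i).p.prob c * (outcome (R.get i).y - x) =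
        d3 + ∑ i : Fin R.length, (R.get i).p.prob c * (q (R.get i).t - x) := by
      rw [hd3def, ← Finset.sum_add_distrib]
      exact Finset.sum_congr rfl fun i _ => by ring
    have hs0 : 0 ≤ s := Real.sqrt_nonneg _
    obtain ⟨h5, h6⟩ := abs_le.mp hqx
    obtain ⟨h7, h8⟩ := abs_le.mp hd3
    obtain ⟨h9, h10⟩ := abs_le.mp hgain
    -- All points of the cell lie at distance at least `ρ` from `x` on one side. So `N ρ` is bounded
    -- by the calibration sum plus the weighted deviation of the outcomes from `x`, which consists
    -- of noise `d3` and the drift `CJ`.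
    have hNρ : N * ρ ≤ CJ + 2001 * (P.ι + s) := by
      rcases hfar with h | h
      · have h11 := haff 1 x (-ρ) fun u hu => by linarith [(hmem u hu).2]
        rw [hsplit] at h11
        linarith
      · have h11 := haff (-1) x (-ρ) fun u hu => by linarith [(hmem u hu).1]
        rw [hsplit] at h11
        linarith
    have h12 := far_cell_le hι0 hN0 hw0 hw1 hs hd1 hρ hρ1 hCJ0 hK hwρ hNρ
    have h13 : 0 ≤ n * w₀ ^ 2 := by positivity
    linarith

/-- Summed over the cells, the three terms of `cell_sum_le` become `|Π| ι`, `C / K²` and `2^m w₀²`,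
each of order `ι + C^{1/3} ι^{2/3}` up to the number of bands. -/
theorem epoch_calError_le (hS : Sound ε S) (hε0 : 0 ≤ ε) (hε : ε ≤ 1) (hι : 1 ≤ P.ι)
    (hC : 0 ≤ P.C) (hT : 1 ≤ P.T) (hm : 2 ≤ m) {ybar x : ℝ} (hy : ybar ∈ Set.Icc (0 : ℝ) 1)
    (hrT : 1 ≤ P.T * radius P (2 ^ (m - 1)))
    (hrad : |ybar - x| ≤ radius P (2 ^ (m - 1)))
    (hL : logSize (buildPartition P m ybar).val.length m ≤ P.ι) (l : List (Bool × Bool))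
    (hlen : l.length ≤ 2 ^ m) (t : ℕ) {st : State} (hst : st.m = m) (hseen : st.seen = 0)
    (hes : st.experts = (initExperts (buildPartition P m ybar).val).val)
    (hq : ((recs S P first t st l).map fun r => |q r.t - x|).sum ≤ P.C)
    (hctl : ∀ j < 2 * (buildPartition P m ybar).val.length, ∀ k : Fin 4,
      |((recs S P first t st l).map (deviate q m j k)).sum| ≤
      2 * √(P.ι / 16 * ((recs S P first t st l).map (varBound m j k)).sum) + P.ι / 16) :
    calError 2 (transcript (recs S P first t st l)) ≤
      10 ^ 10 * (bandCount P + 1) * (P.ι + mainTerm P) := by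
  have hι0 : 0 < P.ι := by linarith
  have hr0 : 0 < radius P (2 ^ (m - 1)) := radius_pos hι0 hC (by positivity)
  have hc := covers_buildPartition hι0 hC hT hrT hr0 hy
  have hlenmul := length_buildPartition_mul_le hι hC (by omega : 1 ≤ m) hy
  have hcells : ∀ J ∈ (buildPartition P m ybar).val, _ := fun J hJ =>
    buildPartition_cell hr0 hy hJ
  set cells := (buildPartition P m ybar).val
  have hN : 0 < cells.length := by
    obtain ⟨J, -⟩ := hc.exists_mem (u := 0) (by simp)
    exact J.pos
  obtain ⟨hR, hcal⟩ := calibration_of_epoch (P := P) (first := first) hS hε0 hε hN hm hc l hlen t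
    hst hseen hes
  have hRlen := length_recs S P first l t st
  set R := recs S P first t st l
  have hL1 := one_le_logSize hN (by omega : 1 ≤ m)
  set L := logSize cells.length m
  set K : ℝ := (outerCount P : ℝ)
  have hK : 1 ≤ K := one_le_outerCount hι0 hC
  set w₀ := ((inner P m ybar).hi - (inner P m ybar).lo) / innerCount P m ybar
  have hB := mainTerm_nonneg hι0.le hC
  have hmain : calError 2 (transcript R) ≤ ∑ J : Fin cells.length,
      ((R.map fun r => (cells.get J).ind r.u * (outcome r.y - (cells.get J).hi)).sum) ^ 2 /
      (R.map fun r => (cells.get J).ind r.u).sum :=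
    calError_le_sum R Rec.z Rec.y (fun J r => (cells.get J).ind r.u) (fun J => (cells.get J).hi)
      (fun r _ J => Cell.ind_nonneg _ _) (fun r hr => hc _ (hR r hr).u_mem) fun r hr J hJ => by
        obtain ⟨J', hJ', hz⟩ := (hR r hr).exists_z
        rw [hz, hc.unique (hR r hr).u_mem (Cell.mem_of_ind hJ) hJ']
  have hcell : ∀ J : Fin cells.length,
      ((R.map fun r => (cells.get J).ind r.u * (outcome r.y - (cells.get J).hi)).sum) ^ 2 /
        (R.map fun r => (cells.get J).ind r.u).sum ≤
      3 * 10 ^ 8 * P.ι +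
      72 * ((R.map fun r => r.p.prob (cells.get J) * |q r.t - x|).sum / K ^ 2) +
      18 * ((R.map fun r => (cells.get J).ind r.u).sum * w₀ ^ 2) := by
    intro J
    obtain ⟨h1, h2, h3, h4⟩ := hcells _ (cells.get_mem J)
    refine cell_sum_le R hR hι J hy hrad hK h1 h2 h3 h4 ((hcal J).trans ?_) hctl
    have hV0 : 0 ≤ (R.map fun r => r.p.gain r.y (cells.get J) ^ 2).sum :=
      List.sum_nonneg (by simpa using fun r _ => sq_nonneg _)
    have hV : (R.map fun r => r.p.gain r.y (cells.get J) ^ 2).sum ≤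
        (R.map fun r => r.p.prob (cells.get J)).sum := by
      refine List.sum_le_sum fun r hr => ?_
      have h5 := Plan.abs_gain_le (hR r hr).legal.pr (hR r hr).legal.u₀ (hR r hr).legal.u₁ r.y
        (cells.get J)
      have h6 := Plan.prob_le_one (hR r hr).legal.pr (cells.get J)
      rw [← sq_abs]
      nlinarith [abs_nonneg (r.p.gain r.y (cells.get J))]
    gcongr
  -- In each round the visit probabilities sum up to `1`, so the drift is charged only once in
  -- total, not once per cell.
  have hsumq : ∑ J : Fin cells.length, (R.map fun r => r.p.prob (cells.get J) * |q r.t - x|).sum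
      ≤ P.C := by
    refine le_trans (le_of_eq ?_) hq
    simp only [sum_map_eq_sum_get]
    rw [Finset.sum_comm]
    refine Finset.sum_congr rfl fun i _ => ?_
    rw [← Finset.sum_mul]
    have hleg := (hR _ (R.get_mem i)).legal
    have : ∑ J : Fin cells.length, (R.get i).p.prob (cells.get J) = 1 := by
      simp only [Plan.prob]
      rw [Finset.sum_add_distrib, ← Finset.mul_sum, ← Finset.mul_sum, hc _ hleg.u₀, hc _ hleg.u₁]
      ring
    rw [this, one_mul]
  have hsumn : ∑ J : Fin cells.length, (R.map fun r => (cells.get J).ind r.u).sum ≤ 2 ^ m := by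
    have h1 : ∑ J : Fin cells.length, (R.map fun r => (cells.get J).ind r.u).sum = R.length := by
      simp only [sum_map_eq_sum_get]
      rw [Finset.sum_comm, Finset.sum_congr rfl fun i _ => hc _ (hR _ (R.get_mem i)).u_mem]
      simp
    rw [h1, hRlen]
    exact_mod_cast hlen
  have hsum := Finset.sum_le_sum fun J (_ : J ∈ Finset.univ) => hcell J
  simp only [Finset.sum_add_distrib, ← Finset.mul_sum, ← Finset.sum_mul, ← Finset.sum_div,
    Finset.sum_const, Finset.card_univ, Fintype.card_fin, nsmul_eq_mul] at hsum
  have hA1 : (∑ J : Fin cells.length,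
      (R.map fun r => r.p.prob (cells.get J) * |q r.t - x|).sum) / K ^ 2 ≤ P.ι + mainTerm P :=
    (div_le_div_of_nonneg_right hsumq (by positivity)).trans (C_div_outerCount_sq_le hι hC)
  have hA2 : (∑ J : Fin cells.length, (R.map fun r => (cells.get J).ind r.u).sum) * w₀ ^ 2 ≤
      4 * (P.ι + mainTerm P) :=
    (mul_le_mul_of_nonneg_right hsumn (sq_nonneg _)).trans
      (inner_grid_error_le hι hC (by omega) hy)
  have hQ : (0 : ℝ) ≤ bandCount P := Nat.cast_nonneg _
  have hIB : 0 ≤ P.ι + mainTerm P := by linarith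
  have hQIB : 0 ≤ bandCount P * (P.ι + mainTerm P) := by positivity
  nlinarith

end Epoch


/-! ### The sequence of epochs -/

theorem calError_le_length (h : List (ℝ × Bool)) (hz : ∀ x ∈ h, x.1 ∈ Set.Icc (0 : ℝ) 1) :
    calError 2 h ≤ h.length := by
  induction h with
  | nil => simp [calError]
  | cons x h ih =>
    have h1 := calError_append_le [x] h
    have h2 := ih fun y hy => hz y (List.mem_cons_of_mem _ hy)
    have h3 : calError 2 [x] ≤ 1 := by
      classical
      rw [calError_two_eq [x] {x.1} (by simp)]
      have h4 := abs_sub_outcome_le (hz x List.mem_cons_self) x.2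
      rw [abs_sub_comm] at h4
      simp only [Finset.sum_singleton, List.map_cons, List.map_nil, List.sum_cons, List.sum_nil,
        if_true, add_zero, div_one]
      rw [← sq_abs]
      nlinarith [abs_nonneg (outcome x.2 - x.1)]
    rw [List.singleton_append] at h1
    push_cast [List.length_cons]
    linarith

section Epochs

variable (S : Subroutines) (P : Params) (first : ℕ → ℝ)

theorem m_eq_of_mem_recs (l : List (Bool × Bool)) (t : ℕ) (st : State)
    (h : st.seen + l.length ≤ 2 ^ st.m) : ∀ r ∈ recs S P first t st l, r.st.m = st.m := by
  induction l generalizing t st with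
  | nil => simp [recs]
  | cons x l ih =>
    rw [List.length_cons] at h
    simp only [recs, List.mem_cons, forall_eq_or_imp, true_and]
    rcases eq_or_ne l [] with rfl | hl
    · simp [recs]
    · have hlpos : 0 < l.length := List.length_pos_iff.mpr hl
      have h1 := nextState_mid S P first (st := st) (by omega) x.2
      have h2 := ih (t + 1) (nextState S P first st x.2)
        (by rw [h1]; dsimp only; omega)
      rwa [h1] at h2 ⊢

theorem m_le_nextState (st : State) (y : Bool) : st.m ≤ (nextState S P first st y).m := by
  by_cases h : st.seen + 1 = 2 ^ st.m
  · rw [nextState_end S P first h]; exact Nat.le_succ _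
  · rw [nextState_mid S P first h]

theorem m_le_of_mem_recs (l : List (Bool × Bool)) (t : ℕ) (st : State) :
    ∀ r ∈ recs S P first t st l, st.m ≤ r.st.m := by
  induction l generalizing t st with
  | nil => simp [recs]
  | cons x l ih =>
    simp only [recs, List.mem_cons, forall_eq_or_imp, le_refl, true_and]
    exact fun r hr => (m_le_nextState S P first st x.2).trans (ih _ _ r hr)

theorem p_eq_of_mem_recs (l : List (Bool × Bool)) (t : ℕ) (st : State) :
    ∀ r ∈ recs S P first t st l, r.p = (plan S first r.st).val := by
  induction l generalizing t st with
  | nil => simp [recs]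
  | cons x l ih =>
    simp only [recs, List.mem_cons, forall_eq_or_imp, true_and]
    exact ih _ _

theorem foldl_nextState (l : List (Bool × Bool)) (t : ℕ) (st : State) (hl : l ≠ [])
    (h : st.seen + l.length = 2 ^ st.m) :
    l.foldl (fun st x => nextState S P first st x.2) st = ⟨st.m + 1, 0, 0,
      (initExperts (buildPartition P (st.m + 1) ((st.ySum +
        ((recs S P first t st l).map fun r => outcome r.y).sum) / 2 ^ st.m)).val).val⟩ := by
  induction l generalizing t st with
  | nil => exact absurd rfl hl
  | cons x l ih =>
    rw [List.length_cons] at h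
    simp only [List.foldl_cons, recs, List.map_cons, List.sum_cons]
    rcases eq_or_ne l [] with rfl | hl'
    · rw [List.length_nil] at h
      simp [recs, nextState_end S P first (by omega : st.seen + 1 = 2 ^ st.m)]
    · have hlpos : 0 < l.length := List.length_pos_iff.mpr hl'
      have h1 := nextState_mid S P first (st := st) (by omega) x.2
      have h2 := ih (t + 1) (nextState S P first st x.2) hl' (by rw [h1]; dsimp only; omega)
      rw [h2, h1]
      simp only [add_assoc]

variable {S P first} {q : ℕ → ℝ} {x : ℝ}

theorem sum_abs_recs_le (hq : ∑ i ∈ Finset.range P.T, |q i - x| ≤ P.C) {t : ℕ}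
    {l : List (Bool × Bool)} (ht : t + l.length ≤ P.T) (st : State) :
    ((recs S P first t st l).map fun r => |q r.t - x|).sum ≤ P.C := by
  rw [sum_recs_t S P first l t st fun i => |q i - x|]
  refine le_trans ?_ hq
  rw [Finset.sum_image (s := Finset.range l.length) (g := fun i => t + i)
    (f := fun i => |q i - x|) (fun a _ b _ h => by simpa using h) |>.symm]
  refine Finset.sum_le_sum_of_subset_of_nonneg ?_ fun _ _ _ => abs_nonneg _
  intro i hi
  simp only [Finset.mem_image, Finset.mem_range] at hi ⊢
  omega

theorem sum_recs_outcome_mem (R : List Rec) :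
    (R.map fun r : Rec => outcome r.y).sum ∈ Set.Icc (0 : ℝ) R.length :=
  ⟨List.sum_nonneg (by simpa using fun (r : Rec) _ => (outcome_mem r.y).1),
    sum_list_le_length fun r _ => (outcome_mem r.y).2⟩

/-- The average outcome of an epoch is close to `x`. -/
theorem abs_average_sub_le (hι : 1 ≤ P.ι) (hq01 : ∀ t, q t ∈ Set.Icc (0 : ℝ) 1)
    (R : List Rec) {m : ℕ} (hlen : R.length = 2 ^ m) (hm : ∀ r ∈ R, r.st.m = m)
    (hq : (R.map fun r => |q r.t - x|).sum ≤ P.C)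
    (hctl : |(R.map (deviate q m 0 0)).sum| ≤
      2 * √(P.ι / 16 * (R.map (varBound m 0 0)).sum) + P.ι / 16) :
    |(R.map fun r => outcome r.y).sum / 2 ^ m - x| ≤ radius P (2 ^ m) := by
  have hlen' : (R.length : ℝ) = 2 ^ m := by exact_mod_cast hlen
  have hdev : (R.map (deviate q m 0 0)).sum = (R.map fun r => outcome r.y - q r.t).sum := by
    refine congrArg List.sum (List.map_congr_left fun r hr => ?_)
    simp [deviate, hm r hr, coinFactor, outcomeFactor]
  have hvar : (R.map (varBound m 0 0)).sum = 2 ^ m := by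
    have : R.map (varBound m 0 0) = R.map fun _ => (1 : ℝ) :=
      List.map_congr_left fun r hr => by simp [varBound, hm r hr]
    rw [this]
    simp [hlen']
  have hn : (0 : ℝ) < 2 ^ m := by positivity
  rw [hdev, hvar] at hctl
  have hd : |(R.map fun r => outcome r.y - q r.t).sum| ≤ 2 ^ m := by
    rw [← hlen', abs_le]
    have h1 : ∀ r : Rec, |outcome r.y - q r.t| ≤ 1 := fun r => by
      rw [abs_sub_comm]; exact abs_sub_outcome_le (hq01 _) _
    exact ⟨length_le_sum_list fun r _ => (abs_le.mp (h1 r)).1,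
      sum_list_le_length fun r _ => (abs_le.mp (h1 r)).2⟩
  have hsplit : (R.map fun r => outcome r.y).sum - 2 ^ m * x =
      (R.map fun r => outcome r.y - q r.t).sum + (R.map fun r => q r.t - x).sum := by
    have h1 : (R.map fun _ => x).sum = 2 ^ m * x := by simp [hlen']
    rw [← h1]
    simp only [sum_map_eq_sum_get, ← Finset.sum_add_distrib, ← Finset.sum_sub_distrib]
    exact Finset.sum_congr rfl fun i _ => by ring
  have hq' : |(R.map fun r => q r.t - x).sum| ≤ P.C := by
    refine le_trans ?_ hq
    simp only [sum_map_eq_sum_get]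
    exact Finset.abs_sum_le_sum_abs _ _
  unfold radius
  set n : ℝ := 2 ^ m
  set s := √(P.ι * n)
  have hs0 : 0 ≤ s := Real.sqrt_nonneg _
  have hs2 : s ^ 2 = P.ι * n := Real.sq_sqrt (by positivity)
  have hs16 : √(P.ι / 16 * n) = s / 4 := by
    rw [show P.ι / 16 * n = P.ι * n / 4 ^ 2 by ring, Real.sqrt_div (by positivity),
      Real.sqrt_sq (by norm_num)]
  rw [hs16] at hctl
  -- The additive `ι / 16` would spoil a radius of the form `√(ι / n)` only in epochs with `n ≤ s`,
  -- that is `n ≤ ι`; there the trivial bound `n` is good enough.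
  have hs : |(R.map fun r => outcome r.y - q r.t).sum| ≤ s := by
    rcases le_total n s with h | h
    · exact hd.trans h
    · have : P.ι ≤ s := by
        by_contra! hlt
        nlinarith
      linarith
  have hroot : √(P.ι / n) = s / n := by
    rw [show P.ι / n = P.ι * n / n ^ 2 by field_simp, Real.sqrt_div (by positivity),
      Real.sqrt_sq hn.le]
  rw [hroot, ← add_div, show (R.map fun r => outcome r.y).sum / n - x =
    ((R.map fun r => outcome r.y).sum - n * x) / n by field_simp, hsplit, abs_div,
    abs_of_pos hn]
  exact div_le_div_of_nonneg_right ((abs_add_le _ _).trans (add_le_add hs hq')) hn.le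

/-- All deviations of the epochs from `m₀` on are small. -/
def Concentrated (q : ℕ → ℝ) (m₀ M D : ℕ) (x : ℝ) (R : List Rec) : Prop :=
  ∀ m, m₀ ≤ m → m < M → ∀ j < D, ∀ k : Fin 4,
    |(R.map (deviate q m j k)).sum| ≤ 2 * √(x * (R.map (varBound m j k)).sum) + x

theorem sum_map_eq_zero {R : List Rec} {f : Rec → ℝ} (h : ∀ r ∈ R, f r = 0) :
    (R.map f).sum = 0 := List.sum_eq_zero (by simpa using h)

theorem deviate_of_ne {m j : ℕ} {k : Fin 4} {r : Rec} (h : r.st.m ≠ m) : deviate q m j k r = 0 :=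
  if_neg h

theorem varBound_of_ne {m j : ℕ} {k : Fin 4} {r : Rec} (h : r.st.m ≠ m) : varBound m j k r = 0 :=
  if_neg h

/-- The deviations of an epoch vanish in all other rounds, so control over the whole game restricts
to the epoch itself, and to the later ones. -/
theorem Concentrated.left {m M D : ℕ} {a : ℝ} {R R' : List Rec}
    (h : Concentrated q m M D a (R ++ R')) (hm : m < M) (hR' : ∀ r ∈ R', m + 1 ≤ r.st.m) :
    ∀ j < D, ∀ k : Fin 4,
      |(R.map (deviate q m j k)).sum| ≤ 2 * √(a * (R.map (varBound m j k)).sum) + a := by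
  intro j hj k
  have h1 := h m le_rfl hm j hj k
  rw [List.map_append, List.map_append, List.sum_append, List.sum_append,
    sum_map_eq_zero (R := R') fun r hr => deviate_of_ne (by have := hR' r hr; omega),
    sum_map_eq_zero (R := R') fun r hr => varBound_of_ne (by have := hR' r hr; omega)] at h1
  simpa using h1

theorem Concentrated.right {m M D : ℕ} {a : ℝ} {R R' : List Rec}
    (h : Concentrated q m M D a (R ++ R')) (hR : ∀ r ∈ R, r.st.m = m) :
    Concentrated q (m + 1) M D a R' := by
  intro m' hm' hM j hj k
  have h1 := h m' (by omega) hM j hj k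
  rw [List.map_append, List.map_append, List.sum_append, List.sum_append,
    sum_map_eq_zero (R := R) fun r hr => deviate_of_ne (by have := hR r hr; omega),
    sum_map_eq_zero (R := R) fun r hr => varBound_of_ne (by have := hR r hr; omega)] at h1
  simpa using h1

/-- Already `√(ι / s)` is at least `1 / T`; this ensures that logarithmically many doublings of the
radius exhaust `[0,1]`. -/
theorem one_le_mul_radius (hι : 1 ≤ P.ι) (hC : 0 ≤ P.C) (hT : 1 ≤ P.T) {s : ℝ} (hs : 0 < s)
    (hsT : s ≤ P.T) : 1 ≤ P.T * radius P s := by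
  have hT' : (1 : ℝ) ≤ P.T := by exact_mod_cast hT
  have h1 : (P.T : ℝ)⁻¹ ≤ √(P.ι / s) := by
    refine Real.le_sqrt_of_sq_le ?_
    calc ((P.T : ℝ)⁻¹) ^ 2 ≤ (P.T : ℝ)⁻¹ := by
          have h2 := inv_le_one_of_one_le₀ hT'
          have h3 : 0 ≤ (P.T : ℝ)⁻¹ := by positivity
          nlinarith
      _ ≤ s⁻¹ := inv_anti₀ hs hsT
      _ ≤ P.ι / s := by rw [← one_div]; gcongr
  have h2 : 0 ≤ P.C / s := by positivity
  calc 1 = P.T * (P.T : ℝ)⁻¹ := by field_simp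
    _ ≤ _ := by unfold radius; gcongr; linarith

/-- The state at the end of a full epoch. -/
theorem foldl_epoch (hι : 1 ≤ P.ι) (hq01 : ∀ t, q t ∈ Set.Icc (0 : ℝ) 1)
    (hq : ∑ i ∈ Finset.range P.T, |q i - x| ≤ P.C) {st : State} (hseen : st.seen = 0)
    (hsum : st.ySum = 0) {l : List (Bool × Bool)} (hl : l.length = 2 ^ st.m) {t : ℕ}
    (ht : t + l.length ≤ P.T)
    (hctl : |((recs S P first t st l).map (deviate q st.m 0 0)).sum| ≤
      2 * √(P.ι / 16 * ((recs S P first t st l).map (varBound st.m 0 0)).sum) + P.ι / 16) :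
    ∃ ybar ∈ Set.Icc (0 : ℝ) 1, |ybar - x| ≤ radius P (2 ^ st.m) ∧
      l.foldl (fun st x => nextState S P first st x.2) st =
        ⟨st.m + 1, 0, 0, (initExperts (buildPartition P (st.m + 1) ybar).val).val⟩ := by
  have hpos : 0 < 2 ^ st.m := by positivity
  have hne : l ≠ [] := List.length_pos_iff.mp (by omega)
  have h1 := foldl_nextState S P first l t st hne (by omega)
  have hRlen := length_recs S P first l t st
  have hR := m_eq_of_mem_recs S P first l t st (by omega)
  rw [hsum, zero_add] at h1
  refine ⟨_, ?_, ?_, h1⟩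
  · obtain ⟨h2, h3⟩ := sum_recs_outcome_mem (recs S P first t st l)
    have h4 : ((recs S P first t st l).length : ℝ) = 2 ^ st.m := by
      rw [hRlen, hl]; push_cast; rfl
    rw [h4] at h3
    exact ⟨by positivity, div_le_one_of_le₀ h3 (by positivity)⟩
  · exact abs_average_sub_le hι hq01 _ (by rw [hRlen, hl]) hR (sum_abs_recs_le hq ht st) hctl

/-- Induction on the number `k` of epochs left before `M`. The relation `t + 2 = 2 ^ m` says that
epoch `m` begins in round `t`. A full epoch also provides the accurate average that the next one
starts from. -/
theorem calError_epochs_le {ε : ℝ} (hS : Sound ε S) (hε0 : 0 ≤ ε) (hε : ε ≤ 1) (hι : 1 ≤ P.ι)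
    (hC : 0 ≤ P.C) (hT : 1 ≤ P.T)
    (hq01 : ∀ t, q t ∈ Set.Icc (0 : ℝ) 1) (hq : ∑ i ∈ Finset.range P.T, |q i - x| ≤ P.C)
    {D M : ℕ} (hM : P.T + 2 ≤ 2 ^ M) (hD : 0 < D)
    (hsize : ∀ m ybar, 1 ≤ m → 2 ^ m ≤ 2 * P.T → ybar ∈ Set.Icc (0 : ℝ) 1 →
      2 * (buildPartition P m ybar).val.length ≤ D ∧
      logSize (buildPartition P m ybar).val.length m ≤ P.ι) (k : ℕ) :
    ∀ (m t : ℕ) (ybar : ℝ) (l : List (Bool × Bool)), m + k = M → 2 ≤ m → t + 2 = 2 ^ m →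
      t + l.length ≤ P.T → ybar ∈ Set.Icc (0 : ℝ) 1 → |ybar - x| ≤ radius P (2 ^ (m - 1)) →
      Concentrated q m M D (P.ι / 16) (recs S P first t
        ⟨m, 0, 0, (initExperts (buildPartition P m ybar).val).val⟩ l) →
      calError 2 (transcript (recs S P first t
        ⟨m, 0, 0, (initExperts (buildPartition P m ybar).val).val⟩ l)) ≤
      k * (10 ^ 10 * (bandCount P + 1) * (P.ι + mainTerm P)) := by
  have hB := mainTerm_nonneg (P := P) (by linarith) hC
  induction k with
  | zero =>
    intro m t ybar l hmk hm ht htl hy hrad hctl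
    -- Epoch `M` would begin in round `2 ^ M - 2 ≥ T`, so no rounds are left.
    obtain rfl : m = M := by omega
    have : l = [] := List.length_eq_zero_iff.mp (by omega)
    subst this
    simp [recs, transcript, calError]
  | succ k ih =>
    intro m t ybar l hmk hm ht htl hy hrad hctl
    rcases eq_or_ne l [] with rfl | hl
    · simp only [recs, transcript, calError, List.map_nil, List.toFinset_nil, Finset.sum_empty]
      positivity
    have hlpos : 0 < l.length := List.length_pos_iff.mpr hl
    set st : State := ⟨m, 0, 0, (initExperts (buildPartition P m ybar).val).val⟩ with hst
    obtain ⟨m', rfl⟩ : ∃ m', m = m' + 1 := ⟨m - 1, by omega⟩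
    have hpow : 2 ^ (m' + 1) = 2 * 2 ^ m' := by ring
    obtain ⟨h1, h2⟩ := hsize (m' + 1) ybar (by omega) (by omega) hy
    have hsT : ((2 : ℝ) ^ (m' + 1 - 1)) ≤ P.T := by
      rw [Nat.add_sub_cancel]
      exact_mod_cast (by omega : 2 ^ m' ≤ P.T)
    have hrT := one_le_mul_radius hι hC hT (by positivity) hsT
    have hE : ∀ l' : List (Bool × Bool), t + l'.length ≤ P.T → l'.length ≤ 2 ^ (m' + 1) →
        (∀ j < D, ∀ k : Fin 4,
          |((recs S P first t st l').map (deviate q (m' + 1) j k)).sum| ≤ 2 * √(P.ι / 16 *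
            ((recs S P first t st l').map (varBound (m' + 1) j k)).sum) + P.ι / 16) →
        calError 2 (transcript (recs S P first t st l')) ≤
          10 ^ 10 * (bandCount P + 1) * (P.ι + mainTerm P) := fun l' ht' hlen' hc' =>
      epoch_calError_le hS hε0 hε hι hC hT hm hy hrT hrad h2 l' hlen' t rfl rfl rfl
        (sum_abs_recs_le hq ht' st) fun j hj k => hc' j (by omega) k
    have hpos : 0 ≤ 10 ^ 10 * ((bandCount P : ℝ) + 1) * (P.ι + mainTerm P) := by positivity
    rcases lt_or_ge l.length (2 ^ (m' + 1)) with hlt | hge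
    · have h3 := hE l htl hlt.le fun j hj k => hctl _ le_rfl (by omega) j hj k
      have h4 : (0 : ℝ) ≤ k := Nat.cast_nonneg k
      push_cast
      nlinarith
    · set l₁ := l.take (2 ^ (m' + 1)) with hl₁
      set l₂ := l.drop (2 ^ (m' + 1)) with hl₂
      have hll : l = l₁ ++ l₂ := (List.take_append_drop _ _).symm
      have hlen₁ : l₁.length = 2 ^ (m' + 1) := by rw [hl₁, List.length_take]; omega
      have hlen₂ : l.length = l₁.length + l₂.length := by rw [hll, List.length_append]
      rw [hll, recs_append] at hctl ⊢
      have hR₁ := m_eq_of_mem_recs S P first l₁ t st (by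
        rw [hlen₁]; simp [st])
      have hR₂ : ∀ r ∈ recs S P first (t + l₁.length)
          (l₁.foldl (fun st x => nextState S P first st x.2) st) l₂, m' + 1 + 1 ≤ r.st.m := by
        intro r hr
        refine le_trans ?_ (m_le_of_mem_recs S P first _ _ _ r hr)
        rw [foldl_nextState S P first l₁ t st (List.length_pos_iff.mp (by omega))
          (by rw [hlen₁]; simp [st])]
      have hc₁ := hctl.left (by omega) hR₂
      have hc₂ := hctl.right hR₁
      obtain ⟨ybar', hy', hrad', hfold⟩ := foldl_epoch hι hq01 hq (st := st) rfl rfl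
        hlen₁ (t := t) (by omega) (hc₁ 0 hD 0)
      rw [hfold] at hc₂ ⊢
      have h3 := ih (m' + 1 + 1) (t + l₁.length) ybar' l₂ (by omega) (by omega)
        (by rw [hlen₁, pow_succ 2 (m' + 1)]; omega) (by omega) hy' (by simpa using hrad') hc₂
      have h4 := hE l₁ (by omega) hlen₁.le hc₁
      have h5 := calError_append_le (transcript (recs S P first t st l₁))
        (transcript (recs S P first (t + l₁.length) ⟨m' + 1 + 1, 0, 0,
          (initExperts (buildPartition P (m' + 1 + 1) ybar').val).val⟩ l₂))
      have h6 : ∀ R R', transcript (R ++ R') = transcript R ++ transcript R' := fun R R' =>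
        List.map_append
      rw [h6]
      push_cast
      have h7 : st.m = m' + 1 := rfl
      rw [h7]
      linarith

/-- The first epoch has two rounds with arbitrary predictions and costs at most `2`; its average
outcome starts the chain of epochs. -/
theorem calError_game_le {ε : ℝ} (hS : Sound ε S) (hε0 : 0 ≤ ε) (hε : ε ≤ 1) (hι : 1 ≤ P.ι)
    (hC : 0 ≤ P.C) (hT : 1 ≤ P.T)
    (hfirst : ∀ t, first t ∈ Set.Icc (0 : ℝ) 1)
    (hq01 : ∀ t, q t ∈ Set.Icc (0 : ℝ) 1) (hq : ∑ i ∈ Finset.range P.T, |q i - x| ≤ P.C)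
    {D k : ℕ} (hM : P.T + 2 ≤ 2 ^ (2 + k)) (hD : 0 < D)
    (hsize : ∀ m ybar, 1 ≤ m → 2 ^ m ≤ 2 * P.T → ybar ∈ Set.Icc (0 : ℝ) 1 →
      2 * (buildPartition P m ybar).val.length ≤ D ∧
      logSize (buildPartition P m ybar).val.length m ≤ P.ι) (l : List (Bool × Bool))
    (hl : l.length = P.T)
    (hctl : Concentrated q 1 (2 + k) D (P.ι / 16) (gameRecs S P first l)) :
    calError 2 (transcript (gameRecs S P first l)) ≤
      2 + k * (10 ^ 10 * (bandCount P + 1) * (P.ι + mainTerm P)) := by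
  have hB := mainTerm_nonneg (P := P) (by linarith) hC
  have hpos : 0 ≤ 10 ^ 10 * ((bandCount P : ℝ) + 1) * (P.ι + mainTerm P) := by positivity
  unfold gameRecs at *
  have h1 : ∀ l' : List (Bool × Bool), l'.length ≤ 2 →
      calError 2 (transcript (recs S P first 0 initState l')) ≤ 2 := by
    intro l' hl'
    refine (calError_le_length _ fun z hz => ?_).trans ?_
    · obtain ⟨r, hr, rfl⟩ := List.mem_map.mp hz
      have hm := m_eq_of_mem_recs S P first l' 0 initState (by simpa [initState] using hl') r hr
      have hp := p_eq_of_mem_recs S P first l' 0 initState r hr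
      rw [Rec.z, hp, plan_of_eq S first hm]
      simpa using hfirst _
    · rw [transcript, List.length_map, length_recs]
      exact_mod_cast hl'
  rcases le_or_gt l.length 2 with h2 | h2
  · have := h1 l h2
    have : 0 ≤ k * (10 ^ 10 * ((bandCount P : ℝ) + 1) * (P.ι + mainTerm P)) := by positivity
    linarith
  · set l₁ := l.take 2 with hl₁
    set l₂ := l.drop 2 with hl₂
    have hll : l = l₁ ++ l₂ := (List.take_append_drop _ _).symm
    have hlen₁ : l₁.length = 2 := by rw [hl₁, List.length_take]; omega
    have hlen₂ : l.length = l₁.length + l₂.length := by rw [hll, List.length_append]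
    rw [hll, recs_append] at hctl ⊢
    have hR₁ := m_eq_of_mem_recs S P first l₁ 0 initState (by rw [hlen₁]; simp [initState])
    have hR₂ : ∀ r ∈ recs S P first (0 + l₁.length)
        (l₁.foldl (fun st x => nextState S P first st x.2) initState) l₂, 1 + 1 ≤ r.st.m := by
      intro r hr
      refine le_trans ?_ (m_le_of_mem_recs S P first _ _ _ r hr)
      rw [foldl_nextState S P first l₁ 0 initState (List.length_pos_iff.mp (by omega))
        (by rw [hlen₁]; simp [initState])]
      simp [initState]
    have hc₁ := hctl.left (by omega) hR₂
    have hc₂ := hctl.right hR₁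
    obtain ⟨ybar', hy', hrad', hfold⟩ := foldl_epoch hι hq01 hq (st := initState) rfl rfl
      (by rw [hlen₁]; simp [initState]) (t := 0) (by omega) (hc₁ 0 hD 0)
    rw [hfold] at hc₂ ⊢
    have h3 := calError_epochs_le hS hε0 hε hι hC hT hq01 hq hM hD hsize k 2 (0 + l₁.length)
      ybar' l₂ (by omega) le_rfl (by omega) (by omega) hy' (by simpa [initState] using hrad') hc₂
    have h4 := h1 l₁ (by omega)
    have h5 := calError_append_le (transcript (recs S P first 0 initState l₁))
      (transcript (recs S P first (0 + l₁.length) ⟨2, 0, 0,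
        (initExperts (buildPartition P 2 ybar').val).val⟩ l₂))
    have h6 : ∀ R R', transcript (R ++ R') = transcript R ++ transcript R' := fun R R' =>
      List.map_append
    rw [h6]
    have h7 : initState.m = 1 := rfl
    rw [h7]
    linarith

end Epochs


/-! ### The bound holds with high probability -/

theorem deviation_spec (T : ℕ) {q : ℕ → ℝ} (hq : ∀ t, q t ∈ Set.Icc (0 : ℝ) 1) :
    0 ≤ deviation T q ∧ deviation T q ≤ T ∧
      ∃ x, ∑ t ∈ Finset.range T, |q t - x| ≤ deviation T q := by
  have hbdd : BddBelow (Set.range fun x : Set.Icc (0 : ℝ) 1 =>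
      ∑ t ∈ Finset.range T, |q t - (x : ℝ)|) :=
    ⟨0, by rintro _ ⟨x, rfl⟩; exact Finset.sum_nonneg fun _ _ => abs_nonneg _⟩
  refine ⟨Real.iInf_nonneg fun x => Finset.sum_nonneg fun _ _ => abs_nonneg _, ?_, ?_⟩
  · refine (ciInf_le hbdd ⟨0, by simp⟩).trans ?_
    have h1 : ∑ t ∈ Finset.range T, |q t - 0| ≤ ∑ _t ∈ Finset.range T, (1 : ℝ) :=
      Finset.sum_le_sum fun t _ => by
        rw [sub_zero, abs_of_nonneg (hq t).1]; exact (hq t).2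
    simpa using h1
  · obtain ⟨x, -, hmin⟩ := (isCompact_Icc (a := (0 : ℝ)) (b := 1)).exists_isMinOn ⟨0, by simp⟩
      (f := fun x => ∑ t ∈ Finset.range T, |q t - x|) (by fun_prop)
    exact ⟨x, le_ciInf fun y => hmin y.2⟩

theorem log_two_le {T : ℕ} (hT : 2 ≤ T) : Real.log 2 ≤ Real.log T :=
  Real.log_le_log (by norm_num) (by exact_mod_cast hT)

theorem bandCount_le {P : Params} (hT : 2 ≤ P.T) : (bandCount P : ℝ) ≤ 3 * Real.log P.T := by
  have h1 := log_two_le hT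
  have h2 := Real.log_two_gt_d9
  have h3 : Real.logb 2 P.T ≤ 3 / 2 * Real.log P.T := by
    rw [Real.logb, div_le_iff₀ (by linarith)]
    nlinarith
  have h4 := Nat.ceil_lt_add_one (a := Real.logb 2 P.T)
    (Real.logb_nonneg (by norm_num) (by exact_mod_cast (by omega : 1 ≤ P.T)))
  unfold bandCount
  linarith

theorem bandCount_le_T (P : Params) : bandCount P ≤ P.T := by
  rcases Nat.eq_zero_or_pos P.T with h | h
  · simp [bandCount, h]
  refine Nat.ceil_le.mpr ?_
  rw [Real.logb_le_iff_le_rpow (by norm_num) (by exact_mod_cast h), Real.rpow_natCast]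
  exact_mod_cast Nat.lt_two_pow_self.le

theorem mainTerm_le {P : Params} (hι : 1 ≤ P.ι) (hC : 0 ≤ P.C) (hT : 1 ≤ P.T) (hCT : P.C ≤ P.T) :
    mainTerm P ≤ P.T * P.ι := by
  have hT' : (1 : ℝ) ≤ P.T := by exact_mod_cast hT
  refine le_of_cube_le (by positivity) ?_
  rw [mainTerm_cube (by linarith) hC]
  calc P.C * P.ι ^ 2 ≤ (P.T : ℝ) ^ 3 * P.ι ^ 3 := by
        gcongr
        · exact hCT.trans (le_self_pow₀ hT' (by norm_num))
        · norm_num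
    _ = (P.T * P.ι) ^ 3 := by ring

/-- A bound for the number of experts that is polynomial in `T`. -/
def expertBound (T : ℕ) : ℕ := 2 * ((T + 1) * (4 * T + 9))

theorem expertBound_le {T : ℕ} (hT : 2 ≤ T) : expertBound T ≤ 26 * T ^ 2 := by
  unfold expertBound
  nlinarith

theorem two_mul_length_le {P : Params} (hι : 1 ≤ P.ι) (hC : 0 ≤ P.C) (hT : 1 ≤ P.T)
    (hCT : P.C ≤ P.T) {m : ℕ} (hm : 1 ≤ m) {ybar : ℝ} (hy : ybar ∈ Set.Icc (0 : ℝ) 1) :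
    2 * (buildPartition P m ybar).val.length ≤ expertBound P.T := by
  have h1 := length_buildPartition_mul_le hι hC hm hy
  have h2 := mainTerm_le hι hC hT hCT
  have h3 : (bandCount P : ℝ) ≤ P.T := by exact_mod_cast bandCount_le_T P
  have h4 : ((buildPartition P m ybar).val.length : ℝ) * P.ι ≤
      ((P.T + 1) * (4 * P.T + 9)) * P.ι := by
    calc _ ≤ _ := h1
      _ ≤ (4 * P.T + 9) * (P.ι + P.T * P.ι) := by
          have := mainTerm_nonneg (P := P) (by linarith) hC
          gcongr
      _ = _ := by ring
  have h5 := le_of_mul_le_mul_right h4 (by linarith)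
  unfold expertBound
  exact Nat.mul_le_mul_left 2 (by exact_mod_cast h5)

theorem logSize_le {T N m : ℕ} (hT : 2 ≤ T) (hN : 2 * N ≤ expertBound T) (hm : 2 ^ m ≤ 2 * T) :
    logSize N m ≤ 9 * Real.log T := by
  have hlog := log_two_le hT
  have h2 := Real.log_two_gt_d9
  rcases Nat.eq_zero_or_pos N with rfl | hpos
  · simp only [logSize, Nat.cast_zero, mul_zero, zero_mul, Real.log_zero]
    linarith
  have h1 : 2 * N * 2 ^ m ≤ T ^ 9 := by
    calc 2 * N * 2 ^ m ≤ 26 * T ^ 2 * (2 * T) :=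
          Nat.mul_le_mul (hN.trans (expertBound_le hT)) hm
      _ ≤ T ^ 6 * T ^ 3 := by
          have : 2 ^ 6 ≤ T ^ 6 := Nat.pow_le_pow_left hT 6
          have h3 : 26 * T ^ 2 * (2 * T) = 52 * T ^ 3 := by ring
          rw [h3]
          exact Nat.mul_le_mul_right _ (by omega)
      _ = T ^ 9 := by ring
  rw [logSize, ← Nat.cast_ofNat (n := 9), ← Real.log_pow]
  exact Real.log_le_log (by positivity) (by exact_mod_cast h1)

theorem plan_pr_mem {ε : ℝ} {S : Subroutines} (hS : Sound ε S) (first : ℕ → ℝ) (st : State) :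
    (plan S first st).val.pr ∈ Set.Icc (0 : ℝ) 1 := by
  by_cases h : st.m = 1
  · rw [plan_of_eq S first h]; simp
  · rw [plan_of_ne S first h]; exact (basePlan_spec hS _ _).1

theorem varBound_mem {m j : ℕ} {k : Fin 4} {r : Rec} (h : r.p.pr ∈ Set.Icc (0 : ℝ) 1) :
    varBound m j k r ∈ Set.Icc (0 : ℝ) 1 := by
  unfold varBound
  split_ifs
  · simp
  · exact ⟨Plan.prob_nonneg h _, Plan.prob_le_one h _⟩
  · simp

theorem Controlled.concentrated {q : ℕ → ℝ} {T M D : ℕ} {a : ℝ} {R : List Rec}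
    (h : Controlled q T M D a R) (ha : 1 ≤ a) (hT : 1 ≤ T) (hR : R.length ≤ T)
    (hpr : ∀ r ∈ R, r.p.pr ∈ Set.Icc (0 : ℝ) 1) (m₀ : ℕ) : Concentrated q m₀ M D a R := by
  intro m _ hm j hj k
  refine abs_le_of_scales ha
    (List.sum_nonneg (by simpa using fun r hr => (varBound_mem (hpr r hr)).1))
    ((sum_list_le_length fun r hr => (varBound_mem (hpr r hr)).2).trans (by exact_mod_cast hR)) hT
    fun σ i hi => ?_
  refine le_trans (le_of_eq ?_) (h m hm j hj k σ i hi)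
  simp only [sum_map_eq_sum_get, Finset.sum_sub_distrib, Finset.mul_sum]

theorem one_sub_le_toOuterMeasure {α : Type*} (μ : PMF α) {s b : Set α} {δ : ℝ} (hδ : 0 ≤ δ)
    (hb : μ.toOuterMeasure b ≤ ENNReal.ofReal δ) (h : ∀ a ∈ μ.support, a ∉ b → a ∈ s) :
    ENNReal.ofReal (1 - δ) ≤ μ.toOuterMeasure s := by
  have h1 : μ.toOuterMeasure (s ∪ b) = 1 := by
    rw [PMF.toOuterMeasure_apply_eq_one_iff]
    intro a ha
    by_cases hab : a ∈ b
    · exact Or.inr hab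
    · exact Or.inl (h a ha hab)
  rw [ENNReal.ofReal_sub _ hδ, ENNReal.ofReal_one, tsub_le_iff_right, ← h1]
  exact (MeasureTheory.measure_union_le s b).trans (by gcongr)

/-- Here `256 = 16 · 16`: one factor offsets the `1/16` in the deviation level, the other makes each
failure probability at most `(δ / T)^16`, against at most `416 T^4 ≤ T^16` events. -/
theorem union_bound_le {T M : ℕ} {δ ι : ℝ} (hT : 2 ≤ T) (hδ : 0 < δ) (hδ1 : δ < 1)
    (hι : 256 * Real.log (T / δ) ≤ ι) (hM : M ≤ T + 2) :
    ((M * expertBound T * 4 * 2 * T : ℕ) : ℝ) * Real.exp (-(ι / 16)) ≤ δ := by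
  have hT0 : (0 : ℝ) < T := by exact_mod_cast (by omega : 0 < T)
  have h1 : Real.exp (-(ι / 16)) ≤ (δ / T) ^ 16 := by
    have h2 : Real.exp (-(16 * Real.log (T / δ))) = (δ / T) ^ 16 := by
      rw [show -(16 * Real.log (T / δ)) = ((16 : ℕ) : ℝ) * Real.log (δ / T) by
        rw [← inv_div, Real.log_inv]; push_cast; ring, ← Real.log_pow, Real.exp_log (by positivity)]
    rw [← h2]
    exact Real.exp_le_exp.mpr (by linarith)
  have h2 : M * expertBound T * 4 * 2 * T ≤ T ^ 16 := by
    calc M * expertBound T * 4 * 2 * T ≤ (2 * T) * (26 * T ^ 2) * 4 * 2 * T := by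
          have := expertBound_le hT
          have : M ≤ 2 * T := by omega
          gcongr
      _ = 416 * T ^ 4 := by ring
      _ ≤ T ^ 12 * T ^ 4 := by
          have : 2 ^ 12 ≤ T ^ 12 := Nat.pow_le_pow_left hT 12
          exact Nat.mul_le_mul_right _ (by omega)
      _ = T ^ 16 := by ring
  calc _ ≤ (T : ℝ) ^ 16 * (δ / T) ^ 16 := by
        gcongr
        exact_mod_cast h2
    _ = δ ^ 16 := by field_simp
    _ ≤ δ := pow_le_of_le_one hδ.le hδ1.le (by norm_num)

theorem log_le_log_div {T : ℕ} {δ : ℝ} (hT : 1 ≤ T) (hδ : 0 < δ) (hδ1 : δ < 1) :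
    Real.log T ≤ Real.log (T / δ) := by
  have hT0 : (0 : ℝ) < T := by exact_mod_cast hT
  exact Real.log_le_log hT0 (le_div_self hT0.le hδ hδ1.le)

theorem prob_calError_le {ε : ℝ} {S : Subroutines} (hS : Sound ε S) (hε0 : 0 ≤ ε) (hε : ε ≤ 1)
    {T : ℕ} {δ ι : ℝ} {q first : ℕ → ℝ} (hT : 2 ≤ T) (hδ : 0 < δ) (hδ1 : δ < 1)
    (hι : 256 * Real.log (T / δ) ≤ ι) (hq : ∀ t, q t ∈ Set.Icc (0 : ℝ) 1)
    (hfirst : ∀ t, first t ∈ Set.Icc (0 : ℝ) 1) :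
    ENNReal.ofReal (1 - δ) ≤ (law S ⟨T, ι, deviation T q⟩ first q T).toOuterMeasure
      {h | calError 2 h ≤ 2 * 10 ^ 11 * (deviation T q ^ ((1 : ℝ) / 3) * ι ^ ((2 : ℝ) / 3) *
        Real.log T ^ 2 + ι * Real.log T ^ 2)} := by
  obtain ⟨hC, hCT, x, hxC⟩ := deviation_spec T hq
  set P : Params := ⟨T, ι, deviation T q⟩ with hP
  have h2 := Real.log_two_gt_d9
  have hlogT := log_two_le hT
  have hlog := log_le_log_div (by omega : 1 ≤ T) hδ hδ1
  have hι16 : 16 ≤ ι := by linarith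
  have hι1 : 1 ≤ P.ι := by simp only [hP]; linarith
  have hB := mainTerm_nonneg (P := P) (by linarith) hC
  have hQ := bandCount_le (P := P) hT
  have hQ0 : (0 : ℝ) ≤ bandCount P := Nat.cast_nonneg _
  rw [law_eq, PMF.toOuterMeasure_map_apply]
  refine one_sub_le_toOuterMeasure _ hδ.le ((prob_not_controlled_le (plan_pr_mem hS first) hq T T
    (2 + bandCount P) (expertBound T) (ι / 16)).trans ?_) fun l hl hctl => ?_
  · rw [← ENNReal.ofReal_natCast, ← ENNReal.ofReal_mul (Nat.cast_nonneg _)]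
    have : bandCount P ≤ T := bandCount_le_T P
    exact ENNReal.ofReal_le_ofReal (union_bound_le hT hδ hδ1 hι (by omega))
  · simp only [Set.mem_ofPred_eq, not_not] at hctl
    have hlen : l.length = T := length_of_mem_support S P first q T hl
    have hconc := hctl.concentrated (by linarith) (by omega)
      (by rw [gameRecs, length_recs, hlen]) (fun r hr => by
        rw [p_eq_of_mem_recs S P first l 0 initState r hr]; exact plan_pr_mem hS first _) 1
    have hM : P.T + 2 ≤ 2 ^ (2 + bandCount P) := by
      have h3 := T_le_two_pow_bandCount (P := P) (by simp only [hP]; omega)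
      have h4 : P.T ≤ 2 ^ bandCount P := by exact_mod_cast h3
      have h5 : 2 ^ (2 + bandCount P) = 4 * 2 ^ bandCount P := by rw [pow_add]; norm_num
      have h6 : 2 ≤ P.T := hT
      omega
    have h3 := calError_game_le hS hε0 hε hι1 hC (by simp only [hP]; omega) hfirst hq hxC hM
      (by unfold expertBound; positivity) (D := expertBound T) (fun m ybar hm hmT hy => by
        have h4 := two_mul_length_le hι1 hC (by simp only [hP]; omega) hCT hm hy
        refine ⟨h4, (logSize_le hT h4 hmT).trans ?_⟩
        simp only [hP]
        linarith) l hlen hconc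
    change calError 2 (transcript (gameRecs S P first l)) ≤
      2 * 10 ^ 11 * (mainTerm P * Real.log T ^ 2 + ι * Real.log T ^ 2)
    refine h3.trans ?_
    have h4 : P.ι = ι := rfl
    have h5 : P.T = T := rfl
    rw [h5] at hQ
    rw [h4]
    -- The square of the logarithm: one factor counts epochs, the other the bands within an epoch.
    have h6 : (bandCount P : ℝ) * (bandCount P + 1) ≤ 15 * Real.log T ^ 2 := by
      nlinarith
    have h7 : (2 : ℝ) ≤ 10 * (ι * Real.log T ^ 2) := by nlinarith
    have h8 := mul_le_mul_of_nonneg_right h6 (by linarith : 0 ≤ ι + mainTerm P)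
    have h9 : 0 ≤ mainTerm P * Real.log T ^ 2 := by positivity
    nlinarith


/-! ### The number of steps of a round -/

theorem mapT_cost_op {α β : Type} (f : α → β) (l : List α) :
    (mapT (fun a => op (f a)) l).cost = 2 * l.length + 1 := by
  induction l with
  | nil => rfl
  | cons a l ih =>
    simp only [mapT, Timed.bind_cost, op_cost, ih, List.length_cons]
    ring

theorem sumT_cost_op {α : Type} (f : α → ℝ) (l : List α) :
    (sumT (fun a => op (f a)) l).cost = 2 * l.length + 1 := by
  induction l with
  | nil => rfl
  | cons a l ih =>
    simp only [sumT, Timed.bind_cost, op_cost, ih, List.length_cons]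
    ring

theorem zipWithT_cost_op_le {α β γ : Type} (f : α → β → γ) (l : List α) (l' : List β) :
    (zipWithT (fun a b => op (f a b)) l l').cost ≤ 2 * l.length + 1 := by
  induction l generalizing l' with
  | nil => cases l' <;> simp [zipWithT]
  | cons a l ih =>
    cases l' with
    | nil => simp [zipWithT]
    | cons b l' =>
      have := ih l'
      simp only [zipWithT, Timed.bind_cost, op_cost, List.length_cons]
      omega

theorem flatMapT_cost_le {α β : Type} (f : α → Timed (List β)) (l : List α) (k : ℕ)
    (h : ∀ a ∈ l, (f a).cost + (f a).val.length ≤ k) :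
    (flatMapT f l).cost ≤ (k + 1) * l.length + 1 := by
  induction l with
  | nil => simp [flatMapT]
  | cons a l ih =>
    have h1 := h a List.mem_cons_self
    have h2 := ih fun b hb => h b (List.mem_cons_of_mem _ hb)
    simp only [flatMapT, Timed.bind_cost, appendT_cost, List.length_cons, mul_add, mul_one]
    omega

theorem potential_cost (es : List Expert) (u : ℝ) :
    (potential es u).cost = 2 * es.length + 1 := sumT_cost_op _ _

theorem locate_cost_le (es : List Expert) (u : ℝ) : (locate es u).cost ≤ es.length + 1 := by
  induction es with
  | nil => simp [locate]
  | cons e es ih =>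
    by_cases h : u ∈ e.cell.toSet
    · simp [locate, h]
    · simp [locate, h]
      omega

theorem search_cost_le (m : ℕ) (es : List Expert) (j i : ℕ) (hj : j ≤ m) :
    (search m es j i).cost ≤ j * (2 * m + 2 * es.length + 3) + 1 := by
  induction j generalizing i with
  | zero => simp [search]
  | succ j ih =>
    have h1 := ih i (by omega)
    have h2 := ih (i + 2 ^ j) (by omega)
    unfold search
    simp only [Timed.bind_cost, pow2_cost, pow2_val, potential_cost, add_mul, one_mul]
    split_ifs <;> omega

theorem bisect_cost (floor : ℝ) (slots : List Slot) (k : ℕ) (l r : ℝ) :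
    (bisect floor slots k l r).cost = k * (2 * slots.length + 2) + 1 := by
  induction k generalizing l r with
  | zero => simp [bisect]
  | succ k ih =>
    unfold bisect
    simp only [Timed.bind_cost, op_cost, sumT_cost_op]
    split_ifs <;> simp only [ih] <;> ring

theorem unifPart_cost (I : Cell) (N : ℕ) : (unifPart I N).cost = 3 * N + 2 := by
  simp only [unifPart, Timed.bind_cost, mapT_cost_op, rangeT_cost, rangeT_val]
  simp
  ring

theorem bandPart_cost_le (B : Cell) (K : ℕ) : (bandPart B K).cost ≤ 3 * K + 3 := by
  by_cases h : B.lo < B.hi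
  · simp [bandPart, h, unifPart_cost]
    omega
  · simp [bandPart, h]

/-- The cells of the two bands of index `q` on both sides of `I`. -/
def bandsT (I : Cell) (r : ℝ) (K q : ℕ) : Timed (List Cell) := do
  let w ← pow2 q
  let L ← op (Cell.clip ⟨I.lo - (2 * (w : ℝ) - 1) * r, I.lo - ((w : ℝ) - 1) * r, true, false⟩)
  let R ← op (Cell.clip ⟨I.hi + ((w : ℝ) - 1) * r, I.hi + (2 * (w : ℝ) - 1) * r, false, true⟩)
  let Ls ← bandPart L K
  let Rs ← bandPart R K
  appendT Ls Rs

theorem bandsT_cost_le (I : Cell) (r : ℝ) (K q : ℕ) :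
    (bandsT I r K q).cost + (bandsT I r K q).val.length ≤ q + 9 * K + 10 := by
  simp only [bandsT, Timed.bind_cost, Timed.bind_val, pow2_cost, pow2_val, op_cost, op_val,
    appendT_cost, appendT_val, bandPart_val, List.length_append]
  set L := Cell.clip
    ⟨I.lo - (2 * ((2 ^ q : ℕ) : ℝ) - 1) * r, I.lo - (((2 ^ q : ℕ) : ℝ) - 1) * r, true, false⟩
  set R := Cell.clip
    ⟨I.hi + (((2 ^ q : ℕ) : ℝ) - 1) * r, I.hi + (2 * ((2 ^ q : ℕ) : ℝ) - 1) * r, false, true⟩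
  have h1 := bandPart_cost_le L K
  have h2 := bandPart_cost_le R K
  have h3 := length_bandCells_le L K
  have h4 := length_bandCells_le R K
  omega

theorem buildPartition_cost_le (P : Params) (m : ℕ) (ybar : ℝ) :
    (buildPartition P m ybar).cost ≤ 2 * m + 5 * innerCount P m ybar + outerCount P +
      (bandCount P + 9 * outerCount P + 11) * (bandCount P + 1) + 2 * bandCount P + 15 := by
  have hr : ((2 ^ (m - 1) : ℕ) : ℝ) = 2 ^ (m - 1) := by push_cast; rfl
  have hs : ((2 ^ m : ℕ) : ℝ) = 2 ^ m := by push_cast; rfl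
  have hN : ⌈innerGrid P ((2 ^ m : ℕ) : ℝ) ((Cell.clip ⟨ybar - 2 * radius P ((2 ^ (m - 1) : ℕ) : ℝ),
      ybar + 2 * radius P ((2 ^ (m - 1) : ℕ) : ℝ), true, true⟩).hi -
      (Cell.clip ⟨ybar - 2 * radius P ((2 ^ (m - 1) : ℕ) : ℝ),
      ybar + 2 * radius P ((2 ^ (m - 1) : ℕ) : ℝ), true, true⟩).lo)⌉₊ = innerCount P m ybar := by
    rw [hr, hs]; rfl
  have h : ∃ (I : Cell) (r : ℝ), (buildPartition P m ybar).cost =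
      m - 1 + 1 + (m + 1 + (1 + (1 + (innerCount P m ybar + 1 + (outerCount P + 1 +
      ((unifPart I (innerCount P m ybar)).cost + (bandCount P + 1 + (bandCount P + 1 + 1 +
      ((flatMapT (bandsT I r (outerCount P)) (List.range (bandCount P + 1))).cost +
      ((unifPart I (innerCount P m ybar)).val.length + 1)))))))))) := by
    refine ⟨Cell.clip ⟨ybar - 2 * radius P ((2 ^ (m - 1) : ℕ) : ℝ),
      ybar + 2 * radius P ((2 ^ (m - 1) : ℕ) : ℝ), true, true⟩,
      radius P ((2 ^ (m - 1) : ℕ) : ℝ), ?_⟩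
    rw [← hN]
    rfl
  obtain ⟨I, r, h⟩ := h
  have h1 : (flatMapT (bandsT I r (outerCount P)) (List.range (bandCount P + 1))).cost ≤
      (bandCount P + 9 * outerCount P + 11) * (bandCount P + 1) + 1 := by
    have h2 := flatMapT_cost_le (bandsT I r (outerCount P)) (List.range (bandCount P + 1))
      (bandCount P + 9 * outerCount P + 10) fun q hq => by
        have h2 := bandsT_cost_le I r (outerCount P) q
        have h3 := List.mem_range.mp hq
        omega
    rwa [List.length_range] at h2
  have h2 : (unifPart I (innerCount P m ybar)).val.length = innerCount P m ybar := by
    simp [unifPart_val, unifCells]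
  rw [h, unifPart_cost, h2]
  omega

theorem initExperts_cost_le (cells : List Cell) :
    (initExperts cells).cost ≤ 5 * cells.length + 2 := by
  simp only [initExperts, Timed.bind_cost, lengthT_cost, lengthT_val]
  have := flatMapT_cost_le (fun J => op
    [(⟨J, 1, 1 / (2 * (cells.length : ℝ)), 0⟩ : Expert),
      ⟨J, -1, 1 / (2 * (cells.length : ℝ)), 0⟩]) cells 3 (by simp)
  omega

theorem basePlan_fast_cost_le (m : ℕ) (es : List Expert) :
    (basePlan fast m es).cost ≤
      m * (2 * m + 2 * es.length + 3) + m + 12 * es.length + 20 := by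
  have h1 := search_cost_le m es m 0 le_rfl
  have h2 := locate_cost_le es
  unfold basePlan
  simp only [Timed.bind_cost, potential_cost]
  split_ifs
  · have := h2 0
    simp only [Timed.bind_cost, op_cost]
    omega
  · simp only [Timed.bind_cost, potential_cost]
    split_ifs
    · have := h2 1
      simp only [Timed.bind_cost, op_cost]
      omega
    · simp only [Timed.bind_cost, op_cost, pow2_cost, potential_cost, fast]
      grind

theorem baseUpdate_fast_cost_le (m : ℕ) (es : List Expert) (p : Plan) (y : Bool) :
    (baseUpdate fast m es p y).cost ≤ 3 * m * (2 * es.length + 2) + m + 7 * es.length + 10 := by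
  unfold baseUpdate
  simp only [Timed.bind_cost, lengthT_cost, lengthT_val, pow2_cost, pow2_val, op_cost,
    mapT_cost_op, fast, bisect_cost]
  refine (Nat.add_le_add_left (Nat.add_le_add_left (Nat.add_le_add_left (Nat.add_le_add_left
    (Nat.add_le_add_left (Nat.add_le_add_left (zipWithT_cost_op_le _ _ _) _) _) _) _) _) _).trans ?_
  simp only [mapT_val, List.length_map]
  omega

/-- `List.zipWith` truncates to the shorter list, so the step count needs no correctness of the
solver. -/
theorem length_baseUpdate_le (S : Subroutines) (m : ℕ) (es : List Expert) (p : Plan) (y : Bool) :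
    (baseUpdate S m es p y).val.length ≤ es.length := by
  simp [baseUpdate, List.length_zipWith]

/-- What holds for the memory after `n` rounds. -/
structure Reachable (P : Params) (n : ℕ) (st : State) : Prop where
  m_pos : 1 ≤ st.m
  seen : st.seen < 2 ^ st.m
  rounds : n + 2 = 2 ^ st.m + st.seen
  ySum : st.ySum ∈ Set.Icc (0 : ℝ) st.seen
  experts : ∃ ybar ∈ Set.Icc (0 : ℝ) 1,
    st.experts.length ≤ 2 * (buildPartition P st.m ybar).val.length

theorem Reachable.average {P : Params} {n : ℕ} {st : State} (h : Reachable P n st)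
    (he : st.seen + 1 = 2 ^ st.m) (y : Bool) :
    (st.ySum + outcome y) / 2 ^ st.m ∈ Set.Icc (0 : ℝ) 1 := by
  obtain ⟨h1, h2⟩ := h.ySum
  obtain ⟨h3, h4⟩ := outcome_mem y
  have h5 : (st.seen : ℝ) + 1 = 2 ^ st.m := by exact_mod_cast he
  exact ⟨by positivity, div_le_one_of_le₀ (by linarith) (by positivity)⟩

/-- The memory is a deterministic function of the outcomes, so these bounds hold for every outcome
sequence. Averages stay in `[0,1]`, which is all that the size bounds for the partition require. -/
theorem reachable_stateAfter (S : Subroutines) (P : Params) (first : ℕ → ℝ) (ys : List Bool) :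
    Reachable P ys.length (stateAfter S P first ys) := by
  induction ys using List.reverseRecOn with
  | nil => exact ⟨le_rfl, by simp [stateAfter, initState], by simp [stateAfter, initState],
      by simp [stateAfter, initState], 0, by simp, by simp [stateAfter, initState]⟩
  | append_singleton ys y ih =>
    have hstep : stateAfter S P first (ys ++ [y]) =
        nextState S P first (stateAfter S P first ys) y := by
      simp [stateAfter, nextState]
    rw [hstep, List.length_append, List.length_singleton]
    set st := stateAfter S P first ys
    have h1 := ih.rounds
    by_cases h : st.seen + 1 = 2 ^ st.m
    · rw [nextState_end S P first h]
      refine ⟨by simp, by simp, ?_, by simp, _, ih.average h y, ?_⟩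
      · dsimp only
        rw [pow_succ]
        omega
      · simp [initExperts_val, length_expertOrder]
    · rw [nextState_mid S P first h]
      obtain ⟨ybar, hy, hlen⟩ := ih.experts
      refine ⟨ih.m_pos, by have := ih.seen; dsimp only; omega, by dsimp only; omega, ?_, ybar, hy,
        ?_⟩
      · obtain ⟨h3, h4⟩ := outcome_mem y
        obtain ⟨h5, h6⟩ := ih.ySum
        push_cast
        exact ⟨by linarith, by linarith⟩
      · refine le_trans ?_ hlen
        unfold midExperts
        split_ifs
        · simp
        · exact length_baseUpdate_le _ _ _ _ _

theorem update_cost_le (S : Subroutines) (P : Params) (st : State) (p : Plan) (y : Bool) {B : ℕ}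
    (hB : (buildPartition P (st.m + 1) ((st.ySum + outcome y) / 2 ^ st.m)).cost +
      5 * (buildPartition P (st.m + 1) ((st.ySum + outcome y) / 2 ^ st.m)).val.length ≤ B ∨
      st.seen + 1 ≠ 2 ^ st.m) :
    (update S P st p y).cost ≤ (baseUpdate S st.m st.experts p y).cost + st.m + B + 6 := by
  set b := buildPartition P (st.m + 1) ((st.ySum + outcome y) / 2 ^ st.m)
  have h1 := initExperts_cost_le b.val
  by_cases h : st.seen + 1 = 2 ^ st.m
  · have h2 := hB.resolve_right (not_not.mpr h)
    have h3 : (update S P st p y).cost ≤ (baseUpdate S st.m st.experts p y).cost + 1 +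
        (1 + (st.m + 1 + (b.cost + ((initExperts b.val).cost + 1)))) := by
      by_cases hm : st.m = 1
      · rw [hm] at h; simp [update, hm, h, b]
      · simp [update, hm, h, b]
    omega
  · have h3 : (update S P st p y).cost ≤ (baseUpdate S st.m st.experts p y).cost + 1 +
        (1 + (st.m + 1 + 1)) := by
      by_cases hm : st.m = 1
      · rw [hm] at h; simp [update, hm, show st.seen ≠ 1 by omega]
      · simp [update, hm, h]
    omega


/-! ### Step counts in terms of `(1 + C)^{1/3}` and `log T` -/

section Cost

variable {P : Params} {m : ℕ} {ybar : ℝ}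

theorem one_le_rpow_third {C : ℝ} (hC : 0 ≤ C) : 1 ≤ (1 + C) ^ ((1 : ℝ) / 3) :=
  Real.one_le_rpow (by linarith) (by norm_num)

theorem outerCount_le (hι : 1 ≤ P.ι) (hC : 0 ≤ P.C) :
    (outerCount P : ℝ) ≤ 2 * (1 + P.C) ^ ((1 : ℝ) / 3) := by
  have h0 : outerGrid P ≤ (1 + P.C) ^ ((1 : ℝ) / 3) := by
    unfold outerGrid
    have : (1 + P.C) / P.ι ≤ 1 + P.C := div_le_self (by linarith) hι
    gcongr
  have h1 := Nat.ceil_lt_add_one (outerGrid_pos (by linarith) hC).le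
  have h2 := one_le_rpow_third hC
  unfold outerCount
  linarith

theorem innerCount_le (hι : 1 ≤ P.ι) (hC : 0 ≤ P.C) (hm : 1 ≤ m)
    (hy : ybar ∈ Set.Icc (0 : ℝ) 1) :
    (innerCount P m ybar : ℝ) ≤ 5 * (1 + P.C) ^ ((1 : ℝ) / 3) := by
  have hι0 : 0 < P.ι := by linarith
  obtain ⟨h0, h1, h2, h3⟩ := inner_spec (radius_pos hι0 hC (by positivity)) hy
  have h4 := innerGrid_cube hι0 (s := 2 ^ m) (by positivity)
    (show 0 ≤ (inner P m ybar).hi - (inner P m ybar).lo by linarith)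
  have h5 := length_inner_sq_le hι hC hm hy
  have h6 := innerGrid_pos hι0 (s := 2 ^ m) (by positivity)
    (show 0 < (inner P m ybar).hi - (inner P m ybar).lo by linarith)
  have h7 := Nat.ceil_lt_add_one h6.le
  have hG := one_le_rpow_third hC
  have hG3 := rpow_third_cube (show 0 ≤ 1 + P.C by linarith)
  unfold innerCount
  set g := innerGrid P (2 ^ m) ((inner P m ybar).hi - (inner P m ybar).lo)
  set G := (1 + P.C) ^ ((1 : ℝ) / 3)
  have h8 : g ≤ 4 * G := by
    refine le_of_cube_le (by positivity) ?_
    have h9 : g ^ 3 * P.ι ≤ (4 * G) ^ 3 * P.ι := by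
      rw [h4, mul_pow, hG3]
      refine h5.trans ?_
      nlinarith
    exact le_of_mul_le_mul_right h9 hι0
  linarith

/-- With `G = (1 + C)^{1/3}` and `Z = 3 log T`, the number of experts is of order `G Z`, and the
dominant products `m d` and `Q K` are at most of order `G Z²`. The constant is divided by `9` to
offset the `3` in `Z`. -/
theorem steps_le {m d Q K N N' G Z : ℝ} (hm0 : 0 ≤ m) (hQ0 : 0 ≤ Q) (hK0 : 0 ≤ K) (hd0 : 0 ≤ d)
    (hZ : 2 ≤ Z) (hG : 1 ≤ G) (hm : m ≤ Z) (hQ : Q ≤ Z) (hK : K ≤ 2 * G) (hN : N ≤ 5 * G)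
    (hN' : N' ≤ 5 * G) (hd : d ≤ 2 * (N + (Q + 1) * (2 * K))) :
    m * (2 * m + 2 * d + 3) + m + 12 * d + 20 + 1 + (3 * m * (2 * d + 2) + m + 7 * d + 10 + m +
      (2 * (m + 1) + 5 * N' + K + (Q + 9 * K + 11) * (Q + 1) + 2 * Q + 15 +
        5 * (N' + (Q + 1) * (2 * K))) + 6) ≤ 10 ^ 4 / 9 * (G * Z ^ 2) := by
  have hGZ : 2 * G ≤ G * Z := by nlinarith
  have hZZ : 2 * (G * Z) ≤ G * Z ^ 2 := by nlinarith
  have hZG : Z ^ 2 ≤ G * Z ^ 2 := by nlinarith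
  have hQK : Q * K ≤ Z * (2 * G) := mul_le_mul hQ hK hK0 (by linarith)
  have hdb : d ≤ 17 * (G * Z) := by linarith
  have hmm : m * m ≤ Z * Z := mul_le_mul hm hm hm0 (by linarith)
  have hQQ : Q * Q ≤ Z * Z := mul_le_mul hQ hQ hQ0 (by linarith)
  have hmd : m * d ≤ Z * (17 * (G * Z)) := mul_le_mul hm hdb hd0 (by linarith)
  have hZ2 : 2 * Z ≤ Z ^ 2 := by nlinarith
  linarith

theorem roundCost_fast_le (hι : 1 ≤ P.ι) (hC : 0 ≤ P.C) (hT : 2 ≤ P.T) (first : ℕ → ℝ)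
    {ys : List Bool} (hys : ys.length < P.T) (y : Bool) :
    (roundCost fast P first ys y : ℝ) ≤
      10 ^ 4 * (1 + P.C) ^ ((1 : ℝ) / 3) * Real.log P.T ^ 2 := by
  have hreach := reachable_stateAfter fast P first ys
  unfold roundCost
  set st := stateAfter fast P first ys
  set p := (plan fast first st).val
  have hplan : (plan fast first st).cost ≤
      st.m * (2 * st.m + 2 * st.experts.length + 3) + st.m + 12 * st.experts.length + 20 := by
    unfold plan
    split_ifs
    · simp only [op_cost]; omega
    · exact basePlan_fast_cost_le _ _
  obtain ⟨ybar, hy, hd⟩ := hreach.experts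
  have hd' := length_buildPartition P st.m ybar
  have hN := innerCount_le hι hC hreach.m_pos hy
  have hK := outerCount_le hι hC
  have hQ := bandCount_le hT
  have hbase := baseUpdate_fast_cost_le st.m st.experts p y
  have hG := one_le_rpow_third hC
  have hlog2 := Real.log_two_gt_d9
  have hlogT := log_two_le hT
  have hm : (st.m : ℝ) ≤ 3 * Real.log P.T := by
    have h1 : 2 ^ st.m ≤ 2 * P.T := by have := hreach.rounds; omega
    have h2 : Real.log (2 ^ st.m) ≤ Real.log (2 * P.T) :=
      Real.log_le_log (by positivity) (by exact_mod_cast h1)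
    rw [Real.log_pow, Real.log_mul (by norm_num) (by positivity)] at h2
    have h3 : (0 : ℝ) ≤ st.m := Nat.cast_nonneg _
    nlinarith
  obtain ⟨N', hN', hupdate⟩ : ∃ N' : ℕ, (N' : ℝ) ≤ 5 * (1 + P.C) ^ ((1 : ℝ) / 3) ∧
      (update fast P st p y).cost ≤ (baseUpdate fast st.m st.experts p y).cost + st.m +
        (2 * (st.m + 1) + 5 * N' + outerCount P +
          (bandCount P + 9 * outerCount P + 11) * (bandCount P + 1) + 2 * bandCount P + 15 +
          5 * (N' + (bandCount P + 1) * (2 * outerCount P))) + 6 := by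
    by_cases h : st.seen + 1 = 2 ^ st.m
    · refine ⟨_, innerCount_le hι hC (by omega : 1 ≤ st.m + 1) (hreach.average h y),
        update_cost_le fast P st p y (Or.inl ?_)⟩
      exact add_le_add (buildPartition_cost_le _ _ _)
        (Nat.mul_le_mul_left 5 (length_buildPartition _ _ _))
    · exact ⟨0, by simpa using by positivity, update_cost_le fast P st p y (Or.inr h)⟩
  have hcost : (plan fast first st).cost + 1 + (update fast P st p y).cost ≤ _ :=
    add_le_add (Nat.add_le_add_right hplan 1) (hupdate.trans
      (Nat.add_le_add_right (Nat.add_le_add_right (Nat.add_le_add_right hbase _) _) _))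
  have hdd := hd.trans (Nat.mul_le_mul_left 2 hd')
  have hcost' := (Nat.cast_le (α := ℝ)).mpr hcost
  have hdd' := (Nat.cast_le (α := ℝ)).mpr hdd
  push_cast at hcost' hdd' ⊢
  have hsteps := steps_le (Nat.cast_nonneg _) (Nat.cast_nonneg _) (Nat.cast_nonneg _)
    (Nat.cast_nonneg _) (by linarith : 2 ≤ 3 * Real.log P.T) hG hm hQ hK hN hN' hdd'
  refine hcost'.trans (le_trans (le_of_eq ?_) (hsteps.trans (le_of_eq ?_)))
  · ring
  · ring

end Cost

end Calib
end

/-! ### The main theorem -/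

theorem mainTheorem2 :
    ∃ c₀ : ℝ, 0 < c₀ ∧ ∀ c₁ : ℝ, c₀ ≤ c₁ → ∃ (A : ℝ) (k : ℕ), 0 < A ∧
      ∀ (T : ℕ) (δ ι : ℝ) (q first : ℕ → ℝ), 2 ≤ T → 0 < δ → δ < 1 →
        c₀ * Real.log (T / δ) ≤ ι → ι ≤ c₁ * Real.log (T / δ) →
        (∀ t, q t ∈ Set.Icc (0 : ℝ) 1) → (∀ t, first t ∈ Set.Icc (0 : ℝ) 1) →
        let C := Calib.deviation T q
        let P : Calib.Params := ⟨T, ι, C⟩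
        let good : Set (List (ℝ × Bool)) :=
          {h | Calib.calError 2 h ≤
            A * (C ^ ((1 : ℝ) / 3) * ι ^ ((2 : ℝ) / 3) * Real.log T ^ 2 + ι * Real.log T ^ 2)}
        (∀ S : Calib.Subroutines, S.Exact →
          ENNReal.ofReal (1 - δ) ≤ (Calib.law S P first q T).toOuterMeasure good) ∧
        ENNReal.ofReal (1 - δ) ≤ (Calib.law Calib.fast P first q T).toOuterMeasure good ∧
        (∀ (ys : List Bool) (y : Bool), ys.length < T →
          (Calib.roundCost Calib.fast P first ys y : ℝ) ≤
            A * (1 + C) ^ ((1 : ℝ) / 3) * Real.log T ^ k) := by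
  -- The value `256` comes from the union bound, and `2 * 10 ^ 11` from the calibration bound; the
  -- latter also exceeds the constant `10 ^ 4` of the step count, whose power of the logarithm is
  -- `2`.
  refine ⟨256, by norm_num, fun c₁ _ => ⟨2 * 10 ^ 11, 2, by norm_num, ?_⟩⟩
  intro T δ ι q first hT hδ hδ1 hι _ hq hfirst C P good
  refine ⟨fun S hS => Calib.prob_calError_le hS.sound le_rfl zero_le_one hT hδ hδ1 hι hq hfirst,
    Calib.prob_calError_le Calib.fast_sound zero_le_one le_rfl hT hδ hδ1 hι hq hfirst,
    fun ys y hys => ?_⟩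
  obtain ⟨hC, -, -⟩ := Calib.deviation_spec T hq
  have h1 := Calib.log_two_le hT
  have h2 := Calib.log_le_log_div (by omega : 1 ≤ T) hδ hδ1
  have h3 := Real.log_two_gt_d9
  have h4 : 0 ≤ (1 + C) ^ ((1 : ℝ) / 3) * Real.log T ^ 2 := by
    have := Calib.one_le_rpow_third hC
    positivity
  have h5 : (Calib.roundCost Calib.fast P first ys y : ℝ) ≤
      10 ^ 4 * (1 + C) ^ ((1 : ℝ) / 3) * Real.log T ^ 2 :=
    Calib.roundCost_fast_le (P := P) (by change 1 ≤ ι; linarith) hC hT first hys y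
  linarith
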